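/- \textbf{Conventions.} All categories have hom-sets in one fixed universe of sets. A model category has all small colimits (and finite limits). A \emph{monoidal model category} is a model category with a closed symmetric monoidal structure satisfying the pushout product axiom and the unit axiom. An adjoint pair $(F,G)$ between model categories is a \emph{Quillen pair} if the right adjoint $G$ preserves fibrations and trivial fibrations, and a \emph{Quillen equivalence} if moreover its total derived functors are adjoint equivalences of homotopy categories. A functor $U\colon\mathcal T\to\mathcal C$ with left adjoint $L$ to a model category $\mathcal C$ \emph{creates a model structure} if $\mathcal T$ has a model structure in which $f$ is a weak equivalence (respectively fibration) if and only if $Uf$ is one, and every cofibrant object of $\mathcal T$ is a retract of a cell object, i.e. of an object obtained from the initial object by a (possibly transfinite) composition of pushouts of morphisms $Lf$ with $f$ a cofibration of $\mathcal C$. Modules are right modules, and model structures on categories of monoids and modules are those created by the forgetful functors to the underlying category. \emph{Quillen invariance holds} for $\mathcal C$ if the forgetful functors create model structures for modules over any monoid in $\mathcal C$ and, for every morphism of monoids $f\colon S\to S'$ that is a weak equivalence in $\mathcal C$, extension and restriction of scalars along $f$ form a Quillen equivalence between $\mathrm{Mod}\text{-}S$ and $\mathrm{Mod}\text{-}S'$.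 \textbf{Theorem.} Let $\mathcal C$ and $\mathcal D$ be monoidal model categories whose unit objects $\mathbb I_{\mathcal C}$, $\mathbb I_{\mathcal D}$ are cofibrant, and let $\lambda\colon\mathcal D\rightleftarrows\mathcal C\colon R$ be a weak monoidal Quillen equivalence: a Quillen equivalence with right adjoint $R$ and a lax monoidal structure $\varphi_{X,Y}\colon RX\wedge RY\to R(X\otimes Y)$, $\nu\colon\mathbb I_{\mathcal D}\to R(\mathbb I_{\mathcal C})$ on $R$ such that (i) for all cofibrant $A,B$ in $\mathcal D$, the map $\tilde\varphi\colon\lambda(A\wedge B)\to\lambda A\otimes\lambda B$ adjoint to $A\wedge B\to R\lambda A\wedge R\lambda B\xrightarrow{\varphi}R(\lambda A\otimes\lambda B)$ is a weak equivalence, and (ii) for some cofibrant replacement $q\colon\mathbb I_{\mathcal D}^c\to\mathbb I_{\mathcal D}$, the composite $\lambda(\mathbb I_{\mathcal D}^c)\xrightarrow{\lambda(q)}\lambda(\mathbb I_{\mathcal D})\xrightarrow{\tilde\nu}\mathbb I_{\mathcal C}$, with $\tilde\nu$ adjoint to $\nu$, is a weak equivalence. Then the following hold. (1) Suppose that the forgetful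 functor from monoids in $\mathcal D$ creates a model structure, and let $L^{\mathrm{mon}}$ be a left adjoint of the functor $R$ from monoids in $\mathcal C$ to monoids in $\mathcal D$. Let $B$ be a cofibrant monoid in $\mathcal D$ such that the forgetful functors create model structures for modules over $B$ and over $L^{\mathrm{mon}}B$. Then the functor $R\colon\mathrm{Mod}\text{-}(L^{\mathrm{mon}}B)\to\mathrm{Mod}\text{-}B$, i.e. $R\colon\mathrm{Mod}\text{-}(L^{\mathrm{mon}}B)\to\mathrm{Mod}\text{-}R(L^{\mathrm{mon}}B)$ followed by restriction along the adjunction unit $B\to R(L^{\mathrm{mon}}B)$, has a left adjoint $L_B$, and $(L_B,R)$ is a Quillen equivalence. (2) Suppose that the forgetful functors create model structures for monoids in $\mathcal C$ and in $\mathcal D$, and that Quillen invariance holds in $\mathcal C$ and in $\mathcal D$. Then for any fibrant monoid $A$ in $\mathcal C$, the functor $R\colon\mathrm{Mod}\text{-}A\to\mathrm{Mod}\text{-}RA$ has a left adjoint $L^A$, and $(L^A,R)$ is a Quillen equivalence. If $R$ preserves weak equivalences between monoids, then this holds for any monoid $A$ in $\mathcal C$. (3) If the forgetful functors create model structures for monoids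 in $\mathcal C$ and in $\mathcal D$, then the functor $R$ from monoids in $\mathcal C$ to monoids in $\mathcal D$ has a left adjoint $L^{\mathrm{mon}}$, and $(L^{\mathrm{mon}},R)$ is a Quillen equivalence between the model categories of monoids. -/

import Mathlib

open CategoryTheory CategoryTheory.Limits CategoryTheory.MonoidalCategory HomotopicalAlgebra

universe v u u' u₁ u₂

/-! ### Quillen pairs and Quillen equivalences -/

section Quillen

variable {C : Type u₁} [Category.{v} C] {D : Type u₂} [Category.{v} D]

/-- The functor `G` preserves fibrations and trivial fibrations; for a right adjoint `G` this says
that the adjoint pair is a Quillen adjoint pair. -/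
structure IsRightQuillen [ModelCategory C] [ModelCategory D] (G : C ⥤ D) : Prop where
  fibration : ∀ {X Y : C} (p : X ⟶ Y), Fibration p → Fibration (G.map p)
  trivialFibration : ∀ {X Y : C} (p : X ⟶ Y), Fibration p → WeakEquivalence p →
    Fibration (G.map p) ∧ WeakEquivalence (G.map p)

/-- The homotopy category of a model category: the localization at the weak equivalences. -/
abbrev HoCat (C : Type u₁) [Category.{v} C] [ModelCategory C] :=
  (weakEquivalences C).Localization

/-- The localization functor to the homotopy category. -/
abbrev toHoCat (C : Type u₁) [Category.{v} C] [ModelCategory C] : C ⥤ HoCat C :=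
  (weakEquivalences C).Q

/-- An adjoint pair `F ⊣ G` between model categories is a Quillen equivalence if it is a Quillen
adjoint pair and the total derived functors, with the derived adjunction, form an adjoint
equivalence `e` of homotopy categories. Here `e.functor` is the total left derived functor of `F`
(through `α`), `e.inverse` is the total right derived functor of `G` (through `β`), and the last
two conditions say that the unit and counit of `e` are those of the derived adjunction. -/
structure IsQuillenEquivalence [ModelCategory C] [ModelCategory D] {F : D ⥤ C} {G : C ⥤ D}
    (adj : F ⊣ G) : Prop where
  isRightQuillen : IsRightQuillen G
  derived : ∃ (e : HoCat D ≌ HoCat C)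
    (α : toHoCat D ⋙ e.functor ⟶ F ⋙ toHoCat C)
    (β : G ⋙ toHoCat D ⟶ toHoCat C ⋙ e.inverse),
    e.functor.IsLeftDerivedFunctor α (weakEquivalences D) ∧
    e.inverse.IsRightDerivedFunctor β (weakEquivalences C) ∧
    (∀ X : D, e.unit.app ((toHoCat D).obj X) ≫ e.inverse.map (α.app X) =
      (toHoCat D).map (adj.unit.app X) ≫ β.app (F.obj X)) ∧
    (∀ Y : C, e.functor.map (β.app Y) ≫ e.counit.app ((toHoCat C).obj Y) =
      α.app (G.obj Y) ≫ (toHoCat C).map (adj.counit.app Y))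

/-- `G` has a left adjoint, and the resulting adjoint pair is a Quillen equivalence for the given
model structures. (The left adjoint is unique up to isomorphism.) -/
def IsRightQuillenEquivalence (mC : ModelCategory C) (mD : ModelCategory D) (G : C ⥤ D) : Prop :=
  ∃ (F : D ⥤ C) (adj : F ⊣ G), IsQuillenEquivalence adj

end Quillen

/-! ### Created model structures -/

section Create

variable {C : Type u} [Category.{v} C] [ModelCategory C] {T : Type u'} [Category.{v} T]

/-- Cell objects relative to `L : C ⥤ T`: those obtained from an initial object as a transfinite
composition of pushouts of morphisms `L f`, with `f` a cofibration of `C`. -/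
def IsCellObject (L : C ⥤ T) (X : T) : Prop :=
  ∃ (Z : T) (_ : IsInitial Z) (f : Z ⟶ X),
    MorphismProperty.transfiniteCompositions.{v} ((cofibrations C).strictMap L).pushouts f

/-- The functor `U`, which has a left adjoint, creates a model structure on `T`: the weak
equivalences and fibrations are detected by `U`, and every cofibrant object is a retract of a
cell object. (The model structure is uniquely determined by these conditions.) -/
structure CreatedModelStructure (U : T ⥤ C) where
  model : ModelCategory T
  left : C ⥤ T
  adj : left ⊣ U
  weakEquivalence_iff : ∀ {X Y : T} (f : X ⟶ Y), WeakEquivalence f ↔ WeakEquivalence (U.map f)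
  fibration_iff : ∀ {X Y : T} (f : X ⟶ Y), Fibration f ↔ Fibration (U.map f)
  retract_cell : ∀ X : T, IsCofibrant X → ∃ Y : T, IsCellObject left Y ∧ Nonempty (Retract X Y)

/-- `X` is a cofibrant object of the created model structure. -/
def CreatedModelStructure.Cofibrant {U : T ⥤ C} (m : CreatedModelStructure U) (X : T) : Prop :=
  letI := m.model
  IsCofibrant X

/-- `X` is a fibrant object of the created model structure. -/
def CreatedModelStructure.Fibrant {U : T ⥤ C} (m : CreatedModelStructure U) (X : T) : Prop :=
  letI := m.model
  IsFibrant X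

end Create

/-! ### Monoidal model categories and weak monoidal Quillen equivalences -/

section Monoidal

/-- The pushout product axiom and the unit axiom for a model category with a (closed symmetric)
monoidal structure. -/
class IsMonoidalModelCategory (C : Type u) [Category.{v} C] [ModelCategory C]
    [MonoidalCategory C] : Prop where
  pushoutProduct_cofibration : ∀ {A B K L : C} (i : A ⟶ B) (j : K ⟶ L),
    Cofibration i → Cofibration j →
    Cofibration (pushout.desc (f := A ◁ j) (g := i ▷ K) (i ▷ L) (B ◁ j)
      (whisker_exchange i j))
  pushoutProduct_weakEquivalence : ∀ {A B K L : C} (i : A ⟶ B) (j : K ⟶ L),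
    Cofibration i → Cofibration j → (WeakEquivalence i ∨ WeakEquivalence j) →
    WeakEquivalence (pushout.desc (f := A ◁ j) (g := i ▷ K) (i ▷ L) (B ◁ j)
      (whisker_exchange i j))
  unit : ∀ {I : C} (q : I ⟶ 𝟙_ C), IsCofibrant I → WeakEquivalence q →
    ∀ A : C, IsCofibrant A → WeakEquivalence ((q ▷ A) ≫ (λ_ A).hom)

variable {C : Type u₁} [Category.{v} C] [MonoidalCategory C]
  {D : Type u₂} [Category.{v} D] [MonoidalCategory D]

/-- The comonoidal map `F (A ⊗ B) ⟶ F A ⊗ F B` of the left adjoint of a lax monoidal functor,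
adjoint to `A ⊗ B ⟶ R F A ⊗ R F B ⟶ R (F A ⊗ F B)`. -/
def comonoidalMap {F : D ⥤ C} {R : C ⥤ D} [R.LaxMonoidal] (adj : F ⊣ R) (A B : D) :
    F.obj (A ⊗ B) ⟶ F.obj A ⊗ F.obj B :=
  (adj.homEquiv _ _).symm
    ((adj.unit.app A ⊗ₘ adj.unit.app B) ≫ Functor.LaxMonoidal.μ R (F.obj A) (F.obj B))

/-- The map `F 𝟙 ⟶ 𝟙` adjoint to the unit map `𝟙 ⟶ R 𝟙` of the lax monoidal functor `R`. -/
def comonoidalUnit {F : D ⥤ C} {R : C ⥤ D} [R.LaxMonoidal] (adj : F ⊣ R) :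
    F.obj (𝟙_ D) ⟶ 𝟙_ C :=
  (adj.homEquiv _ _).symm (Functor.LaxMonoidal.ε R)

/-- The adjoint pair `F ⊣ R`, with `R` lax monoidal, is a weak monoidal Quillen pair. -/
structure IsWeakMonoidalQuillenPair [ModelCategory C] [ModelCategory D] {F : D ⥤ C} {R : C ⥤ D}
    [R.LaxMonoidal] (adj : F ⊣ R) : Prop where
  isRightQuillen : IsRightQuillen R
  comonoidalMap_weakEquivalence : ∀ A B : D, IsCofibrant A → IsCofibrant B →
    WeakEquivalence (comonoidalMap adj A B)
  comonoidalUnit_weakEquivalence : ∃ (I : D) (q : I ⟶ 𝟙_ D), IsCofibrant I ∧ WeakEquivalence q ∧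
    WeakEquivalence (F.map q ≫ comonoidalUnit adj)

/-- A weak monoidal Quillen pair whose underlying Quillen pair is a Quillen equivalence. -/
structure IsWeakMonoidalQuillenEquivalence [ModelCategory C] [ModelCategory D] {F : D ⥤ C}
    {R : C ⥤ D} [R.LaxMonoidal] (adj : F ⊣ R) : Prop where
  isWeakMonoidalQuillenPair : IsWeakMonoidalQuillenPair adj
  isQuillenEquivalence : IsQuillenEquivalence adj

end Monoidal

/-! ### Modules over monoids -/

section Modules

open scoped MonObj

variable {C : Type u₁} [Category.{v} C] [MonoidalCategory C]
  {D : Type u₂} [Category.{v} D] [MonoidalCategory D]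

/-- Right modules over a monoid `A`, with action `M ⊗ A ⟶ M`. -/
structure RightMod (A : Mon C) where
  X : C
  act : X ⊗ A.X ⟶ X
  act_one : (X ◁ η[A.X]) ≫ act = (ρ_ X).hom
  act_mul : (X ◁ μ[A.X]) ≫ act = (α_ X A.X A.X).inv ≫ (act ▷ A.X) ≫ act

namespace RightMod

/-- Morphisms of right modules. -/
@[ext]
structure Hom {A : Mon C} (M N : RightMod A) where
  hom : M.X ⟶ N.X
  act_hom : M.act ≫ hom = (hom ▷ A.X) ≫ N.act

instance (A : Mon C) : Category (RightMod A) where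
  Hom M N := Hom M N
  id M := ⟨𝟙 M.X, by simp⟩
  comp f g := ⟨f.hom ≫ g.hom, by
    rw [← Category.assoc, f.act_hom, Category.assoc, g.act_hom, comp_whiskerRight,
      Category.assoc]⟩
  id_comp f := Hom.ext (Category.id_comp f.hom)
  comp_id f := Hom.ext (Category.comp_id f.hom)
  assoc f g h := Hom.ext (Category.assoc f.hom g.hom h.hom)

/-- The forgetful functor from `A`-modules to the underlying category. -/
def forget (A : Mon C) : RightMod A ⥤ C where
  obj M := M.X
  map f := f.hom

/-- Restriction of scalars along a morphism of monoids. -/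
def restrict {A B : Mon C} (f : A ⟶ B) : RightMod B ⥤ RightMod A where
  obj M :=
    { X := M.X
      act := (M.X ◁ f.hom) ≫ M.act
      act_one := by
        rw [← Category.assoc, ← MonoidalCategory.whiskerLeft_comp, IsMonHom.one_hom, M.act_one]
      act_mul := by
        rw [← Category.assoc, ← MonoidalCategory.whiskerLeft_comp, IsMonHom.mul_hom,
          MonoidalCategory.whiskerLeft_comp, Category.assoc, M.act_mul]
        rw [MonoidalCategory.tensorHom_def, MonoidalCategory.whiskerLeft_comp, Category.assoc, comp_whiskerRight,
          Category.assoc, ← whisker_exchange_assoc]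
        simp }
  map {M N} g :=
    { hom := g.hom
      act_hom := by
        change ((M.X ◁ f.hom) ≫ M.act) ≫ g.hom = (g.hom ▷ A.X) ≫ (N.X ◁ f.hom) ≫ N.act
        rw [Category.assoc, g.act_hom, whisker_exchange_assoc] }

/-- The functor from `A`-modules to `R A`-modules induced by a lax monoidal functor `R`: the module
`R M` has the action `R M ⊗ R A ⟶ R (M ⊗ A) ⟶ R M`. -/
def map (R : C ⥤ D) [R.LaxMonoidal] (A : Mon C) : RightMod A ⥤ RightMod (R.mapMon.obj A) where
  obj M :=
    { X := R.obj M.X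
      act := Functor.LaxMonoidal.μ R M.X A.X ≫ R.map M.act
      act_one := by
        change R.obj M.X ◁ (Functor.LaxMonoidal.ε R ≫ R.map η[A.X]) ≫
          Functor.LaxMonoidal.μ R M.X A.X ≫ R.map M.act = (ρ_ (R.obj M.X)).hom
        rw [MonoidalCategory.whiskerLeft_comp, Category.assoc,
          Functor.LaxMonoidal.μ_natural_right_assoc, ← R.map_comp, M.act_one,
          Functor.LaxMonoidal.right_unitality]
      act_mul := by
        change R.obj M.X ◁ (Functor.LaxMonoidal.μ R A.X A.X ≫ R.map μ[A.X]) ≫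
            Functor.LaxMonoidal.μ R M.X A.X ≫ R.map M.act =
          (α_ (R.obj M.X) (R.obj A.X) (R.obj A.X)).inv ≫
            ((Functor.LaxMonoidal.μ R M.X A.X ≫ R.map M.act) ▷ R.obj A.X) ≫
              Functor.LaxMonoidal.μ R M.X A.X ≫ R.map M.act
        rw [MonoidalCategory.whiskerLeft_comp, Category.assoc,
          Functor.LaxMonoidal.μ_natural_right_assoc, ← R.map_comp, M.act_mul]
        simp }
  map {M N} g :=
    { hom := R.map g.hom
      act_hom := by
        change (Functor.LaxMonoidal.μ R M.X A.X ≫ R.map M.act) ≫ R.map g.hom =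
          (R.map g.hom ▷ R.obj A.X) ≫ Functor.LaxMonoidal.μ R N.X A.X ≫ R.map N.act
        rw [Category.assoc, ← R.map_comp, g.act_hom, R.map_comp,
          Functor.LaxMonoidal.μ_natural_left_assoc] }
  map_id M := Hom.ext (R.map_id M.X)
  map_comp f g := Hom.ext (R.map_comp f.hom g.hom)

end RightMod

/-- Quillen invariance, for a monoidal category whose forgetful functors from modules over any
monoid create model structures: for each morphism of monoids which is a weak equivalence,
restriction of scalars and its left adjoint, extension of scalars, form a Quillen equivalence. -/
def QuillenInvariance [ModelCategory C]
    (m : ∀ A : Mon C, CreatedModelStructure (RightMod.forget A)) : Prop :=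
  ∀ (A B : Mon C) (f : A ⟶ B), WeakEquivalence f.hom →
    IsRightQuillenEquivalence (m B).model (m A).model (RightMod.restrict f)

end Modules

/-! ### Weak equivalences and the homotopy category -/

section Saturation

variable {C : Type u} [Category.{v} C] [ModelCategory C]

/-! All three assertions come down to one comparison. An adjunction `E ⊣ G` between created model
structures lying over the Quillen equivalence `F ⊣ R` is itself a Quillen equivalence once, for
every cofibrant `X`, the map `F (U X) ⟶ U' (E X)` induced by the unit is a weak equivalence between
cofibrant objects (`isQuillenEquivalence_lift`). Cofibrant objects are retracts of cell objects, so
the comparison is proved by cell induction.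

The induction takes place in the category `Glue R` of morphisms `X ⟶ R Y`, which is monoidal because
`R` is lax monoidal. An object is good if `X` and `Y` are cofibrant and the adjunct `F X ⟶ Y` is a
weak equivalence. Instead of using gluing lemmas and colimits of weak equivalences, goodness is
expressed by a left lifting property. A morphism between cofibrant objects is a weak equivalence
exactly when, in the category of arrows, the map to it from the initial arrow lifts against certain
maps built from relative path objects. Good morphisms of `Glue R` are defined by lifting
accordingly, so they are closed under cobase change, transfinite composition and retracts. Any
componentwise cofibration from a good object to an object whose adjunct is a weak equivalence is
good. Condition (i) and the pushout product axiom make good objects and morphisms stable under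
tensor products and pushout products; condition (ii) makes the unit good.

A cell attached to a monoid `B` produces the monoid `P` freely generated by `B` and an object `L`
under `B`. Instead of filtering `P` by words, one recognises it as the free right `B`-module on one
generator carrying a morphism `M ⊗ L ⟶ M` that extends the action of `B`. That module is the colimit
of a sequence whose steps are cobase changes of `q ▷ B`, each `q` after the first being the pushout
product of the preceding step with `B ⟶ L`. The recognition principle `GeneratesActions` can be
verified componentwise in `Glue R`. Since the left adjoint on monoids preserves free extensions, it
applies to `B ⟶ R (Lmon B)`, and attaching a cell gives a good morphism
(`Glue.good_ofMon_map_of_isPushout`).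

Modules are easier: `M ↦ (M ⟶ R (E M))` preserves colimits and sends the free module on `X` to the
tensor product of `X ⟶ R F X` with the good monoid `B ⟶ R (Lmon B)`.

Assertion (2) follows from (1) and (3) by cancellation: take a cofibrant monoid `B` weakly
equivalent to `R A`, so that `Lmon B ⟶ A` is a weak equivalence, and apply Quillen invariance on
both sides. -/

lemma isIso_toHoCat_map {X Y : C} (f : X ⟶ Y) [WeakEquivalence f] :
    IsIso ((toHoCat C).map f) :=
  Localization.inverts (toHoCat C) (weakEquivalences C) f (mem_weakEquivalences f)

lemma exists_cofibrant_replacement (X : C) :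
    ∃ (X' : C) (p : X' ⟶ X), IsCofibrant X' ∧ Fibration p ∧ WeakEquivalence p := by
  obtain ⟨Y', _, p, _, _⟩ := CofibrantObject.HoCat.exists_resolution X
  exact ⟨Y', p, inferInstance, inferInstance, inferInstance⟩

lemma exists_fibrant_replacement (X : C) :
    ∃ (X' : C) (i : X ⟶ X'), IsFibrant X' ∧ Cofibration i ∧ WeakEquivalence i :=
  ⟨_, FibrantObject.HoCat.iResolutionObj X, inferInstance, inferInstance, inferInstance⟩

lemma weakEquivalence_of_retractArrow {X Y X' Y' : C} {f : X ⟶ Y} {g : X' ⟶ Y'}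
    (r : RetractArrow f g) [WeakEquivalence g] : WeakEquivalence f := by
  rw [weakEquivalence_iff]
  exact MorphismProperty.of_retract r (mem_weakEquivalences g)

/-- A morphism with a section `s` such that `p ≫ s` is a weak equivalence is one. -/
lemma weakEquivalence_of_section {Z Y : C} (p : Z ⟶ Y) (s : Y ⟶ Z) (hs : s ≫ p = 𝟙 Y)
    [WeakEquivalence (p ≫ s)] : WeakEquivalence p := by
  let r : RetractArrow p (p ≫ s) :=
    { i := Arrow.homMk (𝟙 _) s
      r := Arrow.homMk (𝟙 _) p (by simp [hs])
      retract := by ext <;> simp [hs] }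
  exact weakEquivalence_of_retractArrow r

/-- Up to a trivial cofibration, `f` is a fibration `p`. Its inverse in the homotopy category is
represented by an honest morphism, which can be deformed to a strict section `s`. Then `p ≫ s` is
homotopic to the identity, and `p` is a retract of it. -/
lemma weakEquivalence_of_isIso_toHoCat_of_bifibrant {X Y : C} [IsCofibrant X] [IsFibrant X]
    [IsCofibrant Y] [IsFibrant Y] (f : X ⟶ Y) [IsIso ((toHoCat C).map f)] :
    WeakEquivalence f := by
  let h := MorphismProperty.factorizationData (trivialCofibrations C) (fibrations C) f
  have := isIso_toHoCat_map h.i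
  have : IsCofibrant h.Z := isCofibrant_of_cofibration h.i
  have : IsFibrant h.Z := isFibrant_of_fibration h.p
  have : IsIso ((toHoCat C).map h.p) := by
    have e : (toHoCat C).map h.i ≫ (toHoCat C).map h.p = (toHoCat C).map f := by
      rw [← Functor.map_comp, h.fac]
    exact IsIso.of_isIso_fac_left e
  suffices WeakEquivalence h.p by
    rw [← h.fac]; infer_instance
  obtain ⟨g, hg⟩ := map_surjective_of_isLocalization (toHoCat C) (X := Y) (Y := h.Z)
    (inv ((toHoCat C).map h.p))
  have h1 : LeftHomotopyRel (g ≫ h.p) (𝟙 Y) := by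
    rw [LeftHomotopyRel.iff_map_eq (toHoCat C), Functor.map_comp, hg]
    simp
  obtain ⟨P, hP, ⟨H⟩⟩ := h1.exists_good_cylinder
  -- The homotopy from `g ≫ h.p` to the identity is lifted along the fibration `h.p`, starting at
  -- `g`; its other end is a strict section.
  obtain ⟨s, H', hs⟩ := H.covering_homotopy h.p g
  have hsp : s ≫ h.p = 𝟙 Y := by
    rw [← H'.h₁, Category.assoc, hs, H.h₁]
  have hs' : (toHoCat C).map s = inv ((toHoCat C).map h.p) := by
    rw [← hg]
    exact ((LeftHomotopyRel.iff_map_eq (toHoCat C) _ _).1 H'.leftHomotopyRel).symm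
  have h2 : LeftHomotopyRel (𝟙 h.Z) (h.p ≫ s) := by
    rw [LeftHomotopyRel.iff_map_eq (toHoCat C), Functor.map_comp, hs']
    simp
  obtain ⟨Q, ⟨K⟩⟩ := h2
  have : WeakEquivalence (h.p ≫ s) := K.weakEquivalence_iff.1 inferInstance
  exact weakEquivalence_of_section h.p s hsp

/-- Trivial cofibrations out of cofibrant objects end in cofibrant objects, so fibrant replacement
of the target and a factorization reduce to the bifibrant case. -/
lemma weakEquivalence_of_isIso_toHoCat_of_cofibrant {X Y : C} [IsCofibrant X] [IsCofibrant Y]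
    (f : X ⟶ Y) [IsIso ((toHoCat C).map f)] : WeakEquivalence f := by
  obtain ⟨Y', j, _, _, _⟩ := exists_fibrant_replacement Y
  let h := MorphismProperty.factorizationData (trivialCofibrations C) (fibrations C) (f ≫ j)
  have := isIso_toHoCat_map h.i
  have := isIso_toHoCat_map j
  have : IsCofibrant Y' := isCofibrant_of_cofibration j
  have : IsCofibrant h.Z := isCofibrant_of_cofibration h.i
  have : IsFibrant h.Z := isFibrant_of_fibration h.p
  have : IsIso ((toHoCat C).map h.p) := by
    have e : (toHoCat C).map h.i ≫ (toHoCat C).map h.p =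
        (toHoCat C).map f ≫ (toHoCat C).map j := by
      rw [← Functor.map_comp, ← Functor.map_comp, h.fac]
    exact IsIso.of_isIso_fac_left e
  have := weakEquivalence_of_isIso_toHoCat_of_bifibrant h.p
  have : WeakEquivalence (f ≫ j) := by rw [← h.fac]; infer_instance
  exact weakEquivalence_of_postcomp f j

/-- The weak equivalences of a model category are saturated. -/
lemma weakEquivalence_of_isIso_toHoCat {X Y : C} (f : X ⟶ Y) [IsIso ((toHoCat C).map f)] :
    WeakEquivalence f := by
  obtain ⟨X', p, _, _, _⟩ := exists_cofibrant_replacement X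
  let h := MorphismProperty.factorizationData (cofibrations C) (trivialFibrations C) (p ≫ f)
  have := isIso_toHoCat_map p
  have := isIso_toHoCat_map h.p
  have : IsCofibrant h.Z := isCofibrant_of_cofibration h.i
  have : IsIso ((toHoCat C).map h.i) := by
    have e : (toHoCat C).map h.i ≫ (toHoCat C).map h.p =
        (toHoCat C).map p ≫ (toHoCat C).map f := by
      rw [← Functor.map_comp, ← Functor.map_comp, h.fac]
    exact IsIso.of_isIso_fac_right e
  have := weakEquivalence_of_isIso_toHoCat_of_cofibrant h.i
  have : WeakEquivalence (p ≫ f) := by rw [← h.fac]; infer_instance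
  exact weakEquivalence_of_precomp p f

lemma isIso_toHoCat_map_iff {X Y : C} (f : X ⟶ Y) :
    IsIso ((toHoCat C).map f) ↔ WeakEquivalence f :=
  ⟨fun _ ↦ weakEquivalence_of_isIso_toHoCat f, fun _ ↦ isIso_toHoCat_map f⟩

end Saturation

/-! ### Derived functors -/

section Derived

/-- Reversing arrows exchanges the universal properties of left and right derived functors. This
transports criteria stated for right derived functors to left ones. -/
lemma isLeftDerivedFunctor_of_op {C D H : Type*} [Category* C] [Category* D] [Category* H]
    {L : C ⥤ D} {F : C ⥤ H} {LF : D ⥤ H} (α : L ⋙ LF ⟶ F) (W : MorphismProperty C)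
    [L.IsLocalization W] (β : F.op ⟶ L.op ⋙ LF.op) (hβ : ∀ X, β.app (Opposite.op X) = (α.app X).op)
    [LF.op.IsRightDerivedFunctor β W.op] :
    LF.IsLeftDerivedFunctor α W := by
  rw [Functor.isLeftDerivedFunctor_iff_isRightKanExtension]
  refine ⟨⟨IsTerminal.ofUniqueHom (fun G ↦ ?_) (fun G m ↦ ?_)⟩⟩
  · let γ : F.op ⟶ L.op ⋙ G.left.op := NatTrans.op G.hom
    let δ : LF.op ⟶ G.left.op := LF.op.rightDerivedDesc β W.op G.left.op γ
    refine CostructuredArrow.homMk (NatTrans.removeOp δ) ?_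
    ext X
    have h := LF.op.rightDerived_fac_app β W.op G.left.op γ (Opposite.op X)
    rw [hβ] at h
    exact congrArg Quiver.Hom.unop h
  · apply CostructuredArrow.hom_ext
    let γ : F.op ⟶ L.op ⋙ G.left.op := NatTrans.op G.hom
    let δ : LF.op ⟶ G.left.op := LF.op.rightDerivedDesc β W.op G.left.op γ
    have key : NatTrans.op m.left = δ := by
      refine LF.op.rightDerived_ext β W.op _ _ _ ?_
      refine Eq.trans ?_ (LF.op.rightDerived_fac β W.op G.left.op γ).symm
      ext X
      have h := NatTrans.congr_app (CostructuredArrow.w m) X.unop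
      change β.app (Opposite.op X.unop) ≫ _ = _
      rw [hβ]
      exact congrArg Quiver.Hom.op h
    change m.left = NatTrans.removeOp δ
    rw [← key]
    rfl

variable {C : Type u} [Category.{v} C] [ModelCategory C] {H : Type*} [Category* H] (F : C ⥤ H)

/-- A functor inverting the weak equivalences between cofibrant objects has a left derived
functor; a natural transformation exhibits a left derived functor as soon as it is an isomorphism
on cofibrant objects. -/
lemma isLeftDerivedFunctor_of_isIso_app
    (hF : ∀ ⦃X Y : C⦄ (f : X ⟶ Y), IsCofibrant X → IsCofibrant Y → WeakEquivalence f →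
      IsIso (F.map f))
    {LF : HoCat C ⥤ H} (α : toHoCat C ⋙ LF ⟶ F) (hα : ∀ X, IsCofibrant X → IsIso (α.app X)) :
    LF.IsLeftDerivedFunctor α (weakEquivalences C) := by
  have hd : (CofibrantObject.localizerMorphism C).op.Derives F.op := by
    intro X Y f hf
    have h1 := hF f.unop.hom Y.unop.2 X.unop.2 ((weakEquivalence_iff _).2 hf)
    exact inferInstanceAs (IsIso (F.map f.unop.hom).op)
  let β : F.op ⟶ (toHoCat C).op ⋙ LF.op := NatTrans.op α
  have : LF.op.IsRightDerivedFunctor β (weakEquivalences C).op := by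
    refine hd.isRightDerivedFunctor_of_isIso β (fun X ↦ ?_)
    have := hα X.unop.obj X.unop.2
    exact inferInstanceAs (IsIso (α.app X.unop.obj).op)
  exact isLeftDerivedFunctor_of_op α _ β (fun _ ↦ rfl)

/-- Inverting weak equivalences between cofibrant objects means that the opposite functor is derived
by the opposite of the inclusion of cofibrant objects; its right derived functor is then read
backwards. -/
lemma exists_leftDerivedFunctor
    (hF : ∀ ⦃X Y : C⦄ (f : X ⟶ Y), IsCofibrant X → IsCofibrant Y → WeakEquivalence f →
      IsIso (F.map f)) :
    ∃ (LF : HoCat C ⥤ H) (α : toHoCat C ⋙ LF ⟶ F), ∀ X, IsCofibrant X → IsIso (α.app X) := by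
  have hd : (CofibrantObject.localizerMorphism C).op.Derives F.op := by
    intro X Y f hf
    have h1 := hF f.unop.hom Y.unop.2 X.unop.2 ((weakEquivalence_iff _).2 hf)
    exact inferInstanceAs (IsIso (F.map f.unop.hom).op)
  have := hd.hasPointwiseRightDerivedFunctor
  let RF := F.op.totalRightDerived (toHoCat C).op (weakEquivalences C).op
  let β : F.op ⟶ (toHoCat C).op ⋙ RF :=
    F.op.totalRightDerivedUnit (toHoCat C).op (weakEquivalences C).op
  refine ⟨RF.unop, NatTrans.unop β, fun X hX ↦ ?_⟩
  have : IsIso (β.app (Opposite.op X)) :=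
    hd.isIso_of_isRightDerivedFunctor β (Opposite.op (CofibrantObject.mk X))
  exact inferInstanceAs (IsIso (β.app (Opposite.op X)).unop)

/-- Left derived functors are unique up to an isomorphism compatible with the transformations to
`F`, so it suffices that one of them has this property. -/
lemma isIso_app_of_isLeftDerivedFunctor
    (hF : ∀ ⦃X Y : C⦄ (f : X ⟶ Y), IsCofibrant X → IsCofibrant Y → WeakEquivalence f →
      IsIso (F.map f))
    {LF : HoCat C ⥤ H} (α : toHoCat C ⋙ LF ⟶ F)
    [LF.IsLeftDerivedFunctor α (weakEquivalences C)] (X : C) (hX : IsCofibrant X) :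
    IsIso (α.app X) := by
  obtain ⟨LF', α', h⟩ := exists_leftDerivedFunctor F hF
  have := isLeftDerivedFunctor_of_isIso_app F hF α' h
  have := h X hX
  let e := Functor.leftDerivedNatIso LF LF' α α' (weakEquivalences C) (Iso.refl F)
  have he : e.hom.app ((toHoCat C).obj X) ≫ α'.app X = α.app X := by
    exact (Functor.leftDerivedNatTrans_app LF LF' α α' (weakEquivalences C) (𝟙 F) X).trans
      (Category.comp_id _)
  rw [← he]
  infer_instance

lemma exists_rightDerivedFunctor
    (hF : ∀ ⦃X Y : C⦄ (f : X ⟶ Y), IsFibrant X → IsFibrant Y → WeakEquivalence f →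
      IsIso (F.map f)) :
    ∃ (RF : HoCat C ⥤ H) (β : F ⟶ toHoCat C ⋙ RF), ∀ X, IsFibrant X → IsIso (β.app X) := by
  have hd : (FibrantObject.localizerMorphism C).Derives F := by
    intro X Y f hf
    exact hF f.hom X.2 Y.2 ((weakEquivalence_iff _).2 hf)
  have := hd.hasPointwiseRightDerivedFunctor
  exact ⟨F.totalRightDerived (toHoCat C) (weakEquivalences C),
    F.totalRightDerivedUnit (toHoCat C) (weakEquivalences C),
    fun X hX ↦ hd.isIso_of_isRightDerivedFunctor _ (FibrantObject.mk X)⟩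

lemma isRightDerivedFunctor_of_isIso_app
    (hF : ∀ ⦃X Y : C⦄ (f : X ⟶ Y), IsFibrant X → IsFibrant Y → WeakEquivalence f →
      IsIso (F.map f))
    {RF : HoCat C ⥤ H} (β : F ⟶ toHoCat C ⋙ RF) (hβ : ∀ X, IsFibrant X → IsIso (β.app X)) :
    RF.IsRightDerivedFunctor β (weakEquivalences C) := by
  have hd : (FibrantObject.localizerMorphism C).Derives F := by
    intro X Y f hf
    exact hF f.hom X.2 Y.2 ((weakEquivalence_iff _).2 hf)
  exact hd.isRightDerivedFunctor_of_isIso β (fun X ↦ hβ X.obj X.2)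

lemma isIso_app_of_isRightDerivedFunctor
    (hF : ∀ ⦃X Y : C⦄ (f : X ⟶ Y), IsFibrant X → IsFibrant Y → WeakEquivalence f →
      IsIso (F.map f))
    {RF : HoCat C ⥤ H} (β : F ⟶ toHoCat C ⋙ RF)
    [RF.IsRightDerivedFunctor β (weakEquivalences C)] (X : C) (hX : IsFibrant X) :
    IsIso (β.app X) := by
  have hd : (FibrantObject.localizerMorphism C).Derives F := by
    intro X Y f hf
    exact hF f.hom X.2 Y.2 ((weakEquivalence_iff _).2 hf)
  exact hd.isIso_of_isRightDerivedFunctor β (FibrantObject.mk X)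

end Derived

/-! ### Quillen pairs -/

section KenBrown

variable {C : Type u₁} [Category.{v} C] [ModelCategory C]
  {D : Type u₂} [Category.{v} D] [ModelCategory D]

/-- Ken Brown's lemma. -/
lemma weakEquivalence_map_of_isCofibrant (F : D ⥤ C)
    (hF : ∀ ⦃X Y : D⦄ (i : X ⟶ Y), IsCofibrant X → Cofibration i → WeakEquivalence i →
      WeakEquivalence (F.map i))
    {X Y : D} (f : X ⟶ Y) [hX : IsCofibrant X] [hY : IsCofibrant Y] [WeakEquivalence f] :
    WeakEquivalence (F.map f) := by
  obtain ⟨h⟩ := (inferInstance : Nonempty (CofibrantBrownFactorization f))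
  have h1 := hF h.i hX inferInstance inferInstance
  have h2 := hF h.s hY inferInstance inferInstance
  have h3 : WeakEquivalence (F.map h.p) := by
    have e : F.map h.s ≫ F.map h.p = 𝟙 _ := by rw [← F.map_comp, h.s_p, F.map_id]
    exact weakEquivalence_of_precomp_of_fac e
  rw [← h.fac, F.map_comp]
  infer_instance

/-- The dual of Ken Brown's lemma. -/
lemma weakEquivalence_map_of_isFibrant (G : C ⥤ D)
    (hG : ∀ ⦃X Y : C⦄ (p : X ⟶ Y), IsFibrant Y → Fibration p → WeakEquivalence p →
      WeakEquivalence (G.map p))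
    {X Y : C} (f : X ⟶ Y) [hX : IsFibrant X] [hY : IsFibrant Y] [WeakEquivalence f] :
    WeakEquivalence (G.map f) := by
  obtain ⟨h⟩ := (inferInstance : Nonempty (FibrantBrownFactorization f))
  have h1 := hG h.p hY inferInstance inferInstance
  have h2 := hG h.r hX inferInstance inferInstance
  have h3 : WeakEquivalence (G.map h.i) := by
    have e : G.map h.i ≫ G.map h.r = 𝟙 _ := by rw [← G.map_comp, h.i_r, G.map_id]
    exact weakEquivalence_of_postcomp_of_fac e
  rw [← h.fac, G.map_comp]
  infer_instance

end KenBrown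

namespace IsRightQuillen

variable {C : Type u₁} [Category.{v} C] [ModelCategory C]
  {D : Type u₂} [Category.{v} D] [ModelCategory D] {F : D ⥤ C} {G : C ⥤ D}

lemma cofibration_map (hG : IsRightQuillen G) (adj : F ⊣ G) {X Y : D} (i : X ⟶ Y)
    [Cofibration i] : Cofibration (F.map i) := by
  rw [cofibration_iff, ← trivialFibrations_llp]
  intro A B p hp
  rw [mem_trivialFibrations_iff] at hp
  obtain ⟨_, _⟩ := hG.trivialFibration p hp.1 hp.2
  rw [adj.hasLiftingProperty_iff]
  infer_instance

lemma weakEquivalence_map_of_cofibration (hG : IsRightQuillen G) (adj : F ⊣ G) {X Y : D}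
    (i : X ⟶ Y) [Cofibration i] [WeakEquivalence i] : WeakEquivalence (F.map i) := by
  suffices trivialCofibrations C (F.map i) from (mem_trivialCofibrations_iff _).1 this |>.2
  rw [← fibrations_llp]
  intro A B p hp
  have := hG.fibration p ((fibration_iff p).2 hp)
  rw [adj.hasLiftingProperty_iff]
  infer_instance

lemma isCofibrant_obj (hG : IsRightQuillen G) (adj : F ⊣ G) (X : D) [IsCofibrant X] :
    IsCofibrant (F.obj X) := by
  have := adj.leftAdjoint_preservesColimits
  have := hG.cofibration_map adj (initial.to X)
  exact (isCofibrant_iff_of_isInitial (F.map (initial.to X))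
    (IsInitial.isInitialObj F _ initialIsInitial)).2 this

lemma isFibrant_obj (hG : IsRightQuillen G) (adj : F ⊣ G) (Y : C) [hY : IsFibrant Y] :
    IsFibrant (G.obj Y) := by
  have := adj.rightAdjoint_preservesLimits
  have := hG.fibration (terminal.from Y) hY
  exact (isFibrant_iff_of_isTerminal (G.map (terminal.from Y))
    (IsTerminal.isTerminalObj G _ terminalIsTerminal)).2 this

lemma weakEquivalence_leftAdjoint_map (hG : IsRightQuillen G) (adj : F ⊣ G) {X Y : D}
    (f : X ⟶ Y) [IsCofibrant X] [IsCofibrant Y] [WeakEquivalence f] :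
    WeakEquivalence (F.map f) :=
  weakEquivalence_map_of_isCofibrant F
    (fun _ _ i _ _ _ ↦ hG.weakEquivalence_map_of_cofibration adj i) f

lemma weakEquivalence_map (hG : IsRightQuillen G) {X Y : C}
    (f : X ⟶ Y) [IsFibrant X] [IsFibrant Y] [WeakEquivalence f] :
    WeakEquivalence (G.map f) :=
  weakEquivalence_map_of_isFibrant G (fun _ _ p _ h h' ↦ (hG.trivialFibration p h h').2) f

lemma isIso_leftAdjoint_map (hG : IsRightQuillen G) (adj : F ⊣ G) ⦃X Y : D⦄
    (f : X ⟶ Y) (_ : IsCofibrant X) (_ : IsCofibrant Y) (_ : WeakEquivalence f) :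
    IsIso ((F ⋙ toHoCat C).map f) := by
  have := hG.weakEquivalence_leftAdjoint_map adj f
  exact isIso_toHoCat_map (F.map f)

lemma isIso_map (hG : IsRightQuillen G) ⦃X Y : C⦄
    (f : X ⟶ Y) (_ : IsFibrant X) (_ : IsFibrant Y) (_ : WeakEquivalence f) :
    IsIso ((G ⋙ toHoCat D).map f) := by
  have := hG.weakEquivalence_map f
  exact isIso_toHoCat_map (G.map f)

end IsRightQuillen

section QuillenEquivalence

variable {C : Type u₁} [Category.{v} C] [ModelCategory C]
  {D : Type u₂} [Category.{v} D] [ModelCategory D] {F : D ⥤ C} {G : C ⥤ D} {adj : F ⊣ G}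

/-- In a Quillen equivalence, a morphism from the image of a cofibrant object to a fibrant object
is a weak equivalence if and only if its adjunct is. -/
lemma IsQuillenEquivalence.weakEquivalence_homEquiv_iff (h : IsQuillenEquivalence adj) {X : D}
    {Y : C} [hX : IsCofibrant X] [hY : IsFibrant Y] (f : F.obj X ⟶ Y) :
    WeakEquivalence (adj.homEquiv X Y f) ↔ WeakEquivalence f := by
  obtain ⟨e, α, β, hα, hβ, h1, -⟩ := h.derived
  have := isIso_app_of_isLeftDerivedFunctor (F ⋙ toHoCat C)
    (h.isRightQuillen.isIso_leftAdjoint_map adj) α X hX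
  have := isIso_app_of_isRightDerivedFunctor (G ⋙ toHoCat D)
    h.isRightQuillen.isIso_map β Y hY
  rw [← isIso_toHoCat_map_iff, ← isIso_toHoCat_map_iff, adj.homEquiv_unit, Functor.map_comp]
  -- Up to the isomorphisms `e.unit`, `α.app X` and `β.app Y`, the class of the adjunct of `f` is
  -- `e.inverse` applied to the class of `f`. Saturation of the weak equivalences translates this
  -- back.
  have key : ((toHoCat D).map (adj.unit.app X) ≫ (toHoCat D).map (G.map f)) ≫ β.app Y =
      e.unit.app ((toHoCat D).obj X) ≫ e.inverse.map (α.app X) ≫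
        e.inverse.map ((toHoCat C).map f) := by
    have hn : (toHoCat D).map (G.map f) ≫ β.app Y =
      β.app (F.obj X) ≫ e.inverse.map ((toHoCat C).map f) := β.naturality f
    rw [Category.assoc, hn, ← Category.assoc, ← h1, Category.assoc]
  have e1 : IsIso ((toHoCat D).map (adj.unit.app X) ≫ (toHoCat D).map (G.map f)) ↔
      IsIso (e.inverse.map ((toHoCat C).map f)) := by
    rw [← isIso_comp_right_iff _ (β.app Y), key, isIso_comp_left_iff, isIso_comp_left_iff]
  rw [e1]
  exact ⟨fun _ ↦ isIso_of_reflects_iso _ e.inverse, fun _ ↦ inferInstance⟩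

/-- The usual criterion for a Quillen pair to be a Quillen equivalence. -/
lemma isQuillenEquivalence_of_weakEquivalence_homEquiv_iff (hG : IsRightQuillen G)
    (h : ∀ (X : D) (Y : C) (f : F.obj X ⟶ Y), IsCofibrant X → IsFibrant Y →
      (WeakEquivalence (adj.homEquiv X Y f) ↔ WeakEquivalence f)) :
    IsQuillenEquivalence adj := by
  refine ⟨hG, ?_⟩
  obtain ⟨LF, α, hα⟩ := exists_leftDerivedFunctor (F ⋙ toHoCat C) (hG.isIso_leftAdjoint_map adj)
  obtain ⟨RG, β, hβ⟩ := exists_rightDerivedFunctor (G ⋙ toHoCat D) hG.isIso_map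
  have h1 := isLeftDerivedFunctor_of_isIso_app _ (hG.isIso_leftAdjoint_map adj) α hα
  have h2 := isRightDerivedFunctor_of_isIso_app _ hG.isIso_map β hβ
  -- The derived unit and counit are defined by universal properties of the two composites, so these
  -- have to be derived functors as well.
  have h3 : (LF ⋙ RG).IsLeftDerivedFunctor
      ((Functor.associator _ _ _).inv ≫ Functor.whiskerRight α RG) (weakEquivalences D) := by
    refine isLeftDerivedFunctor_of_isIso_app ((F ⋙ toHoCat C) ⋙ RG) (fun X Y f hX hY hf ↦ ?_) _
      (fun X hX ↦ ?_)
    · have := hG.isIso_leftAdjoint_map adj f hX hY hf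
      exact inferInstanceAs (IsIso (RG.map _))
    · have := hα X hX
      have e : ((Functor.associator _ _ _).inv ≫ Functor.whiskerRight α RG).app X =
        RG.map (α.app X) := Category.id_comp _
      rw [e]
      infer_instance
  have h4 : (RG ⋙ LF).IsRightDerivedFunctor
      (Functor.whiskerRight β LF ≫ (Functor.associator _ _ _).hom) (weakEquivalences C) := by
    refine isRightDerivedFunctor_of_isIso_app ((G ⋙ toHoCat D) ⋙ LF) (fun X Y f hX hY hf ↦ ?_) _
      (fun X hX ↦ ?_)
    · have := hG.isIso_map f hX hY hf
      exact inferInstanceAs (IsIso (LF.map _))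
    · have := hβ X hX
      have e : (Functor.whiskerRight β LF ≫ (Functor.associator _ _ _).hom).app X =
        LF.map (β.app X) := Category.comp_id _
      rw [e]
      infer_instance
  let dadj := adj.derived (weakEquivalences D) (weakEquivalences C) α β
  have hunit : ∀ X : D, dadj.unit.app ((toHoCat D).obj X) ≫ RG.map (α.app X) =
      (toHoCat D).map (adj.unit.app X) ≫ β.app (F.obj X) :=
    adj.derivedη_fac_app (weakEquivalences D) α β
  have hcounit : ∀ Y : C, LF.map (β.app Y) ≫ dadj.counit.app ((toHoCat C).obj Y) =
      α.app (G.obj Y) ≫ (toHoCat C).map (adj.counit.app Y) :=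
    adj.derivedε_fac_app (weakEquivalences C) α β
  -- The hypothesis is applied to a fibrant replacement of `F.obj X`, whose adjunct represents the
  -- derived unit at `X`.
  have i1 : ∀ X : D, IsCofibrant X → IsIso (dadj.unit.app ((toHoCat D).obj X)) := by
    intro X hX
    obtain ⟨Y, j, hY, _, _⟩ := exists_fibrant_replacement (F.obj X)
    have := hα X hX
    have := hβ Y hY
    have := isIso_toHoCat_map j
    have hw := (h X Y j hX hY).2 inferInstance
    have := isIso_toHoCat_map (adj.homEquiv X Y j)
    have e : dadj.unit.app ((toHoCat D).obj X) ≫ (RG.map (α.app X) ≫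
        RG.map ((toHoCat C).map j)) = (toHoCat D).map (adj.homEquiv X Y j) ≫ β.app Y := by
      have hn : (toHoCat D).map (G.map j) ≫ β.app Y =
        β.app (F.obj X) ≫ RG.map ((toHoCat C).map j) := β.naturality j
      rw [← Category.assoc, hunit, Category.assoc, ← hn, adj.homEquiv_unit, Functor.map_comp,
        Category.assoc]
    exact IsIso.of_isIso_fac_right e
  have i2 : ∀ Y : C, IsFibrant Y → IsIso (dadj.counit.app ((toHoCat C).obj Y)) := by
    intro Y hY
    obtain ⟨X, p, hX, _, _⟩ := exists_cofibrant_replacement (G.obj Y)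
    have := hα X hX
    have := hβ Y hY
    have := isIso_toHoCat_map p
    have hw := (h X Y ((adj.homEquiv X Y).symm p) hX hY).1 (by simpa using ‹WeakEquivalence p›)
    have := isIso_toHoCat_map ((adj.homEquiv X Y).symm p)
    have e : (LF.map ((toHoCat D).map p) ≫ LF.map (β.app Y)) ≫
        dadj.counit.app ((toHoCat C).obj Y) =
        α.app X ≫ (toHoCat C).map ((adj.homEquiv X Y).symm p) := by
      have hn : LF.map ((toHoCat D).map p) ≫ α.app (G.obj Y) =
        α.app X ≫ (toHoCat C).map (F.map p) := α.naturality p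
      rw [Category.assoc, hcounit, ← Category.assoc, hn, adj.homEquiv_counit, Functor.map_comp,
        Category.assoc]
    exact IsIso.of_isIso_fac_left e
  have i3 : IsIso dadj.unit := by
    rw [NatTrans.isIso_iff_isIso_app]
    intro Z
    obtain ⟨X, p, hX, _, _⟩ := exists_cofibrant_replacement ((toHoCat D).objPreimage Z)
    have := isIso_toHoCat_map p
    have := i1 X hX
    exact (NatTrans.isIso_app_iff_of_iso dadj.unit
      (asIso ((toHoCat D).map p) ≪≫ (toHoCat D).objObjPreimageIso Z)).1 this
  have i4 : IsIso dadj.counit := by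
    rw [NatTrans.isIso_iff_isIso_app]
    intro Z
    obtain ⟨X, p, hX, _, _⟩ := exists_fibrant_replacement ((toHoCat C).objPreimage Z)
    have := isIso_toHoCat_map p
    have := i2 X hX
    exact (NatTrans.isIso_app_iff_of_iso dadj.counit
      ((asIso ((toHoCat C).map p)).symm ≪≫ (toHoCat C).objObjPreimageIso Z)).1 this
  have : ∀ X, IsIso (dadj.unit.app X) := fun X ↦ inferInstance
  have : ∀ X, IsIso (dadj.counit.app X) := fun X ↦ inferInstance
  exact ⟨dadj.toEquivalence, α, β, h1, h2, hunit, hcounit⟩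

end QuillenEquivalence

/-! ### Detecting weak equivalences by a lifting property in the category of arrows -/

section PathLifting

attribute [local simp] pushout.inl_desc pushout.inr_desc pushout.inl_desc_assoc
  pushout.inr_desc_assoc pullback.lift_fst pullback.lift_snd pullback.lift_fst_assoc
  pullback.lift_snd_assoc

variable {C : Type u} [Category.{v} C] [ModelCategory C]

/-- A path object for `E` in the category of objects over `B`, where `q : E ⟶ B`. -/
structure RelPathObject {E B : C} (q : E ⟶ B) where
  P : C
  r : E ⟶ P
  p₀ : P ⟶ E
  p₁ : P ⟶ E
  r_p₀ : r ≫ p₀ = 𝟙 E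
  r_p₁ : r ≫ p₁ = 𝟙 E
  w : p₀ ≫ q = p₁ ≫ q
  weakEquivalence_r : WeakEquivalence r
  fibration : Fibration (pullback.lift p₀ p₁ w)

namespace RelPathObject

variable {E B : C} {q : E ⟶ B}

lemma exists_relPathObject (q : E ⟶ B) : Nonempty (RelPathObject q) := by
  let h := MorphismProperty.factorizationData (trivialCofibrations C) (fibrations C)
    (pullback.lift (𝟙 E) (𝟙 E) rfl : E ⟶ pullback q q)
  refine ⟨⟨h.Z, h.i, h.p ≫ pullback.fst q q, h.p ≫ pullback.snd q q, ?_, ?_, ?_, ?_, ?_⟩⟩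
  · rw [← Category.assoc, h.fac, pullback.lift_fst]
  · rw [← Category.assoc, h.fac, pullback.lift_snd]
  · rw [Category.assoc, Category.assoc, pullback.condition]
  · infer_instance
  · have e : pullback.lift (h.p ≫ pullback.fst q q) (h.p ≫ pullback.snd q q)
        (by rw [Category.assoc, Category.assoc, pullback.condition]) = h.p := by
      ext <;> simp
    rw [e]
    infer_instance

variable (d : RelPathObject q)

lemma weakEquivalence_p₀ : WeakEquivalence d.p₀ :=
  have := d.weakEquivalence_r
  weakEquivalence_of_precomp_of_fac d.r_p₀

lemma weakEquivalence_p₁ : WeakEquivalence d.p₁ :=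
  have := d.weakEquivalence_r
  weakEquivalence_of_precomp_of_fac d.r_p₁

lemma fibration_p₀ [Fibration q] : Fibration d.p₀ := by
  have := d.fibration
  rw [← pullback.lift_fst d.p₀ d.p₁ d.w]
  infer_instance

/-- The two endpoint maps of a relative path object, as a morphism of arrows. -/
def arrowHom : Arrow.mk d.p₁ ⟶ Arrow.mk q := Arrow.homMk d.p₀ q d.w

/-- The lifting property of a square of cofibrations with respect to `arrowHom`. -/
lemma exists_lift [Fibration q] {X Y X' Y' : C} (f : X ⟶ Y) (f' : X' ⟶ Y')
    (i : X ⟶ X') (j : Y ⟶ Y') (w : i ≫ f' = f ≫ j) [Cofibration i] [Cofibration j]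
    [WeakEquivalence f'] [WeakEquivalence (pushout.inl i f)]
    (a₀ : X ⟶ d.P) (a₁ : Y ⟶ E) (ha : a₀ ≫ d.p₁ = f ≫ a₁) (b₀ : X' ⟶ E) (b₁ : Y' ⟶ B)
    (hb : b₀ ≫ q = f' ≫ b₁) (h₀ : a₀ ≫ d.p₀ = i ≫ b₀) (h₁ : a₁ ≫ q = j ≫ b₁) :
    ∃ (c₀ : X' ⟶ d.P) (c₁ : Y' ⟶ E), i ≫ c₀ = a₀ ∧ j ≫ c₁ = a₁ ∧ c₀ ≫ d.p₀ = b₀ ∧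
      c₁ ≫ q = b₁ ∧ c₀ ≫ d.p₁ = f' ≫ c₁ := by
  have := d.weakEquivalence_p₀
  have := d.fibration_p₀
  have := d.fibration
  -- Since `d.p₀` is a trivial fibration, there is a first candidate `t` for `c₀`; but `t ≫ d.p₁`
  -- need not factor through `f'`. The rest of the proof corrects this by a homotopy relative to
  -- `X`.
  have sq₁ : CommSq a₀ i d.p₀ b₀ := ⟨h₀⟩
  let t := sq₁.lift
  have ht : i ≫ t = a₀ := sq₁.fac_left
  have ht' : t ≫ d.p₀ = b₀ := sq₁.fac_right
  -- By two-out-of-three `ψ` is a weak equivalence. Hence `h.Z`, the middle object of its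
  -- factorization, receives `pushout i f` by a trivial cofibration, and `t ≫ d.p₁` and `a₁`
  -- together extend over it to `z : h.Z ⟶ E`.
  let ψ : pushout i f ⟶ Y' := pushout.desc f' j w
  let h := MorphismProperty.factorizationData (cofibrations C) (trivialFibrations C) ψ
  have hψ : WeakEquivalence ψ :=
    weakEquivalence_of_precomp_of_fac (pushout.inl_desc f' j w)
  have : WeakEquivalence h.i := weakEquivalence_of_postcomp_of_fac h.fac
  let e : pushout i f ⟶ E := pushout.desc (t ≫ d.p₁) a₁ (by rw [← Category.assoc, ht, ha])
  have sq₂ : CommSq e h.i q (h.p ≫ b₁) := ⟨by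
    rw [← Category.assoc, h.fac]
    ext
    · simp [e, ψ, ← d.w, reassoc_of% ht', hb]
    · simp [e, ψ, h₁]⟩
  let z := sq₂.lift
  have hz : h.i ≫ z = e := sq₂.fac_left
  have hz' : z ≫ q = h.p ≫ b₁ := sq₂.fac_right
  -- A section `σ` of `h.p` compatible with `Y`; the second component of the lift will be `σ ≫ z`.
  have sq₃ : CommSq (pushout.inr i f ≫ h.i) j h.p (𝟙 Y') := ⟨by simp [ψ]⟩
  let σ := sq₃.lift
  have hσ : j ≫ σ = pushout.inr i f ≫ h.i := sq₃.fac_left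
  have hσ' : σ ≫ h.p = 𝟙 Y' := sq₃.fac_right
  -- A cylinder on `X'` relative to `X`. The two maps `X' ⟶ h.Z`, through the pushout and through
  -- `σ`, agree on `X` and over `Y'`; as `h.p` is a trivial fibration, a homotopy `θ` joins them.
  let k := MorphismProperty.factorizationData (cofibrations C) (trivialFibrations C)
    (pushout.desc (𝟙 X') (𝟙 X') rfl : pushout i i ⟶ X')
  let d₀ : X' ⟶ k.Z := pushout.inl i i ≫ k.i
  let d₁ : X' ⟶ k.Z := pushout.inr i i ≫ k.i
  have hd₀ : d₀ ≫ k.p = 𝟙 X' := by simp [d₀]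
  have hd₁ : d₁ ≫ k.p = 𝟙 X' := by simp [d₁]
  have hd : i ≫ d₀ = i ≫ d₁ := by simp only [d₀, d₁, ← Category.assoc, pushout.condition]
  have : Cofibration d₀ := by dsimp only [d₀]; infer_instance
  have : WeakEquivalence d₀ := weakEquivalence_of_postcomp_of_fac hd₀
  have sq₄ : CommSq (pushout.desc (pushout.inl i f ≫ h.i) (f' ≫ σ) (by
      rw [← Category.assoc, pushout.condition, Category.assoc, ← hσ, ← Category.assoc,
        ← Category.assoc, w])) k.i h.p (k.p ≫ f') := ⟨by
    ext
    · simp [ψ]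
    · simp [hσ']⟩
  let θ := sq₄.lift
  have hθ₀ : d₀ ≫ θ = pushout.inl i f ≫ h.i := by simp [d₀, θ]
  have hθ₁ : d₁ ≫ θ = f' ≫ σ := by simp [d₁, θ]
  have hθ' : θ ≫ h.p = k.p ≫ f' := sq₄.fac_right
  -- Lifting along the fibration with components `d.p₀`, `d.p₁` moves `t` along `θ ≫ z` while its
  -- image under `d.p₀` stays constant. The far end is the corrected first component.
  have sq₅ : CommSq t d₀ (pullback.lift d.p₀ d.p₁ d.w) (pullback.lift (k.p ≫ b₀) (θ ≫ z) (by
      rw [Category.assoc, Category.assoc, hz', hb, reassoc_of% hθ'])) := ⟨by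
    ext
    · simp [ht', reassoc_of% hd₀]
    · simp [reassoc_of% hθ₀, hz, e]⟩
  have hξ₀ : sq₅.lift ≫ d.p₀ = k.p ≫ b₀ := by
    calc
      _ = (sq₅.lift ≫ pullback.lift d.p₀ d.p₁ d.w) ≫ pullback.fst q q := by
        simp only [Category.assoc, pullback.lift_fst]
      _ = _ := by rw [sq₅.fac_right, pullback.lift_fst]
  have hξ₁ : sq₅.lift ≫ d.p₁ = θ ≫ z := by
    calc
      _ = (sq₅.lift ≫ pullback.lift d.p₀ d.p₁ d.w) ≫ pullback.snd q q := by
        simp only [Category.assoc, pullback.lift_snd]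
      _ = _ := by rw [sq₅.fac_right, pullback.lift_snd]
  refine ⟨d₁ ≫ sq₅.lift, σ ≫ z, ?_, ?_, ?_, ?_, ?_⟩
  · rw [← reassoc_of% hd, sq₅.fac_left, ht]
  · rw [reassoc_of% hσ, hz, pushout.inr_desc]
  · rw [Category.assoc, hξ₀, reassoc_of% hd₁]
  · rw [Category.assoc, hz', reassoc_of% hσ']
  · rw [Category.assoc, hξ₁, reassoc_of% hθ₁]

/-- The case of an initial source arrow, where the pushout condition holds trivially. This makes it
available for proving that very condition in `weakEquivalence_pushout_inl`. -/
lemma exists_lift_of_isCofibrant [Fibration q] {X Y : C} [IsCofibrant X] [IsCofibrant Y]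
    (f : X ⟶ Y) [WeakEquivalence f] (b₀ : X ⟶ E) (b₁ : Y ⟶ B) (hb : b₀ ≫ q = f ≫ b₁) :
    ∃ (c₀ : X ⟶ d.P) (c₁ : Y ⟶ E), c₀ ≫ d.p₀ = b₀ ∧ c₁ ≫ q = b₁ ∧ c₀ ≫ d.p₁ = f ≫ c₁ := by
  obtain ⟨c₀, c₁, -, -, h⟩ := d.exists_lift (𝟙 (⊥_ C)) f (initial.to X) (initial.to Y) (by simp)
    (initial.to _) (initial.to _) (by simp) b₀ b₁ hb (by simp) (by simp)
  exact ⟨c₀, c₁, h⟩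

end RelPathObject

/-- The pushout of a weak equivalence between cofibrant objects along a cofibration. -/
instance weakEquivalence_pushout_inl {X X' Y : C} (i : X ⟶ X') (f : X ⟶ Y) [IsCofibrant X]
    [IsCofibrant Y] [Cofibration i] [WeakEquivalence f] : WeakEquivalence (pushout.inl i f) := by
  let h := MorphismProperty.factorizationData (trivialCofibrations C) (fibrations C)
    (pushout.inl i f)
  obtain ⟨d⟩ := RelPathObject.exists_relPathObject h.p
  have := d.weakEquivalence_p₀
  have := d.weakEquivalence_p₁
  have := d.fibration_p₀
  -- The maps of `X` and `Y` to the base of the fibration `h.p` are lifted up to the path homotopy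
  -- `K`. Extending `K` over `X'` makes the lift strict on the pushout: this gives a section `s` of
  -- `h.p` for which `pushout.inl i f ≫ s` is a weak equivalence, so that `pushout.inl i f` is a
  -- retract of that composite.
  obtain ⟨K, v, h₀, hv, h₁⟩ := d.exists_lift_of_isCofibrant f (i ≫ h.i) (pushout.inr i f)
    (by rw [Category.assoc, h.fac, pushout.condition])
  have sq : CommSq K i d.p₀ h.i := ⟨h₀⟩
  have e₀ : sq.lift ≫ d.p₀ = h.i := sq.fac_right
  have e₁ : i ≫ sq.lift ≫ d.p₁ = f ≫ v := by rw [← Category.assoc, sq.fac_left, h₁]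
  have : WeakEquivalence sq.lift := weakEquivalence_of_postcomp_of_fac e₀
  let s : pushout i f ⟶ h.Z := pushout.desc (sq.lift ≫ d.p₁) v e₁
  have hs : s ≫ h.p = 𝟙 _ := by
    ext
    · simp [s, ← d.w, reassoc_of% e₀]
    · simp [s, hv]
  have hs' : pushout.inl i f ≫ s = sq.lift ≫ d.p₁ := pushout.inl_desc _ _ _
  let r : RetractArrow (pushout.inl i f) (sq.lift ≫ d.p₁) :=
    { i := Arrow.homMk (𝟙 _) s (by simp [hs'])
      r := Arrow.homMk (𝟙 _) h.p (by simp [← hs', hs])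
      retract := by ext <;> simp [hs] }
  exact weakEquivalence_of_retractArrow r

/-- The class of morphisms of arrows given by relative path objects of fibrations. -/
inductive pathTestMaps : MorphismProperty (Arrow C)
  | mk {E B : C} (q : E ⟶ B) [Fibration q] (d : RelPathObject q) : pathTestMaps d.arrowHom

/-- Only the two components need be cofibrations, not the relative map out of the pushout:
cofibrancy of the source arrow makes the pushout of the weak equivalence `f.hom` a weak equivalence.
-/
lemma pathTestMaps_llp_of_weakEquivalence {f f' : Arrow C} (φ : f ⟶ f') [IsCofibrant f.left]
    [IsCofibrant f.right] [Cofibration φ.left] [Cofibration φ.right] [WeakEquivalence f.hom]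
    [WeakEquivalence f'.hom] : (pathTestMaps (C := C)).llp φ := by
  rintro _ _ _ ⟨q, d⟩
  refine ⟨fun {a b} sq ↦ ?_⟩
  have w := sq.w
  obtain ⟨c₀, c₁, h₁, h₂, h₃, h₄, h₅⟩ := d.exists_lift f.hom f'.hom φ.left φ.right (Arrow.w φ)
    a.left a.right (Arrow.w a) b.left b.right (Arrow.w b)
    (congrArg CommaMorphism.left w) (congrArg CommaMorphism.right w)
  exact ⟨⟨{ l := Arrow.homMk c₀ c₁ h₅
            fac_left := by ext; exacts [h₁, h₂]
            fac_right := by ext; exacts [h₃, h₄] }⟩⟩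

/-- Testing against a path object for the fibration part of `f.hom` yields a section of that
fibration whose composite with `f.hom` is a weak equivalence; `f.hom` is a retract of this
composite. -/
lemma weakEquivalence_of_pathTestMaps_llp {I f : Arrow C} (φ : I ⟶ f) (hI : IsInitial I)
    (h : (pathTestMaps (C := C)).llp φ) : WeakEquivalence f.hom := by
  let k := MorphismProperty.factorizationData (trivialCofibrations C) (fibrations C) f.hom
  obtain ⟨d⟩ := RelPathObject.exists_relPathObject k.p
  have := d.weakEquivalence_p₀
  have := d.weakEquivalence_p₁
  have := h _ (pathTestMaps.mk k.p d)
  let b : f ⟶ Arrow.mk k.p := Arrow.homMk k.i (𝟙 _) (by simp)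
  have sq : CommSq (hI.to _) φ d.arrowHom b := ⟨hI.hom_ext _ _⟩
  have hl := sq.fac_right
  have h₀ : sq.lift.left ≫ d.p₀ = k.i := congrArg CommaMorphism.left hl
  have hs : sq.lift.right ≫ k.p = 𝟙 _ := congrArg CommaMorphism.right hl
  have h₁ : sq.lift.left ≫ d.p₁ = f.hom ≫ sq.lift.right := Arrow.w sq.lift
  have : WeakEquivalence sq.lift.left := weakEquivalence_of_postcomp_of_fac h₀
  have : WeakEquivalence (f.hom ≫ sq.lift.right) := by rw [← h₁]; infer_instance
  let r : RetractArrow f.hom (f.hom ≫ sq.lift.right) :=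
    { i := Arrow.homMk (𝟙 _) sq.lift.right (by simp)
      r := Arrow.homMk (𝟙 _) k.p (by
        change 𝟙 _ ≫ f.hom = (f.hom ≫ sq.lift.right) ≫ k.p
        rw [Category.assoc, hs, Category.comp_id, Category.id_comp])
      retract := by
        ext
        · simp
        · exact hs }
  exact weakEquivalence_of_retractArrow r

end PathLifting

/-! ### The category of morphisms `X ⟶ R Y` -/

/-- Objects `X` of `D` and `Y` of `C` with a morphism `X ⟶ R Y`. -/
structure Glue {C : Type u₁} [Category.{v} C] {D : Type u₂} [Category.{v} D] (R : C ⥤ D) where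
  left : D
  right : C
  hom : left ⟶ R.obj right

namespace Glue

section Basic

variable {C : Type u₁} [Category.{v} C] {D : Type u₂} [Category.{v} D] {R : C ⥤ D}

/-- Morphisms in `Glue R`. -/
@[ext]
structure Hom (X Y : Glue R) where
  left : X.left ⟶ Y.left
  right : X.right ⟶ Y.right
  w : X.hom ≫ R.map right = left ≫ Y.hom

instance : Category (Glue R) where
  Hom := Hom
  id X := ⟨𝟙 _, 𝟙 _, by simp⟩
  comp f g := ⟨f.left ≫ g.left, f.right ≫ g.right, by
    rw [R.map_comp, ← Category.assoc, f.w, Category.assoc, g.w, Category.assoc]⟩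
  id_comp f := Hom.ext (Category.id_comp f.left) (Category.id_comp f.right)
  comp_id f := Hom.ext (Category.comp_id f.left) (Category.comp_id f.right)
  assoc f g h := Hom.ext (Category.assoc f.left g.left h.left)
    (Category.assoc f.right g.right h.right)

@[ext]
lemma hom_ext {X Y : Glue R} {f g : X ⟶ Y} (h : f.left = g.left) (h' : f.right = g.right) :
    f = g := Hom.ext h h'

@[simp] lemma id_left (X : Glue R) : Hom.left (𝟙 X) = 𝟙 X.left := rfl
@[simp] lemma id_right (X : Glue R) : Hom.right (𝟙 X) = 𝟙 X.right := rfl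
@[simp] lemma comp_left {X Y Z : Glue R} (f : X ⟶ Y) (g : Y ⟶ Z) :
    (f ≫ g).left = f.left ≫ g.left := rfl
@[simp] lemma comp_right {X Y Z : Glue R} (f : X ⟶ Y) (g : Y ⟶ Z) :
    (f ≫ g).right = f.right ≫ g.right := rfl

/-- Isomorphisms in `Glue R` from isomorphisms of the components. -/
@[simps]
def mkIso {X Y : Glue R} (e : X.left ≅ Y.left) (e' : X.right ≅ Y.right)
    (w : X.hom ≫ R.map e'.hom = e.hom ≫ Y.hom) : X ≅ Y where
  hom := ⟨e.hom, e'.hom, w⟩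
  inv := ⟨e.inv, e'.inv, by
    rw [← cancel_epi e.hom, ← reassoc_of% w, ← R.map_comp]
    simp⟩
  hom_inv_id := hom_ext e.hom_inv_id e'.hom_inv_id
  inv_hom_id := hom_ext e.inv_hom_id e'.inv_hom_id

variable (R) in
/-- The first component. -/
abbrev leftFunctor : Glue R ⥤ D where
  obj X := X.left
  map f := f.left

variable (R) in
/-- The second component. -/
abbrev rightFunctor : Glue R ⥤ C where
  obj X := X.right
  map f := f.right

section Colimits

variable {J : Type*} [Category* J] {K : J ⥤ Glue R}

/-- A cocone in `Glue R` is a colimit cocone if both its components are. -/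
def isColimitOfComponents (c : Cocone K) (hl : IsColimit ((leftFunctor R).mapCocone c))
    (hr : IsColimit ((rightFunctor R).mapCocone c)) : IsColimit c where
  desc s :=
    { left := hl.desc ((leftFunctor R).mapCocone s)
      right := hr.desc ((rightFunctor R).mapCocone s)
      w := hl.hom_ext fun j ↦ by
        have h := hl.fac ((leftFunctor R).mapCocone s) j
        have h' := hr.fac ((rightFunctor R).mapCocone s) j
        have w := (c.ι.app j).w
        dsimp at h h' w ⊢
        rw [reassoc_of% h, ← reassoc_of% w, ← R.map_comp, h']
        exact (s.ι.app j).w }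
  fac s j := hom_ext (hl.fac ((leftFunctor R).mapCocone s) j)
    (hr.fac ((rightFunctor R).mapCocone s) j)
  uniq s m hm := hom_ext
    (hl.uniq ((leftFunctor R).mapCocone s) _ fun j ↦ congrArg Hom.left (hm j))
    (hr.uniq ((rightFunctor R).mapCocone s) _ fun j ↦ congrArg Hom.right (hm j))

/-- The morphism on colimits of the components induced by a diagram in `Glue R`. -/
def colimitHom {cl : Cocone (K ⋙ leftFunctor R)} (hl : IsColimit cl)
    (cr : Cocone (K ⋙ rightFunctor R)) : cl.pt ⟶ R.obj cr.pt :=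
  hl.desc
    { pt := R.obj cr.pt
      ι :=
        { app := fun j ↦ (K.obj j).hom ≫ R.map (cr.ι.app j)
          naturality := fun j j' f ↦ by
            have h := cr.w f
            dsimp at h ⊢
            rw [← reassoc_of% (K.map f).w, ← R.map_comp, h, Category.comp_id] } }

lemma ι_colimitHom {cl : Cocone (K ⋙ leftFunctor R)} (hl : IsColimit cl)
    (cr : Cocone (K ⋙ rightFunctor R)) (j : J) :
    (K.obj j).hom ≫ R.map (cr.ι.app j) = cl.ι.app j ≫ colimitHom hl cr := by
  rw [colimitHom, hl.fac]

/-- The cocone in `Glue R` constructed from a colimit cocone for the first components and any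
cocone for the second components. -/
abbrev coconeOfComponents {cl : Cocone (K ⋙ leftFunctor R)} (hl : IsColimit cl)
    (cr : Cocone (K ⋙ rightFunctor R)) : Cocone K where
  pt := ⟨cl.pt, cr.pt, colimitHom hl cr⟩
  ι :=
    { app := fun j ↦ ⟨cl.ι.app j, cr.ι.app j, ι_colimitHom hl cr j⟩
      naturality := fun _ _ f ↦ hom_ext (cl.ι.naturality f) (cr.ι.naturality f) }

section

variable (K) [HasColimitsOfShape J C] [HasColimitsOfShape J D]

/-- A colimit cocone in `Glue R`. -/
noncomputable def colimitCocone : ColimitCocone K where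
  cocone := coconeOfComponents (colimit.isColimit (K ⋙ leftFunctor R))
    (colimit.cocone (K ⋙ rightFunctor R))
  isColimit := isColimitOfComponents _ (colimit.isColimit (K ⋙ leftFunctor R))
    (colimit.isColimit (K ⋙ rightFunctor R))

/-- Structure morphisms leave the first component, so colimits are computed componentwise although
`R` need not preserve them. -/
instance : HasColimitsOfShape J (Glue R) := ⟨fun K ↦ ⟨⟨colimitCocone K⟩⟩⟩

instance : PreservesColimitsOfShape J (leftFunctor R) := ⟨fun {K} ↦
  preservesColimit_of_preserves_colimit_cocone (colimitCocone K).isColimit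
    (colimit.isColimit (K ⋙ leftFunctor R))⟩

instance : PreservesColimitsOfShape J (rightFunctor R) := ⟨fun {K} ↦
  preservesColimit_of_preserves_colimit_cocone (colimitCocone K).isColimit
    (colimit.isColimit (K ⋙ rightFunctor R))⟩

end

variable (J)

lemma preservesColimitsOfShape_of_components {E : Type*} [Category* E] (G : E ⥤ Glue R)
    [PreservesColimitsOfShape J (G ⋙ leftFunctor R)]
    [PreservesColimitsOfShape J (G ⋙ rightFunctor R)] : PreservesColimitsOfShape J G :=
  ⟨fun {_} ↦ ⟨fun {_} hc ↦ ⟨isColimitOfComponents _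
    (isColimitOfPreserves (G ⋙ leftFunctor R) hc)
    (isColimitOfPreserves (G ⋙ rightFunctor R) hc)⟩⟩⟩

end Colimits

section Adjunctions

/-- The right adjoint of `leftFunctor R`. -/
noncomputable abbrev ofLeft {F : D ⥤ C} (adj : F ⊣ R) [HasTerminal C] : D ⥤ Glue R where
  obj Z := ⟨Z, ⊤_ C, adj.homEquiv _ _ (terminal.from _)⟩
  map f := ⟨f, 𝟙 _, by
    rw [R.map_id, Category.comp_id, ← adj.homEquiv_naturality_left]
    exact congrArg (adj.homEquiv _ _) (Subsingleton.elim _ _)⟩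

/-- The adjunction between `leftFunctor R` and `ofLeft adj`. -/
noncomputable def leftAdjunction {F : D ⥤ C} (adj : F ⊣ R) [HasTerminal C] :
    leftFunctor R ⊣ ofLeft adj :=
  Adjunction.mkOfHomEquiv
    { homEquiv := fun X Z ↦
        { toFun := fun f ↦ ⟨f, terminal.from _, by
            dsimp
            rw [← adj.homEquiv_naturality_left]
            exact (Equiv.symm_apply_eq _).1 (Subsingleton.elim _ _)⟩
          invFun := fun f ↦ f.left
          left_inv := fun _ ↦ rfl
          right_inv := fun _ ↦ hom_ext rfl (Subsingleton.elim _ _) }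
      homEquiv_naturality_left_symm := fun _ _ ↦ rfl
      homEquiv_naturality_right := fun _ _ ↦ hom_ext rfl (Subsingleton.elim _ _) }

variable (R) in
/-- The right adjoint of `rightFunctor R`. -/
abbrev ofRight : C ⥤ Glue R where
  obj W := ⟨R.obj W, W, 𝟙 _⟩
  map f := ⟨R.map f, f, by simp⟩

variable (R) in
/-- The adjunction between `rightFunctor R` and `ofRight R`. -/
def rightAdjunction : rightFunctor R ⊣ ofRight R :=
  Adjunction.mkOfHomEquiv
    { homEquiv := fun X W ↦
        { toFun := fun f ↦ ⟨X.hom ≫ R.map f, f, by simp⟩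
          invFun := fun f ↦ f.right
          left_inv := fun _ ↦ rfl
          right_inv := fun f ↦ hom_ext (by simpa using f.w) rfl }
      homEquiv_naturality_left_symm := fun _ _ ↦ rfl
      homEquiv_naturality_right := fun _ _ ↦ hom_ext (by dsimp; simp) rfl }

variable {F : D ⥤ C} (adj : F ⊣ R)

/-- The functor to arrows of `C` given by the adjoint morphisms. -/
abbrev arrowFunctor : Glue R ⥤ Arrow C where
  obj X := Arrow.mk ((adj.homEquiv _ _).symm X.hom)
  map f := Arrow.homMk (F.map f.left) f.right (by
    simp only [Arrow.mk_left, Arrow.mk_right, Arrow.mk_hom]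
    rw [← adj.homEquiv_naturality_left_symm, ← adj.homEquiv_naturality_right_symm, f.w])

variable (R) in
/-- The right adjoint of `arrowFunctor adj`. -/
abbrev ofArrow : Arrow C ⥤ Glue R where
  obj E := ⟨R.obj E.left, E.right, R.map E.hom⟩
  map f := ⟨R.map f.left, f.right, by rw [← R.map_comp, ← R.map_comp, Arrow.w]⟩

/-- The adjunction between `arrowFunctor adj` and `ofArrow R`. -/
def arrowAdjunction : arrowFunctor adj ⊣ ofArrow R :=
  Adjunction.mkOfHomEquiv
    { homEquiv := fun X E ↦
        { toFun := fun f ↦ ⟨adj.homEquiv _ _ f.left, f.right, by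
            have := Arrow.w f
            dsimp at this ⊢
            rw [← adj.homEquiv_naturality_right, this, adj.homEquiv_naturality_right,
              Equiv.apply_symm_apply]⟩
          invFun := fun f ↦ Arrow.homMk ((adj.homEquiv _ _).symm f.left) f.right (by
            have := f.w
            dsimp at this ⊢
            rw [← adj.homEquiv_naturality_right_symm, ← this,
              adj.homEquiv_naturality_right_symm])
          left_inv := fun f ↦ by ext <;> simp
          right_inv := fun f ↦ by ext <;> simp }
      homEquiv_naturality_left_symm := fun _ _ ↦ by
        ext
        · simp [adj.homEquiv_naturality_left_symm]
        · rfl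
      homEquiv_naturality_right := fun _ _ ↦ by
        ext
        · simp [adj.homEquiv_naturality_right]
        · rfl }

end Adjunctions

end Basic

section Monoidal

variable {C : Type u₁} [Category.{v} C] [MonoidalCategory C]
  {D : Type u₂} [Category.{v} D] [MonoidalCategory D] {R : C ⥤ D} [R.LaxMonoidal]

open Functor.LaxMonoidal

/-- Structure morphisms point into values of `R`, so the lax structure suffices. A monoid here
amounts to a morphism of monoids `B ⟶ R B'`. -/
instance : MonoidalCategoryStruct (Glue R) where
  tensorObj X Y := ⟨X.left ⊗ Y.left, X.right ⊗ Y.right, (X.hom ⊗ₘ Y.hom) ≫ μ R _ _⟩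
  whiskerLeft X {Y₁ Y₂} f := ⟨X.left ◁ f.left, X.right ◁ f.right, by
    rw [Category.assoc, ← μ_natural_right, ← Category.assoc, ← Category.assoc]
    congr 1
    rw [← id_tensorHom, ← id_tensorHom, tensorHom_comp_tensorHom, tensorHom_comp_tensorHom, f.w,
      Category.comp_id, Category.id_comp]⟩
  whiskerRight {X₁ X₂} f Y := ⟨f.left ▷ Y.left, f.right ▷ Y.right, by
    rw [Category.assoc, ← μ_natural_left, ← Category.assoc, ← Category.assoc]
    congr 1
    rw [← tensorHom_id, ← tensorHom_id, tensorHom_comp_tensorHom, tensorHom_comp_tensorHom, f.w,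
      Category.comp_id, Category.id_comp]⟩
  tensorHom {X₁ Y₁ X₂ Y₂} f g := ⟨f.left ⊗ₘ g.left, f.right ⊗ₘ g.right, by
    rw [Category.assoc, ← μ_natural, ← Category.assoc, ← Category.assoc]
    congr 1
    rw [tensorHom_comp_tensorHom, tensorHom_comp_tensorHom, f.w, g.w]⟩
  tensorUnit := ⟨𝟙_ D, 𝟙_ C, ε R⟩
  associator X Y Z := mkIso (α_ _ _ _) (α_ _ _ _) (by
    dsimp
    rw [← Category.comp_id Z.hom, ← tensorHom_comp_tensorHom, ← Category.comp_id X.hom,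
      ← tensorHom_comp_tensorHom, tensorHom_id, id_tensorHom, Category.assoc, Category.assoc,
      associativity, Category.comp_id, Category.comp_id, associator_naturality_assoc,
      Category.assoc])
  leftUnitor X := mkIso (λ_ _) (λ_ _) (by
    dsimp
    rw [MonoidalCategory.tensorHom_def', Category.assoc, Category.assoc, ← left_unitality,
      leftUnitor_naturality])
  rightUnitor X := mkIso (ρ_ _) (ρ_ _) (by
    dsimp
    simp [MonoidalCategory.tensorHom_def])

@[simp] lemma tensorObj_left (X Y : Glue R) : (X ⊗ Y).left = X.left ⊗ Y.left := rfl
@[simp] lemma tensorObj_right (X Y : Glue R) : (X ⊗ Y).right = X.right ⊗ Y.right := rfl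
@[simp] lemma tensorUnit_left : (𝟙_ (Glue R)).left = 𝟙_ D := rfl
@[simp] lemma tensorUnit_right : (𝟙_ (Glue R)).right = 𝟙_ C := rfl
@[simp] lemma whiskerLeft_left (X : Glue R) {Y Z : Glue R} (f : Y ⟶ Z) :
    (X ◁ f).left = X.left ◁ f.left := rfl
@[simp] lemma whiskerLeft_right (X : Glue R) {Y Z : Glue R} (f : Y ⟶ Z) :
    (X ◁ f).right = X.right ◁ f.right := rfl
@[simp] lemma whiskerRight_left {X Y : Glue R} (f : X ⟶ Y) (Z : Glue R) :
    (f ▷ Z).left = f.left ▷ Z.left := rfl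
@[simp] lemma whiskerRight_right {X Y : Glue R} (f : X ⟶ Y) (Z : Glue R) :
    (f ▷ Z).right = f.right ▷ Z.right := rfl
@[simp] lemma tensorHom_left {X Y X' Y' : Glue R} (f : X ⟶ Y) (g : X' ⟶ Y') :
    (f ⊗ₘ g).left = f.left ⊗ₘ g.left := rfl
@[simp] lemma tensorHom_right {X Y X' Y' : Glue R} (f : X ⟶ Y) (g : X' ⟶ Y') :
    (f ⊗ₘ g).right = f.right ⊗ₘ g.right := rfl
@[simp] lemma associator_hom_left (X Y Z : Glue R) :
    (α_ X Y Z).hom.left = (α_ X.left Y.left Z.left).hom := rfl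
@[simp] lemma associator_hom_right (X Y Z : Glue R) :
    (α_ X Y Z).hom.right = (α_ X.right Y.right Z.right).hom := rfl
@[simp] lemma associator_inv_left (X Y Z : Glue R) :
    (α_ X Y Z).inv.left = (α_ X.left Y.left Z.left).inv := rfl
@[simp] lemma associator_inv_right (X Y Z : Glue R) :
    (α_ X Y Z).inv.right = (α_ X.right Y.right Z.right).inv := rfl
@[simp] lemma leftUnitor_hom_left (X : Glue R) : (λ_ X).hom.left = (λ_ X.left).hom := rfl
@[simp] lemma leftUnitor_hom_right (X : Glue R) : (λ_ X).hom.right = (λ_ X.right).hom := rfl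
@[simp] lemma rightUnitor_hom_left (X : Glue R) : (ρ_ X).hom.left = (ρ_ X.left).hom := rfl
@[simp] lemma rightUnitor_hom_right (X : Glue R) : (ρ_ X).hom.right = (ρ_ X.right).hom := rfl

instance : MonoidalCategory (Glue R) where
  tensorHom_def _ _ := hom_ext (MonoidalCategory.tensorHom_def _ _)
    (MonoidalCategory.tensorHom_def _ _)

end Monoidal

end Glue

/-! ### Tensor products in monoidal model categories -/

section MonoidalModel

variable {C : Type u} [Category.{v} C] [MonoidalCategory C] [ModelCategory C]
  [IsMonoidalModelCategory C]

lemma pushoutProduct_cofibration_of_isPushout {A B K L Q : C} (i : A ⟶ B) (j : K ⟶ L)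
    [Cofibration i] [Cofibration j] {inl : A ⊗ L ⟶ Q} {inr : B ⊗ K ⟶ Q}
    (h : IsPushout (A ◁ j) (i ▷ K) inl inr) (q : Q ⟶ B ⊗ L) (hl : inl ≫ q = i ▷ L)
    (hr : inr ≫ q = B ◁ j) : Cofibration q := by
  have := IsMonoidalModelCategory.pushoutProduct_cofibration i j inferInstance inferInstance
  rw [cofibration_iff] at this ⊢
  refine ((cofibrations C).arrow_mk_iso_iff (Arrow.isoMk h.isoPushout (Iso.refl _) ?_)).2 this
  apply h.hom_ext <;> simp [hl, hr, pushout.inl_desc, pushout.inr_desc]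

lemma pushoutProduct_weakEquivalence_of_isPushout {A B K L Q : C} (i : A ⟶ B) (j : K ⟶ L)
    [Cofibration i] [Cofibration j] (hij : WeakEquivalence i ∨ WeakEquivalence j)
    {inl : A ⊗ L ⟶ Q} {inr : B ⊗ K ⟶ Q}
    (h : IsPushout (A ◁ j) (i ▷ K) inl inr) (q : Q ⟶ B ⊗ L) (hl : inl ≫ q = i ▷ L)
    (hr : inr ≫ q = B ◁ j) : WeakEquivalence q := by
  have := IsMonoidalModelCategory.pushoutProduct_weakEquivalence i j inferInstance
    inferInstance hij
  rw [weakEquivalence_iff] at this ⊢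
  refine ((weakEquivalences C).arrow_mk_iso_iff (Arrow.isoMk h.isoPushout (Iso.refl _) ?_)).2 this
  apply h.hom_ext <;> simp [hl, hr, pushout.inl_desc, pushout.inr_desc]

variable [SymmetricCategory C] [MonoidalClosed C]

omit [IsMonoidalModelCategory C] in
-- Tensoring preserves initial objects, so the pushout product of `∅ ⟶ B` with `j` degenerates to `B
-- ◁ j`. In this way the pushout product axiom controls tensoring with a cofibrant object.
lemma isPushout_initial_tensor (B : C) {K L : C} (j : K ⟶ L) :
    ∃ t : (⊥_ C) ⊗ L ⟶ B ⊗ K,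
      IsPushout ((⊥_ C) ◁ j) (initial.to B ▷ K) t (𝟙 _) ∧ t ≫ B ◁ j = initial.to B ▷ L := by
  have h (K : C) : IsInitial ((⊥_ C) ⊗ K) :=
    IsInitial.isInitialObj (tensorRight K) _ initialIsInitial
  have := isIso_of_isInitial (h K) (h L) ((⊥_ C) ◁ j)
  exact ⟨(h L).to _, IsPushout.of_horiz_isIso ⟨(h K).hom_ext _ _⟩, (h L).hom_ext _ _⟩

omit [IsMonoidalModelCategory C] [SymmetricCategory C] in
lemma isPushout_tensor_initial {A B : C} (i : A ⟶ B) (L : C) :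
    ∃ t : B ⊗ (⊥_ C) ⟶ A ⊗ L,
      IsPushout (A ◁ initial.to L) (i ▷ (⊥_ C)) (𝟙 _) t ∧ t ≫ i ▷ L = B ◁ initial.to L := by
  have h (K : C) : IsInitial (K ⊗ (⊥_ C)) :=
    IsInitial.isInitialObj (tensorLeft K) _ initialIsInitial
  have := isIso_of_isInitial (h A) (h B) (i ▷ (⊥_ C))
  exact ⟨(h B).to _, IsPushout.of_vert_isIso ⟨(h A).hom_ext _ _⟩, (h B).hom_ext _ _⟩

instance cofibration_whiskerLeft (B : C) [IsCofibrant B] {K L : C} (j : K ⟶ L) [Cofibration j] :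
    Cofibration (B ◁ j) := by
  obtain ⟨t, h, ht⟩ := isPushout_initial_tensor B j
  exact pushoutProduct_cofibration_of_isPushout _ _ h _ ht (Category.id_comp _)

instance cofibration_whiskerRight {A B : C} (i : A ⟶ B) [Cofibration i] (L : C) [IsCofibrant L] :
    Cofibration (i ▷ L) := by
  obtain ⟨t, h, ht⟩ := isPushout_tensor_initial i L
  exact pushoutProduct_cofibration_of_isPushout _ _ h _ (Category.id_comp _) ht

instance isCofibrant_tensor (A B : C) [IsCofibrant A] [IsCofibrant B] : IsCofibrant (A ⊗ B) :=
  (isCofibrant_iff_of_isInitial (A ◁ initial.to B)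
    (IsInitial.isInitialObj (tensorLeft A) _ initialIsInitial)).2 inferInstance

instance weakEquivalence_whiskerLeft (B : C) [IsCofibrant B] {K L : C} (j : K ⟶ L)
    [IsCofibrant K] [IsCofibrant L] [WeakEquivalence j] : WeakEquivalence (B ◁ j) :=
  weakEquivalence_map_of_isCofibrant (tensorLeft B) (fun _ _ j _ _ _ ↦ by
    obtain ⟨t, h, ht⟩ := isPushout_initial_tensor B j
    exact pushoutProduct_weakEquivalence_of_isPushout _ j (.inr inferInstance) h _ ht
      (Category.id_comp _)) j

instance weakEquivalence_whiskerRight {A B : C} (i : A ⟶ B) [IsCofibrant A] [IsCofibrant B]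
    [WeakEquivalence i] (L : C) [IsCofibrant L] : WeakEquivalence (i ▷ L) :=
  weakEquivalence_map_of_isCofibrant (tensorRight L) (fun _ _ i _ _ _ ↦ by
    obtain ⟨t, h, ht⟩ := isPushout_tensor_initial i L
    exact pushoutProduct_weakEquivalence_of_isPushout i _ (.inl inferInstance) h _
      (Category.id_comp _) ht) i

end MonoidalModel

/-! ### Good objects -/

namespace Glue

section Good

variable {C : Type u₁} [Category.{v} C] [ModelCategory C]
  {D : Type u₂} [Category.{v} D] [ModelCategory D] {F : D ⥤ C} {R : C ⥤ D} (adj : F ⊣ R)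

/-- The images of trivial fibrations and of `pathTestMaps` under the right adjoints of the
functors from `Glue R` to `D`, `C` and `Arrow C`. -/
noncomputable def testMaps : MorphismProperty (Glue R) :=
  (trivialFibrations D).strictMap (ofLeft adj) ⊔ (trivialFibrations C).strictMap (ofRight R) ⊔
    pathTestMaps.strictMap (ofArrow R)

/-- The morphisms with the left lifting property with respect to `testMaps`. -/
noncomputable abbrev good : MorphismProperty (Glue R) := (testMaps adj).llp

/-- Lifting problems are transposed along the three adjunctions. Packing the three conditions into
one lifting property gives all closure properties of good morphisms at once. -/
lemma good_iff {X Y : Glue R} (f : X ⟶ Y) :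
    good adj f ↔ Cofibration f.left ∧ Cofibration f.right ∧
      pathTestMaps.llp ((arrowFunctor adj).map f) := by
  rw [cofibration_iff, cofibration_iff, ← trivialFibrations_llp, ← trivialFibrations_llp]
  constructor
  · intro h
    refine ⟨fun _ _ p hp ↦ ?_, fun _ _ p hp ↦ ?_, fun _ _ p hp ↦ ?_⟩
    · exact ((leftAdjunction adj).hasLiftingProperty_iff f p).2 (h _ (.inl (.inl ⟨hp⟩)))
    · exact ((rightAdjunction R).hasLiftingProperty_iff f p).2 (h _ (.inl (.inr ⟨hp⟩)))
    · exact ((arrowAdjunction adj).hasLiftingProperty_iff f p).2 (h _ (.inr ⟨hp⟩))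
  · rintro ⟨h₁, h₂, h₃⟩ _ _ _ ((hp | hp) | hp) <;> obtain ⟨hp⟩ := hp
    · exact ((leftAdjunction adj).hasLiftingProperty_iff f _).1 (h₁ _ hp)
    · exact ((rightAdjunction R).hasLiftingProperty_iff f _).1 (h₂ _ hp)
    · exact ((arrowAdjunction adj).hasLiftingProperty_iff f _).1 (h₃ _ hp)

/-- An object of `Glue R` is good if both components are cofibrant and the adjoint morphism is
a weak equivalence. -/
structure IsGood (X : Glue R) : Prop where
  left : IsCofibrant X.left
  right : IsCofibrant X.right
  weakEquivalence : WeakEquivalence ((adj.homEquiv _ _).symm X.hom)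

variable {adj}

/-- `F` preserves cofibrations and cofibrant objects, so the induced map of arrows is a
componentwise cofibration of weak equivalences with cofibrant source, and lifts by
`pathTestMaps_llp_of_weakEquivalence`. -/
lemma good_of_cofibration (hR : IsRightQuillen R) {X Y : Glue R} (f : X ⟶ Y)
    (hX : IsGood adj X) (hY : WeakEquivalence ((adj.homEquiv _ _).symm Y.hom))
    [Cofibration f.left] [Cofibration f.right] : good adj f := by
  rw [good_iff]
  refine ⟨inferInstance, inferInstance, ?_⟩
  obtain ⟨_, _, _⟩ := hX
  have : IsCofibrant ((arrowFunctor adj).obj X).left := hR.isCofibrant_obj adj X.left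
  have : IsCofibrant ((arrowFunctor adj).obj X).right := ‹IsCofibrant X.right›
  have : Cofibration ((arrowFunctor adj).map f).left := hR.cofibration_map adj f.left
  have : Cofibration ((arrowFunctor adj).map f).right := ‹Cofibration f.right›
  have : WeakEquivalence ((arrowFunctor adj).obj X).hom := ‹_›
  have : WeakEquivalence ((arrowFunctor adj).obj Y).hom := hY
  exact pathTestMaps_llp_of_weakEquivalence _

variable (adj) in
lemma isGood_of_good_of_isInitial {I X : Glue R} (hI : IsInitial I) (f : I ⟶ X)
    (hf : good adj f) : IsGood adj X := by
  obtain ⟨h₁, h₂, h₃⟩ := (good_iff adj f).1 hf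
  have := (arrowAdjunction adj).isLeftAdjoint
  exact ⟨(isCofibrant_iff_of_isInitial f.left (IsInitial.isInitialObj (leftFunctor R) _ hI)).2 h₁,
    (isCofibrant_iff_of_isInitial f.right (IsInitial.isInitialObj (rightFunctor R) _ hI)).2 h₂,
    weakEquivalence_of_pathTestMaps_llp _ (IsInitial.isInitialObj (arrowFunctor adj) _ hI) h₃⟩

/-- The functors to `D`, `C` and arrows of `C` are left adjoints, hence preserve initial objects,
and the initial object is itself good. Good objects thus inherit the closure properties of a lifting
class. -/
lemma good_iff_isGood_of_isInitial (hR : IsRightQuillen R) {I X : Glue R} (hI : IsInitial I)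
    (f : I ⟶ X) : good adj f ↔ IsGood adj X := by
  refine ⟨isGood_of_good_of_isInitial adj hI f, fun hX ↦ ?_⟩
  have := (arrowAdjunction adj).isLeftAdjoint
  have hI' : IsGood adj I := isGood_of_good_of_isInitial adj hI (𝟙 I)
    (MorphismProperty.id_mem _ _)
  have : Cofibration f.left :=
    (isCofibrant_iff_of_isInitial f.left (IsInitial.isInitialObj (leftFunctor R) _ hI)).1 hX.left
  have : Cofibration f.right :=
    (isCofibrant_iff_of_isInitial f.right
      (IsInitial.isInitialObj (rightFunctor R) _ hI)).1 hX.right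
  exact good_of_cofibration hR f hI' hX.weakEquivalence

lemma IsGood.of_good (hR : IsRightQuillen R) {X Y : Glue R} (hX : IsGood adj X) (f : X ⟶ Y)
    (hf : good adj f) : IsGood adj Y :=
  isGood_of_good_of_isInitial adj initialIsInitial (initial.to X ≫ f)
    (MorphismProperty.comp_mem _ _ _
      ((good_iff_isGood_of_isInitial hR initialIsInitial _).2 hX) hf)

lemma IsGood.of_retract (hR : IsRightQuillen R) {X Y : Glue R} (r : Retract X Y)
    (hY : IsGood adj Y) : IsGood adj X := by
  rw [← good_iff_isGood_of_isInitial hR initialIsInitial (initial.to _)] at hY ⊢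
  let r' : RetractArrow (initial.to X) (initial.to Y) :=
    { i := Arrow.homMk (𝟙 _) r.i
      r := Arrow.homMk (𝟙 _) r.r }
  exact MorphismProperty.of_retract r' hY

end Good

section

variable {C : Type u₁} [Category.{v} C] [MonoidalCategory C]
  {D : Type u₂} [Category.{v} D] [MonoidalCategory D]
  {F : D ⥤ C} {R : C ⥤ D} [R.LaxMonoidal] {adj : F ⊣ R}

lemma homEquiv_symm_tensor (X Y : Glue R) :
    (adj.homEquiv _ _).symm (X ⊗ Y).hom = comonoidalMap adj X.left Y.left ≫
      ((adj.homEquiv _ _).symm X.hom ⊗ₘ (adj.homEquiv _ _).symm Y.hom) := by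
  rw [Equiv.symm_apply_eq, adj.homEquiv_naturality_right, comonoidalMap]
  erw [Equiv.apply_symm_apply]
  rw [Category.assoc, ← Functor.LaxMonoidal.μ_natural, tensorHom_comp_tensorHom_assoc]
  simp only [← adj.homEquiv_unit, Equiv.apply_symm_apply]
  rfl

instance preservesColimitsOfShape_tensorRight (J : Type*) [Category* J] (X : Glue R)
    [HasColimitsOfShape J C] [HasColimitsOfShape J D]
    [PreservesColimitsOfShape J (tensorRight X.left)]
    [PreservesColimitsOfShape J (tensorRight X.right)] :
    PreservesColimitsOfShape J (tensorRight X) :=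
  have : PreservesColimitsOfShape J (tensorRight X ⋙ leftFunctor R) :=
    inferInstanceAs (PreservesColimitsOfShape J (leftFunctor R ⋙ tensorRight X.left))
  have : PreservesColimitsOfShape J (tensorRight X ⋙ rightFunctor R) :=
    inferInstanceAs (PreservesColimitsOfShape J (rightFunctor R ⋙ tensorRight X.right))
  preservesColimitsOfShape_of_components J (tensorRight X)

end

section GoodTensor

variable {C : Type u₁} [Category.{v} C] [MonoidalCategory C] [SymmetricCategory C]
  [MonoidalClosed C] [ModelCategory C] [IsMonoidalModelCategory C]
  {D : Type u₂} [Category.{v} D] [MonoidalCategory D] [SymmetricCategory D]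
  [MonoidalClosed D] [ModelCategory D] [IsMonoidalModelCategory D]
  {F : D ⥤ C} {R : C ⥤ D} [R.LaxMonoidal] {adj : F ⊣ R}

/-- The adjunct of a tensor product is the comonoidal map, a weak equivalence by condition (i),
followed by the tensor product of two weak equivalences between cofibrant objects. -/
lemma IsGood.tensor (hR : IsWeakMonoidalQuillenPair adj) {X Y : Glue R} (hX : IsGood adj X)
    (hY : IsGood adj Y) : IsGood adj (X ⊗ Y) := by
  obtain ⟨_, _, _⟩ := hX
  obtain ⟨_, _, _⟩ := hY
  have := hR.isRightQuillen.isCofibrant_obj adj X.left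
  have := hR.isRightQuillen.isCofibrant_obj adj Y.left
  refine ⟨isCofibrant_tensor X.left Y.left, isCofibrant_tensor X.right Y.right, ?_⟩
  rw [homEquiv_symm_tensor, MonoidalCategory.tensorHom_def]
  have := hR.comonoidalMap_weakEquivalence X.left Y.left inferInstance inferInstance
  infer_instance

lemma good_whiskerLeft (hR : IsWeakMonoidalQuillenPair adj) {X Y Z : Glue R} (hX : IsGood adj X)
    (hY : IsGood adj Y) (f : Y ⟶ Z) (hf : good adj f) :
    good adj (X ◁ f) := by
  have hZ := hY.of_good hR.isRightQuillen f hf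
  rw [good_iff] at hf
  obtain ⟨_, _, _⟩ := hf
  have := hX.left
  have := hX.right
  have : Cofibration (X ◁ f).left := cofibration_whiskerLeft X.left f.left
  have : Cofibration (X ◁ f).right := cofibration_whiskerLeft X.right f.right
  exact good_of_cofibration hR.isRightQuillen _ (hX.tensor hR hY) (hX.tensor hR hZ).weakEquivalence

lemma good_whiskerRight (hR : IsWeakMonoidalQuillenPair adj) {X Y Z : Glue R} (hX : IsGood adj X)
    (hZ : IsGood adj Z) (f : X ⟶ Y) (hf : good adj f) :
    good adj (f ▷ Z) := by
  have hY := hX.of_good hR.isRightQuillen f hf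
  rw [good_iff] at hf
  obtain ⟨_, _, _⟩ := hf
  have := hZ.left
  have := hZ.right
  have : Cofibration (f ▷ Z).left := cofibration_whiskerRight f.left Z.left
  have : Cofibration (f ▷ Z).right := cofibration_whiskerRight f.right Z.right
  exact good_of_cofibration hR.isRightQuillen _ (hX.tensor hR hZ) (hY.tensor hR hZ).weakEquivalence

/-- `Q` is good as the target of a cobase change of `f ▷ K` starting at the good object `X ⊗ L`.
Both ends of `q` are then good, and the pushout product axioms in `C` and `D` make its components
cofibrations. -/
lemma good_pushoutProduct (hR : IsWeakMonoidalQuillenPair adj)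
    {X Y K L Q : Glue R} (hX : IsGood adj X) (hK : IsGood adj K) (f : X ⟶ Y) (g : K ⟶ L)
    (hf : good adj f) (hg : good adj g) {inl : X ⊗ L ⟶ Q} {inr : Y ⊗ K ⟶ Q}
    (h : IsPushout (X ◁ g) (f ▷ K) inl inr) (q : Q ⟶ Y ⊗ L) (hl : inl ≫ q = f ▷ L)
    (hr : inr ≫ q = Y ◁ g) : good adj q := by
  have hY := hX.of_good hR.isRightQuillen f hf
  have hL := hK.of_good hR.isRightQuillen g hg
  have hQ : IsGood adj Q := (hX.tensor hR hL).of_good hR.isRightQuillen inl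
    (MorphismProperty.of_isPushout h (good_whiskerRight hR hX hK f hf))
  obtain ⟨_, _, -⟩ := (good_iff adj f).1 hf
  obtain ⟨_, _, -⟩ := (good_iff adj g).1 hg
  have : Cofibration q.left := pushoutProduct_cofibration_of_isPushout f.left g.left
    (h.map (leftFunctor R)) q.left (congrArg Hom.left hl) (congrArg Hom.left hr)
  have : Cofibration q.right := pushoutProduct_cofibration_of_isPushout f.right g.right
    (h.map (rightFunctor R)) q.right (congrArg Hom.right hl) (congrArg Hom.right hr)
  exact good_of_cofibration hR.isRightQuillen q hQ (hY.tensor hR hL).weakEquivalence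

end GoodTensor

end Glue

/-! ### Colimits of modules and free modules -/

namespace RightMod

variable {V : Type u} [Category.{v} V] [MonoidalCategory V] {B : Mon V}

@[ext]
lemma hom_ext {M N : RightMod B} {f g : M ⟶ N} (h : f.hom = g.hom) : f = g := Hom.ext h

@[simp] lemma id_hom (M : RightMod B) : Hom.hom (𝟙 M) = 𝟙 M.X := rfl
@[simp] lemma comp_hom {M N P : RightMod B} (f : M ⟶ N) (g : N ⟶ P) :
    (f ≫ g).hom = f.hom ≫ g.hom := rfl

/-- Isomorphisms of modules from isomorphisms of the underlying objects. -/
@[simps]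
def mkIso {M N : RightMod B} (e : M.X ≅ N.X) (h : M.act ≫ e.hom = e.hom ▷ B.X ≫ N.act) :
    M ≅ N where
  hom := ⟨e.hom, h⟩
  inv := ⟨e.inv, by
    rw [← cancel_epi (e.hom ▷ B.X), ← reassoc_of% h, e.hom_inv_id, Category.comp_id,
      hom_inv_whiskerRight_assoc]⟩

variable (B) in
/-- The functor `forget B`, as a reducible definition. -/
abbrev underlying : RightMod B ⥤ V where
  obj M := M.X
  map f := f.hom

section Colimits

lemma act_one_of_hom {M : RightMod B} {Y : V} (f : M.X ⟶ Y) (a : Y ⊗ B.X ⟶ Y)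
    (h : f ▷ B.X ≫ a = M.act ≫ f) :
    f ▷ 𝟙_ V ≫ Y ◁ MonObj.one ≫ a = f ▷ 𝟙_ V ≫ (ρ_ Y).hom := by
  rw [← whisker_exchange_assoc, h, reassoc_of% M.act_one, rightUnitor_naturality]

lemma act_mul_of_hom {M : RightMod B} {Y : V} (f : M.X ⟶ Y) (a : Y ⊗ B.X ⟶ Y)
    (h : f ▷ B.X ≫ a = M.act ≫ f) :
    f ▷ (B.X ⊗ B.X) ≫ Y ◁ MonObj.mul ≫ a =
      f ▷ (B.X ⊗ B.X) ≫ (α_ Y B.X B.X).inv ≫ a ▷ B.X ≫ a := by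
  rw [← whisker_exchange_assoc, h, reassoc_of% M.act_mul, associator_inv_naturality_left_assoc,
    ← comp_whiskerRight_assoc, h, comp_whiskerRight_assoc, h]

variable {J : Type*} [Category* J] [∀ X : V, PreservesColimitsOfShape J (tensorRight X)]
  {K : J ⥤ RightMod B}

section

variable {c : Cocone (K ⋙ underlying B)} (hc : IsColimit c)

/-- The action on the colimit of the underlying objects of a diagram of modules. -/
noncomputable def colimitAct : c.pt ⊗ B.X ⟶ c.pt :=
  (isColimitOfPreserves (tensorRight B.X) hc).desc
    { pt := c.pt
      ι :=
        { app := fun j ↦ (K.obj j).act ≫ c.ι.app j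
          naturality := fun j j' f ↦ by
            have := c.w f
            dsimp at this ⊢
            rw [← reassoc_of% (K.map f).act_hom, this, Category.comp_id] } }

lemma ι_colimitAct (j : J) : c.ι.app j ▷ B.X ≫ colimitAct hc = (K.obj j).act ≫ c.ι.app j :=
  (isColimitOfPreserves (tensorRight B.X) hc).fac _ j

lemma tensor_hom_ext {c : Cocone (K ⋙ underlying B)} (hc : IsColimit c) {Z X : V}
    {f g : c.pt ⊗ X ⟶ Z} (h : ∀ j, c.ι.app j ▷ X ≫ f = c.ι.app j ▷ X ≫ g) : f = g :=
  (isColimitOfPreserves (tensorRight X) hc).hom_ext h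

/-- The cocone of modules constructed from a colimit cocone of the underlying objects. -/
noncomputable abbrev liftedCocone : Cocone K where
  pt :=
    { X := c.pt
      act := colimitAct hc
      act_one := tensor_hom_ext hc fun j ↦ act_one_of_hom _ _ (ι_colimitAct hc j)
      act_mul := tensor_hom_ext hc fun j ↦ act_mul_of_hom _ _ (ι_colimitAct hc j) }
  ι :=
    { app := fun j ↦ ⟨c.ι.app j, (ι_colimitAct hc j).symm⟩
      naturality := fun _ _ f ↦ hom_ext (c.ι.naturality f) }

/-- The cocone `liftedCocone` is a colimit cocone. -/
noncomputable def isColimitLiftedCocone : IsColimit (liftedCocone hc) where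
  desc s :=
    { hom := hc.desc ((underlying B).mapCocone s)
      act_hom := tensor_hom_ext hc fun j ↦ by
        have h := hc.fac ((underlying B).mapCocone s) j
        have h' := ι_colimitAct hc j
        dsimp at h h' ⊢
        rw [reassoc_of% h', h, ← comp_whiskerRight_assoc, h]
        exact (s.ι.app j).act_hom }
  fac s j := hom_ext (hc.fac ((underlying B).mapCocone s) j)
  uniq s m hm := hom_ext
    (hc.uniq ((underlying B).mapCocone s) _ fun j ↦ congrArg Hom.hom (hm j))

end

instance [HasColimitsOfShape J V] : HasColimitsOfShape J (RightMod B) :=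
  ⟨fun K ↦ ⟨⟨⟨_, isColimitLiftedCocone (colimit.isColimit (K ⋙ underlying B))⟩⟩⟩⟩

instance [HasColimitsOfShape J V] : PreservesColimitsOfShape J (underlying B) := ⟨fun {K} ↦
  preservesColimit_of_preserves_colimit_cocone
    (isColimitLiftedCocone (colimit.isColimit (K ⋙ underlying B)))
    (colimit.isColimit (K ⋙ underlying B))⟩

end Colimits

section Free

variable (B) in
/-- The free module functor. -/
abbrev free : V ⥤ RightMod B where
  obj X :=
    { X := X ⊗ B.X
      act := (α_ X B.X B.X).hom ≫ X ◁ MonObj.mul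
      act_one := by
        rw [associator_naturality_right_assoc, ← MonoidalCategory.whiskerLeft_comp,
          MonObj.mul_one, whiskerLeft_rightUnitor, Iso.hom_inv_id_assoc]
      act_mul := by
        rw [associator_naturality_right_assoc, ← MonoidalCategory.whiskerLeft_comp,
          MonObj.mul_assoc_flip, comp_whiskerRight, Category.assoc,
          associator_naturality_middle_assoc, ← MonoidalCategory.whiskerLeft_comp]
        simp }
  map f :=
    { hom := f ▷ B.X
      act_hom := by simp [whisker_exchange] }

/-- The unit of the free module adjunction. -/
def freeUnit (X : V) : X ⟶ X ⊗ B.X := (ρ_ X).inv ≫ X ◁ MonObj.one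

lemma freeUnit_naturality {X Y : V} (f : X ⟶ Y) :
    freeUnit (B := B) X ≫ f ▷ B.X = f ≫ freeUnit Y := by
  rw [freeUnit, freeUnit, Category.assoc, whisker_exchange, rightUnitor_inv_naturality_assoc]

lemma freeUnit_act (M : RightMod B) : freeUnit M.X ≫ M.act = 𝟙 _ := by
  rw [freeUnit, Category.assoc, M.act_one, Iso.inv_hom_id]

/-- The morphism from a free module determined by a morphism to the underlying object. -/
@[simps]
def freeDesc {X : V} {M : RightMod B} (f : X ⟶ M.X) : (free B).obj X ⟶ M where
  hom := f ▷ B.X ≫ M.act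
  act_hom := by
    rw [Category.assoc, whisker_exchange_assoc, M.act_mul]
    simp

lemma freeUnit_freeDesc {X : V} {M : RightMod B} (f : X ⟶ M.X) :
    freeUnit X ≫ (freeDesc f).hom = f := by
  rw [freeDesc_hom]
  erw [reassoc_of% freeUnit_naturality (B := B) f]
  rw [freeUnit_act, Category.comp_id]

lemma freeDesc_freeUnit {X : V} {M : RightMod B} (f : (free B).obj X ⟶ M) :
    freeDesc (freeUnit X ≫ f.hom) = f := by
  ext
  rw [freeDesc_hom, comp_whiskerRight, Category.assoc, ← f.act_hom, freeUnit]
  have : (ρ_ X).inv ▷ B.X ≫ (X ◁ MonObj.one) ▷ B.X ≫ (α_ X B.X B.X).hom ≫ X ◁ MonObj.mul = 𝟙 _ := by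
    rw [associator_naturality_middle_assoc, ← MonoidalCategory.whiskerLeft_comp, MonObj.one_mul]
    simp
  simpa using this =≫ f.hom

lemma free_hom_ext {X : V} {M : RightMod B} {f g : (free B).obj X ⟶ M}
    (h : freeUnit X ≫ f.hom = freeUnit X ≫ g.hom) : f = g := by
  rw [← freeDesc_freeUnit f, h, freeDesc_freeUnit]

variable (B) in
/-- The free module functor is left adjoint to the forgetful functor. -/
def freeAdjunction : free B ⊣ underlying B := Adjunction.mkOfHomEquiv
  { homEquiv := fun X M ↦
      { toFun := fun f ↦ freeUnit X ≫ f.hom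
        invFun := freeDesc
        left_inv := freeDesc_freeUnit
        right_inv := freeUnit_freeDesc }
    homEquiv_naturality_left_symm := fun f g ↦ by
      ext
      simp
    homEquiv_naturality_right := fun f g ↦ by simp }

variable (B) in
/-- A monoid as a module over itself. -/
abbrev self : RightMod B where
  X := B.X
  act := MonObj.mul
  act_one := MonObj.mul_one _
  act_mul := by rw [MonObj.mul_assoc, Iso.inv_hom_id_assoc]

end Free

end RightMod

/-- The conditions on an action of a monoid. -/
structure IsAction {V : Type u} [Category.{v} V] [MonoidalCategory V] (P : Mon V) {X : V}
    (act : X ⊗ P.X ⟶ X) : Prop where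
  act_one : X ◁ MonObj.one ≫ act = (ρ_ X).hom
  act_mul : X ◁ MonObj.mul ≫ act = (α_ X P.X P.X).inv ≫ act ▷ P.X ≫ act

/-- The morphism `l : L ⟶ P` is such that each `B`-module with a compatible action of `L` is
a `P`-module, and `L`-linear morphisms of `P`-modules are `P`-linear. -/
structure GeneratesActions {V : Type u} [Category.{v} V] [MonoidalCategory V] {B : Mon V} {L : V}
    (i : B.X ⟶ L) {P : Mon V} (l : L ⟶ P.X) : Prop where
  exists_action (M : RightMod B) (m : M.X ⊗ L ⟶ M.X) (hm : M.X ◁ i ≫ m = M.act) :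
    ∃ act : M.X ⊗ P.X ⟶ M.X, IsAction P act ∧ M.X ◁ l ≫ act = m
  linear (M N : RightMod P) (f : M.X ⟶ N.X)
    (hf : (M.X ◁ l ≫ M.act) ≫ f = f ▷ L ≫ N.X ◁ l ≫ N.act) : M.act ≫ f = f ▷ P.X ≫ N.act

/-- The inverse `r` of `m` lets `P` act on the generator `u = ι(1)`. Linearity of `m` over `P` gives
`r ≫ m = 𝟙`; for the other composite, `m ≫ r` is an endomorphism of `S` fixing the generator, so
`uniq` applies. -/
lemma exists_iso_of_isAction {V : Type u} [Category.{v} V] [MonoidalCategory V] {B : Mon V}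
    {L : V} {i : B.X ⟶ L} {P : Mon V} {j : B ⟶ P} {l : L ⟶ P.X} (hl : i ≫ l = j.hom)
    {S : V} (ι : B.X ⟶ S) {sB : S ⊗ B.X ⟶ S} (hι : MonObj.mul ≫ ι = ι ▷ B.X ≫ sB)
    (s : S ⊗ L ⟶ S) (hs : S ◁ i ≫ s = sB) (m : S ⟶ P.X) (hm : ι ≫ m = j.hom)
    (hmB : sB ≫ m = m ▷ B.X ≫ P.X ◁ j.hom ≫ MonObj.mul)
    (hms : s ≫ m = m ▷ L ≫ P.X ◁ l ≫ MonObj.mul)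
    (act : S ⊗ P.X ⟶ S) (hact : IsAction P act) (hact' : S ◁ l ≫ act = s)
    (hact_m : act ≫ m = m ▷ P.X ≫ MonObj.mul)
    (uniq : ∀ g : S ⟶ S, sB ≫ g = g ▷ B.X ≫ sB → ι ≫ g = ι → s ≫ g = g ▷ L ≫ s → g = 𝟙 S) :
    ∃ e : S ≅ P.X, ι ≫ e.hom = j.hom := by
  let u : 𝟙_ V ⟶ S := MonObj.one ≫ ι
  have hu : u ≫ m = MonObj.one := by
    rw [Category.assoc, hm, IsMonHom.one_hom]
  let r : P.X ⟶ S := (λ_ P.X).inv ≫ u ▷ P.X ≫ act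
  have hrm : r ≫ m = 𝟙 _ := by
    simp only [r, Category.assoc]
    rw [hact_m, ← comp_whiskerRight_assoc, hu, MonObj.one_mul, Iso.inv_hom_id]
  have hr {Z : V} (z : Z ⟶ P.X) : z ≫ r = (λ_ Z).inv ≫ u ▷ Z ≫ S ◁ z ≫ act := by
    rw [← whisker_exchange_assoc, leftUnitor_inv_naturality_assoc]
  have hj : S ◁ j.hom ≫ act = sB := by
    rw [← hl, MonoidalCategory.whiskerLeft_comp, Category.assoc, hact', hs]
  have hr_mul : MonObj.mul ≫ r = r ▷ P.X ≫ act := by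
    rw [hr, hact.act_mul]
    simp [r]
  refine ⟨⟨m, r, uniq _ ?_ ?_ ?_, hrm⟩, hm⟩
  · rw [reassoc_of% hmB, hr_mul, whisker_exchange_assoc, hj, ← comp_whiskerRight_assoc]
  · rw [← Category.assoc, hm, hr, hj, comp_whiskerRight_assoc, ← hι, MonObj.one_mul_assoc,
      Iso.inv_hom_id_assoc]
  · rw [reassoc_of% hms, hr_mul, ← hact', whisker_exchange_assoc, ← comp_whiskerRight_assoc]

/-! ### The free module with a compatible action of an object under the monoid -/

section Chain

open RightMod

variable {V : Type u} [Category.{v} V] [MonoidalCategory V] {B : Mon V} {L : V}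

/-- A stage in the construction of the free `B`-module on one generator with a compatible
morphism `M ⊗ L ⟶ M`. -/
structure Stage (i : B.X ⟶ L) where
  Y : RightMod B
  Q : V
  k : Y.X ⊗ B.X ⟶ Q
  q : Q ⟶ Y.X ⊗ L
  r : Q ⟶ Y.X
  k_q : k ≫ q = Y.X ◁ i
  k_r : k ≫ r = Y.act

namespace Stage

variable {i : B.X ⟶ L} [HasPushouts V]
  [∀ X : V, PreservesColimitsOfShape WalkingSpan (tensorRight X)]

variable (i) in
/-- The initial stage. -/
@[simps]
def start : Stage i where
  Y := self B
  Q := B.X ⊗ B.X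
  k := 𝟙 _
  q := B.X ◁ i
  r := MonObj.mul
  k_q := Category.id_comp _
  k_r := Category.id_comp _

variable (S : Stage i)

/-- The module in the next stage. -/
noncomputable def nextY : RightMod B := pushout ((free B).map S.q) (freeDesc S.r)

/-- The morphism to the next stage. -/
noncomputable def p : S.Y ⟶ S.nextY := pushout.inr _ _

/-- The morphism from the free module to the next stage. -/
noncomputable def f : (free B).obj (S.Y.X ⊗ L) ⟶ S.nextY := pushout.inl _ _

lemma q_f : (free B).map S.q ≫ S.f = freeDesc S.r ≫ S.p := pushout.condition

/-- The part of the action of `L` constructed in the next stage. -/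
noncomputable def a : S.Y.X ⊗ L ⟶ S.nextY.X := freeUnit _ ≫ S.f.hom

/-- `Q` is the part of `Y ⊗ L` on which the action of `L` is already prescribed, by `r`. The new
module freely adds values on the rest, so `a` extends `r` up to `p`. -/
lemma q_a : S.q ≫ S.a = S.r ≫ S.p.hom := by
  rw [a, ← reassoc_of% freeUnit_naturality (B := B) S.q]
  refine (congrArg (freeUnit S.Q ≫ ·) (congrArg Hom.hom S.q_f)).trans ?_
  rw [comp_hom, ← Category.assoc, freeUnit_freeDesc]

lemma whiskerLeft_a : S.Y.X ◁ i ≫ S.a = S.Y.act ≫ S.p.hom := by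
  rw [← S.k_q, Category.assoc, q_a, ← Category.assoc, k_r]

/-- The next stage. -/
noncomputable def next : Stage i where
  Y := S.nextY
  -- On the new module the action of `L` is known on the old `Y ⊗ L`, through `a`, and on the new `Y
  -- ⊗ B`, through the module structure. The resulting `q` is the pushout product of `p` and `i`.
  Q := pushout (S.Y.X ◁ i) (S.p.hom ▷ B.X)
  k := pushout.inr _ _
  q := pushout.desc (S.p.hom ▷ L) (S.nextY.X ◁ i) (whisker_exchange _ _)
  r := pushout.desc S.a S.nextY.act (by rw [whiskerLeft_a, S.p.act_hom])
  k_q := pushout.inr_desc _ _ _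
  k_r := pushout.inr_desc _ _ _

lemma p_a : S.p.hom ▷ L ≫ S.next.a = S.a ≫ S.next.p.hom := by
  have h := pushout.inl _ _ ≫= S.next.q_a
  dsimp only [next] at h
  rwa [pushout.inl_desc_assoc, pushout.inl_desc_assoc] at h

section

variable {M : RightMod B} {l : M.X ⊗ L ⟶ M.X} (hl : M.X ◁ i ≫ l = M.act)

include hl in
-- The last conclusion is the hypothesis `hf` for the next stage, so the construction can be
-- iterated.
lemma exists_desc (f : S.Y ⟶ M) (hf : S.q ≫ f.hom ▷ L ≫ l = S.r ≫ f.hom) :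
    ∃ f' : S.nextY ⟶ M, S.p ≫ f' = f ∧ S.a ≫ f'.hom = f.hom ▷ L ≫ l ∧
      S.next.q ≫ f'.hom ▷ L ≫ l = S.next.r ≫ f'.hom := by
  let f' : S.nextY ⟶ M := pushout.desc (freeDesc (f.hom ▷ L ≫ l)) f (free_hom_ext (by
    rw [comp_hom, comp_hom, ← Category.assoc, ← Category.assoc, freeUnit_freeDesc,
      freeUnit_naturality, Category.assoc, freeUnit_freeDesc, hf]))
  have h₁ : S.p ≫ f' = f := pushout.inr_desc _ _ _
  have h₂ : S.a ≫ f'.hom = f.hom ▷ L ≫ l := by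
    have : S.f ≫ f' = freeDesc (f.hom ▷ L ≫ l) := pushout.inl_desc _ _ _
    rw [a, Category.assoc, ← comp_hom, this, freeUnit_freeDesc]
  refine ⟨f', h₁, h₂, ?_⟩
  apply pushout.hom_ext
  · dsimp only [next]
    rw [pushout.inl_desc_assoc, pushout.inl_desc_assoc, h₂, ← comp_whiskerRight_assoc,
      ← comp_hom, h₁]
  · dsimp only [next]
    rw [pushout.inr_desc_assoc, pushout.inr_desc_assoc, whisker_exchange_assoc, hl, f'.act_hom]

lemma hom_ext_next {f g : S.nextY ⟶ M} (h : S.p ≫ f = S.p ≫ g)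
    (h' : S.a ≫ f.hom = S.a ≫ g.hom) : f = g := by
  apply pushout.hom_ext
  · apply free_hom_ext
    rw [a, Category.assoc, Category.assoc] at h'
    exact h'
  · exact h

end

end Stage

variable (i : B.X ⟶ L) [HasPushouts V]
  [∀ X : V, PreservesColimitsOfShape WalkingSpan (tensorRight X)]

/-- The sequence of stages. -/
noncomputable def stage : ℕ → Stage i
  | 0 => Stage.start i
  | n + 1 => (stage n).next

/-- The module of a stage. -/
noncomputable def stageY (n : ℕ) : RightMod B := (stage i n).Y

/-- The morphisms between stages. -/
noncomputable def stageP (n : ℕ) : stageY i n ⟶ stageY i (n + 1) := (stage i n).p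

/-- The partial action of `L` on the stages. -/
noncomputable def stageA (n : ℕ) : (stageY i n).X ⊗ L ⟶ (stageY i (n + 1)).X := (stage i n).a

lemma stageP_stageA (n : ℕ) :
    (stageP i n).hom ▷ L ≫ stageA i (n + 1) = stageA i n ≫ (stageP i (n + 1)).hom :=
  (stage i n).p_a

lemma whiskerLeft_stageA (n : ℕ) :
    (stageY i n).X ◁ i ≫ stageA i n = (stageY i n).act ≫ (stageP i n).hom :=
  (stage i n).whiskerLeft_a

/-- The sequence of modules of the stages. -/
noncomputable abbrev stageFunctor : ℕ ⥤ RightMod B := Functor.ofSequence (stageP i)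

variable [HasColimitsOfShape ℕ V] [∀ X : V, PreservesColimitsOfShape ℕ (tensorRight X)]

/-- The free `B`-module on one generator with a compatible action of `L`. -/
noncomputable def stageColimit : RightMod B := colimit (stageFunctor i)

/-- The inclusions of the stages. -/
noncomputable def stageι (n : ℕ) : stageY i n ⟶ stageColimit i := colimit.ι (stageFunctor i) n

lemma stageP_ι (n : ℕ) : stageP i n ≫ stageι i (n + 1) = stageι i n := by
  have := colimit.w (stageFunctor i) (homOfLE (Nat.le_add_right n 1))
  rwa [Functor.ofSequence_map_homOfLE_succ] at this

lemma stageA_ι (n : ℕ) : (stageP i n).hom ▷ L ≫ stageA i (n + 1) ≫ (stageι i (n + 2)).hom =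
    stageA i n ≫ (stageι i (n + 1)).hom := by
  rw [← Category.assoc, stageP_stageA, Category.assoc, ← comp_hom, stageP_ι]

lemma stageColimit_tensor_hom_ext {X Z : V} {f g : (stageColimit i).X ⊗ X ⟶ Z}
    (h : ∀ n, (stageι i n).hom ▷ X ≫ f = (stageι i n).hom ▷ X ≫ g) : f = g :=
  (isColimitOfPreserves (underlying B ⋙ tensorRight X)
    (colimit.isColimit (stageFunctor i))).hom_ext h

/-- The action of `L` on `stageColimit i`. -/
noncomputable def stageAct : (stageColimit i).X ⊗ L ⟶ (stageColimit i).X :=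
  (isColimitOfPreserves (underlying B ⋙ tensorRight L) (colimit.isColimit (stageFunctor i))).desc
    { pt := (stageColimit i).X
      ι := NatTrans.ofSequence (fun n ↦ stageA i n ≫ (stageι i (n + 1)).hom) (fun n ↦ by
        dsimp
        rw [Functor.ofSequence_map_homOfLE_succ, Category.comp_id]
        exact stageA_ι i n) }

lemma ι_stageAct (n : ℕ) : (stageι i n).hom ▷ L ≫ stageAct i =
    stageA i n ≫ (stageι i (n + 1)).hom :=
  (isColimitOfPreserves (underlying B ⋙ tensorRight L)
    (colimit.isColimit (stageFunctor i))).fac _ n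

lemma whiskerLeft_stageAct : (stageColimit i).X ◁ i ≫ stageAct i = (stageColimit i).act := by
  apply stageColimit_tensor_hom_ext
  intro n
  rw [← whisker_exchange_assoc, ι_stageAct, reassoc_of% whiskerLeft_stageA i n, ← comp_hom,
    stageP_ι, Hom.act_hom]

section

variable {i} {M : RightMod B} {l : M.X ⊗ L ⟶ M.X} (hl : M.X ◁ i ≫ l = M.act)

include hl in
lemma exists_stageDesc (f₀ : self B ⟶ M) :
    ∃ f : stageColimit i ⟶ M, stageι i 0 ≫ f = f₀ ∧ stageAct i ≫ f.hom = f.hom ▷ L ≫ l := by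
  let D (n : ℕ) := { f : stageY i n ⟶ M //
    (stage i n).q ≫ f.hom ▷ L ≫ l = (stage i n).r ≫ f.hom }
  have h₀ : B.X ◁ i ≫ f₀.hom ▷ L ≫ l = MonObj.mul ≫ f₀.hom := by
    have := whisker_exchange_assoc f₀.hom i l
    dsimp at this
    rw [this, hl]
    exact f₀.act_hom.symm
  let d : ∀ n, D n := fun n ↦ Nat.rec (⟨f₀, h₀⟩ : D 0) (fun n f ↦
      ⟨((stage i n).exists_desc hl f.1 f.2).choose,
        ((stage i n).exists_desc hl f.1 f.2).choose_spec.2.2⟩) n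
  have hd (n : ℕ) : stageP i n ≫ (d (n + 1)).1 = (d n).1 :=
    ((stage i n).exists_desc hl (d n).1 (d n).2).choose_spec.1
  have hd' (n : ℕ) : stageA i n ≫ (d (n + 1)).1.hom = (d n).1.hom ▷ L ≫ l :=
    ((stage i n).exists_desc hl (d n).1 (d n).2).choose_spec.2.1
  let f : stageColimit i ⟶ M := colimit.desc (stageFunctor i)
    { pt := M
      ι := NatTrans.ofSequence (fun n ↦ (d n).1) (fun n ↦ by
        rw [Functor.ofSequence_map_homOfLE_succ]
        exact (hd n).trans (Category.comp_id _).symm) }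
  have hf (n : ℕ) : stageι i n ≫ f = (d n).1 := colimit.ι_desc _ _
  refine ⟨f, hf 0, ?_⟩
  apply stageColimit_tensor_hom_ext
  intro n
  rw [reassoc_of% ι_stageAct i n, ← comp_hom, hf, hd', ← comp_whiskerRight_assoc, ← comp_hom, hf]

lemma stageColimit_hom_ext {f g : stageColimit i ⟶ M} (h : stageι i 0 ≫ f = stageι i 0 ≫ g)
    (hf : stageAct i ≫ f.hom = f.hom ▷ L ≫ l) (hg : stageAct i ≫ g.hom = g.hom ▷ L ≫ l) :
    f = g := by
  refine colimit.hom_ext (F := stageFunctor i) fun n ↦ ?_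
  change stageι i n ≫ f = stageι i n ≫ g
  induction n with
  | zero => exact h
  | succ n hn =>
    have key (f : stageColimit i ⟶ M) (hf : stageAct i ≫ f.hom = f.hom ▷ L ≫ l) :
        stageA i n ≫ (stageι i (n + 1) ≫ f).hom = (stageι i n ≫ f).hom ▷ L ≫ l := by
      rw [comp_hom, ← reassoc_of% ι_stageAct i n, hf, comp_hom, comp_whiskerRight_assoc]
    have key' (f : stageColimit i ⟶ M) : stageP i n ≫ stageι i (n + 1) ≫ f = stageι i n ≫ f := by
      rw [← stageP_ι i n, Category.assoc]
    exact (stage i n).hom_ext_next ((key' f).trans (hn.trans (key' g).symm))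
      ((key f hf).trans ((congrArg (fun f : stageY i n ⟶ M ↦ f.hom ▷ L ≫ l) hn).trans
        (key g hg).symm))

end

/-- `P` satisfies the universal property of `stageColimit`: the free module maps to `P` because `L`
acts on `P`, and it is itself a `P`-module because actions of `L` extend to `P`. -/
lemma GeneratesActions.exists_iso {i : B.X ⟶ L} {P : Mon V} {j : B ⟶ P} {l : L ⟶ P.X}
    (h : GeneratesActions i l) (hl : i ≫ l = j.hom) :
    ∃ e : (stageColimit i).X ≅ P.X, (stageι i 0).hom ≫ e.hom = j.hom := by
  let M := (restrict j).obj (self P)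
  have hM : M.X ◁ i ≫ P.X ◁ l ≫ MonObj.mul = M.act := by
    change P.X ◁ i ≫ P.X ◁ l ≫ MonObj.mul = P.X ◁ j.hom ≫ MonObj.mul
    rw [← hl, MonoidalCategory.whiskerLeft_comp, Category.assoc]
  let f₀ : self B ⟶ M :=
    { hom := j.hom
      act_hom := by
        have := IsMonHom.mul_hom j.hom
        rw [MonoidalCategory.tensorHom_def, Category.assoc] at this
        exact this }
  obtain ⟨m, hm, hm'⟩ := exists_stageDesc hM f₀
  obtain ⟨act, hact, hact'⟩ := h.exists_action (stageColimit i) (stageAct i)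
    (whiskerLeft_stageAct i)
  let N : RightMod P := ⟨(stageColimit i).X, act, hact.act_one, hact.act_mul⟩
  have hN := h.linear N (self P) m.hom ((congrArg (· ≫ m.hom) hact').trans hm')
  refine exists_iso_of_isAction hl (stageι i 0).hom (stageι i 0).act_hom (stageAct i)
    (whiskerLeft_stageAct i) m.hom (congrArg Hom.hom hm) m.act_hom hm' act hact hact' hN
    fun g hg hg₀ hg' ↦ ?_
  let g' : stageColimit i ⟶ stageColimit i := ⟨g, hg⟩
  exact congrArg Hom.hom (stageColimit_hom_ext (f := g') (g := 𝟙 _)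
    ((hom_ext hg₀).trans (Category.comp_id _).symm) hg' (by simp))

end Chain

/-! ### Extensions of monoids by good morphisms -/

namespace Glue

open RightMod

variable {C : Type u₁} [Category.{v} C] [MonoidalCategory C] [SymmetricCategory C]
  [MonoidalClosed C] [ModelCategory C] [IsMonoidalModelCategory C]
  {D : Type u₂} [Category.{v} D] [MonoidalCategory D] [SymmetricCategory D]
  [MonoidalClosed D] [ModelCategory D] [IsMonoidalModelCategory D]
  {F : D ⥤ C} {R : C ⥤ D} [R.LaxMonoidal] {adj : F ⊣ R}

section

variable {B : Mon (Glue R)} {L : Glue R} {i : B.X ⟶ L} (hR : IsWeakMonoidalQuillenPair adj)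
  (hB : IsGood adj B.X) (hi : good adj i)

include hR hB

lemma good_stage_p (S : Stage i) (hQ : IsGood adj S.Q) (hq : good adj S.q) :
    good adj S.p.hom := by
  have h := (IsPushout.of_hasPushout ((free B).map S.q) (freeDesc S.r)).map (underlying B)
  exact MorphismProperty.of_isPushout h.flip (good_whiskerRight hR hQ hB S.q hq)

include hi

/-- The step `p` is a cobase change of `q ▷ B`, and the next `q` is the pushout product of `p` with
`i`; goodness passes along both. -/
lemma good_stage (n : ℕ) :
    IsGood adj (stage i n).Y.X ∧ IsGood adj (stage i n).Q ∧ good adj (stage i n).q := by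
  induction n with
  | zero => exact ⟨hB, hB.tensor hR hB, good_whiskerLeft hR hB hB i hi⟩
  | succ n hn =>
    obtain ⟨hY, hQ, hq⟩ := hn
    set S := stage i n
    have hp := good_stage_p hR hB S hQ hq
    have hY' := hY.of_good hR.isRightQuillen _ hp
    have h := IsPushout.of_hasPushout (S.Y.X ◁ i) (S.p.hom ▷ B.X)
    refine ⟨hY', (hY.tensor hR (hB.of_good hR.isRightQuillen i hi)).of_good hR.isRightQuillen _
      (MorphismProperty.of_isPushout h (good_whiskerRight hR hY hB _ hp)), ?_⟩
    exact good_pushoutProduct hR hY hB S.p.hom i hp hi h _ (pushout.inl_desc _ _ _)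
      (pushout.inr_desc _ _ _)

lemma good_stageι [HasColimitsOfShape ℕ C] [HasColimitsOfShape ℕ D] :
    good adj (stageι i 0).hom := by
  refine MorphismProperty.transfiniteCompositionsOfShape_le _ ℕ _ ⟨?_⟩
  exact
    { F := stageFunctor i ⋙ underlying B
      isoBot := Iso.refl _
      incl := ((underlying B).mapCocone (colimit.cocone (stageFunctor i))).ι
      isColimit := isColimitOfPreserves (underlying B) (colimit.isColimit (stageFunctor i))
      fac := Category.id_comp _
      map_mem := fun n _ ↦ by
        have := good_stage hR hB hi n
        have h : (stageFunctor i).map (homOfLE (Nat.le_add_right n 1)) = stageP i n :=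
          Functor.ofSequence_map_homOfLE_succ _ _
        exact (congrArg (fun f : stageY i n ⟶ stageY i (n + 1) ↦ good adj f.hom) h).mpr
          (good_stage_p hR hB _ this.2.1 this.2.2) }

/-- A monoid with a morphism from `L` which generates actions is a good extension. -/
lemma good_of_generatesActions [HasColimitsOfShape ℕ C] [HasColimitsOfShape ℕ D]
    {P : Mon (Glue R)} {j : B ⟶ P} {l : L ⟶ P.X} (h : GeneratesActions i l)
    (hl : i ≫ l = j.hom) : good adj j.hom := by
  obtain ⟨e, he⟩ := h.exists_iso hl
  rw [← he]
  exact MorphismProperty.comp_mem _ _ _ (good_stageι hR hB hi)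
    (MorphismProperty.llp_of_isIso _ _)

end

end Glue

/-! ### Free extensions of monoids -/

section FreeExtension

open RightMod

variable {V : Type u} [Category.{v} V] [MonoidalCategory V]

/-- The monoid `P` is freely generated by the monoid `B` and `L` subject to the identification of
the monoid `B` with its image under `i : B ⟶ L`. -/
structure IsFreeExtension {B P : Mon V} {L : V} (i : B.X ⟶ L) (j : B ⟶ P) (l : L ⟶ P.X) :
    Prop where
  fac : i ≫ l = j.hom
  exists_desc {N : Mon V} (b : B ⟶ N) (m : L ⟶ N.X) (h : i ≫ m = b.hom) :
    ∃ g : P ⟶ N, j ≫ g = b ∧ l ≫ g.hom = m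
  hom_ext {N : Mon V} {f g : P ⟶ N} (h : l ≫ f.hom = l ≫ g.hom) : f = g

/-- The monoid structure on a subobject of a monoid through which the structure morphisms
factor. -/
abbrev MonObj.ofMono {V : Type u} [Category.{v} V] [MonoidalCategory V] {P : Mon V} {Q : V}
    (ι : Q ⟶ P.X) [Mono ι] (one : 𝟙_ V ⟶ Q) (mul : Q ⊗ Q ⟶ Q)
    (h₁ : one ≫ ι = MonObj.one) (h₂ : mul ≫ ι = (ι ⊗ₘ ι) ≫ MonObj.mul) : MonObj Q where
  one := one
  mul := mul
  one_mul := by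
    rw [← cancel_mono ι, Category.assoc, h₂, MonoidalCategory.tensorHom_def, Category.assoc,
      ← comp_whiskerRight_assoc, h₁, ← whisker_exchange_assoc, MonObj.one_mul,
      leftUnitor_naturality]
  mul_one := by
    rw [← cancel_mono ι, Category.assoc, h₂, MonoidalCategory.tensorHom_def', Category.assoc,
      ← MonoidalCategory.whiskerLeft_comp_assoc, h₁, whisker_exchange_assoc, MonObj.mul_one,
      rightUnitor_naturality]
  mul_assoc := by
    have e₁ : mul ▷ Q ≫ (ι ⊗ₘ ι) = ((ι ⊗ₘ ι) ⊗ₘ ι) ≫ MonObj.mul ▷ P.X := by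
      rw [← tensorHom_id, tensorHom_comp_tensorHom, ← tensorHom_id, tensorHom_comp_tensorHom, h₂,
        Category.id_comp, Category.comp_id]
    have e₂ : Q ◁ mul ≫ (ι ⊗ₘ ι) = (ι ⊗ₘ (ι ⊗ₘ ι)) ≫ P.X ◁ MonObj.mul := by
      rw [← id_tensorHom, tensorHom_comp_tensorHom, ← id_tensorHom, tensorHom_comp_tensorHom, h₂,
        Category.id_comp, Category.comp_id]
    rw [← cancel_mono ι, Category.assoc, Category.assoc, Category.assoc, h₂, reassoc_of% e₁,
      reassoc_of% e₂, MonObj.mul_assoc, associator_naturality_assoc]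

section OfMono

variable {P : Mon V} {Q : V} (ι : Q ⟶ P.X) [Mono ι] (one : 𝟙_ V ⟶ Q) (mul : Q ⊗ Q ⟶ Q)
  (h₁ : one ≫ ι = MonObj.one) (h₂ : mul ≫ ι = (ι ⊗ₘ ι) ≫ MonObj.mul)

/-- The submonoid determined by a subobject through which the structure morphisms factor. -/
def Mon.ofMono : Mon V where
  X := Q
  mon := MonObj.ofMono ι one mul h₁ h₂

/-- The inclusion of a submonoid. -/
def Mon.ofMonoι : Mon.ofMono ι one mul h₁ h₂ ⟶ P where
  hom := ι
  isMonHom_hom := ⟨h₁, h₂⟩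

/-- A morphism of monoids to a submonoid. -/
def Mon.ofMonoLift {B : Mon V} (j : B ⟶ P) (z : B.X ⟶ Q) (hz : z ≫ ι = j.hom) :
    B ⟶ Mon.ofMono ι one mul h₁ h₂ where
  hom := z
  isMonHom_hom :=
    { one_hom := by
        change MonObj.one ≫ z = one
        rw [← cancel_mono ι, Category.assoc, hz, h₁, IsMonHom.one_hom]
      mul_hom := by
        change MonObj.mul ≫ z = (z ⊗ₘ z) ≫ mul
        rw [← cancel_mono ι, Category.assoc, hz, Category.assoc, h₂, IsMonHom.mul_hom,
          tensorHom_comp_tensorHom_assoc, hz] }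

end OfMono

/-! ### The subobject of a monoid on which a morphism is linear -/

section EqualizerMonoid

variable {P : Mon V} (M N : RightMod P) (f : M.X ⟶ N.X)

/-- The condition that `f` is linear with respect to the elements in the image of `z`. -/
def IsLinearOn {Z : V} (z : Z ⟶ P.X) : Prop :=
  (M.X ◁ z ≫ M.act) ≫ f = f ▷ Z ≫ N.X ◁ z ≫ N.act

variable {M N f}

lemma isLinearOn_comp {Z Z' : V} (z' : Z' ⟶ Z) {z : Z ⟶ P.X} (h : IsLinearOn M N f z) :
    IsLinearOn M N f (z' ≫ z) := by
  unfold IsLinearOn at h ⊢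
  rw [MonoidalCategory.whiskerLeft_comp, Category.assoc, Category.assoc, ← Category.assoc _ _ f, h,
    whisker_exchange_assoc, MonoidalCategory.whiskerLeft_comp, Category.assoc]

lemma isLinearOn_one : IsLinearOn M N f (MonObj.one : 𝟙_ V ⟶ P.X) := by
  rw [IsLinearOn, M.act_one, N.act_one, rightUnitor_naturality]

lemma isLinearOn_mul {Z Z' : V} {z : Z ⟶ P.X} {z' : Z' ⟶ P.X} (h : IsLinearOn M N f z)
    (h' : IsLinearOn M N f z') : IsLinearOn M N f ((z ⊗ₘ z') ≫ MonObj.mul) := by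
  have key (M : RightMod P) : M.X ◁ ((z ⊗ₘ z') ≫ MonObj.mul) ≫ M.act =
      (α_ _ _ _).inv ≫ (M.X ◁ z ≫ M.act) ▷ Z' ≫ M.X ◁ z' ≫ M.act := by
    rw [MonoidalCategory.whiskerLeft_comp, Category.assoc, M.act_mul,
      MonoidalCategory.tensorHom_def, MonoidalCategory.whiskerLeft_comp, Category.assoc,
      comp_whiskerRight_assoc, ← whisker_exchange_assoc]
    simp
  unfold IsLinearOn at h h' ⊢
  have h'' := congrArg (· ▷ Z') h
  simp only [Category.assoc, comp_whiskerRight] at h' h''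
  simp only [key, Category.assoc, comp_whiskerRight]
  rw [h', reassoc_of% h'', associator_inv_naturality_left_assoc]

variable [MonoidalClosed V]

/-- After currying, linearity on `z` says that `z` equalizes two morphisms from `P` to the internal
hom. Hence there is a universal such `z`. -/
lemma isLinearOn_iff {Z : V} (z : Z ⟶ P.X) : IsLinearOn M N f z ↔
    z ≫ MonoidalClosed.curry (M.act ≫ f) = z ≫ MonoidalClosed.curry (f ▷ P.X ≫ N.act) := by
  rw [← MonoidalClosed.curry_natural_left, ← MonoidalClosed.curry_natural_left,
    MonoidalClosed.curry_injective.eq_iff, IsLinearOn, whisker_exchange_assoc, Category.assoc]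

variable [HasEqualizers V]

variable (M N f) in
/-- The largest subobject of `P` on which `f` is linear. -/
noncomputable abbrev linearLocus : V :=
  equalizer (MonoidalClosed.curry (M.act ≫ f)) (MonoidalClosed.curry (f ▷ P.X ≫ N.act))

variable (M N f) in
/-- The inclusion of `linearLocus`. -/
noncomputable abbrev linearLocusι : linearLocus M N f ⟶ P.X := equalizer.ι _ _

lemma isLinearOn_linearLocusι : IsLinearOn M N f (linearLocusι M N f) :=
  (isLinearOn_iff _).2 (equalizer.condition _ _)

lemma exists_lift_linearLocus {Z : V} (z : Z ⟶ P.X) (h : IsLinearOn M N f z) :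
    ∃ z' : Z ⟶ linearLocus M N f, z' ≫ linearLocusι M N f = z :=
  ⟨equalizer.lift z ((isLinearOn_iff _).1 h), equalizer.lift_ι _ _⟩

end EqualizerMonoid

/-! ### Endomorphism monoids and actions -/

section End

variable [MonoidalClosed V]

open MonoidalClosed

/-- The monoid of endomorphisms of an object acting on the right. -/
noncomputable def endMon (M : V) : Mon V where
  X := (ihom M).obj M
  mon :=
    { one := MonoidalClosed.id M
      mul := MonoidalClosed.comp M M M
      one_mul := by
        have := MonoidalClosed.id_comp M M
        rwa [Iso.inv_comp_eq, Category.comp_id] at this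
      mul_one := by
        have := MonoidalClosed.comp_id M M
        rwa [Iso.inv_comp_eq, Category.comp_id] at this
      mul_assoc := by
        have := MonoidalClosed.assoc M M M M
        rwa [Iso.inv_comp_eq] at this }

/-- The action of the endomorphism monoid. -/
noncomputable def endEv (M : V) : M ⊗ (endMon M).X ⟶ M := (ihom.ev M).app M

/-- The morphism to the endomorphism monoid given by a morphism `M ⊗ Y ⟶ M`. -/
noncomputable def endCurry {M Y : V} (m : M ⊗ Y ⟶ M) : Y ⟶ (endMon M).X := curry m

lemma whiskerLeft_endCurry {M Y : V} (m : M ⊗ Y ⟶ M) : M ◁ endCurry m ≫ endEv M = m :=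
  (uncurry_eq _).symm.trans (uncurry_curry m)

lemma endMon_hom_ext {M Y : V} {f g : Y ⟶ (endMon M).X}
    (h : M ◁ f ≫ endEv M = M ◁ g ≫ endEv M) : f = g :=
  uncurry_injective (A := M) h

lemma isAction_endEv (M : V) : IsAction (endMon M) (endEv M) where
  act_one := whiskerLeft_endCurry (ρ_ M).hom
  act_mul := whiskerLeft_endCurry (compTranspose M M M)

/-- A morphism of monoids to the endomorphism monoid is an action. -/
lemma isAction_of_hom {P : Mon V} {M : V} (g : P ⟶ endMon M) :
    IsAction P (M ◁ g.hom ≫ endEv M) :=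
  let N : RightMod (endMon M) := ⟨M, _, (isAction_endEv M).act_one, (isAction_endEv M).act_mul⟩
  ⟨((restrict g).obj N).act_one, ((restrict g).obj N).act_mul⟩

/-- The morphism to the endomorphism monoid given by a module. -/
noncomputable def RightMod.toEndMon {P : Mon V} (M : RightMod P) : P ⟶ endMon M.X where
  hom := endCurry M.act
  isMonHom_hom :=
    { one_hom := endMon_hom_ext (by
        rw [MonoidalCategory.whiskerLeft_comp, Category.assoc, whiskerLeft_endCurry, M.act_one,
          (isAction_endEv M.X).act_one])
      mul_hom := endMon_hom_ext (by
        rw [MonoidalCategory.whiskerLeft_comp, Category.assoc, whiskerLeft_endCurry, M.act_mul,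
          MonoidalCategory.whiskerLeft_comp, Category.assoc, (isAction_endEv M.X).act_mul,
          MonoidalCategory.tensorHom_def, MonoidalCategory.whiskerLeft_comp, Category.assoc,
          associator_inv_naturality_right_assoc, whisker_exchange_assoc, whiskerLeft_endCurry,
          associator_inv_naturality_middle_assoc, ← comp_whiskerRight_assoc,
          whiskerLeft_endCurry]) }

end End

/-- In a closed monoidal category, free extensions of monoids generate actions. -/
lemma IsFreeExtension.generatesActions [MonoidalClosed V] [HasEqualizers V] {B P : Mon V} {L : V}
    {i : B.X ⟶ L} {j : B ⟶ P} {l : L ⟶ P.X} (h : IsFreeExtension i j l) :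
    GeneratesActions i l where
  exists_action M m hm := by
    -- Actions are morphisms of monoids to the endomorphism monoid, to which the universal property
    -- of `P` is applied.
    obtain ⟨g, -, hg⟩ := h.exists_desc M.toEndMon (endCurry m) (endMon_hom_ext (by
      rw [MonoidalCategory.whiskerLeft_comp, Category.assoc, whiskerLeft_endCurry, hm]
      exact (whiskerLeft_endCurry _).symm))
    refine ⟨_, isAction_of_hom g, ?_⟩
    rw [← MonoidalCategory.whiskerLeft_comp_assoc, hg, whiskerLeft_endCurry]
  linear M N f hf := by
    -- The locus where `f` is linear is a submonoid of `P` through which `l` factors. Since `P` is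
    -- generated by `L`, the identity of `P` factors through the locus too.
    have hf' : IsLinearOn M N f l := hf
    obtain ⟨one, h_one⟩ := exists_lift_linearLocus (M := M) (N := N) (f := f) _ isLinearOn_one
    obtain ⟨mul, h_mul⟩ := exists_lift_linearLocus (M := M) (N := N) (f := f) _
      (isLinearOn_mul isLinearOn_linearLocusι isLinearOn_linearLocusι)
    obtain ⟨l', hl'⟩ := exists_lift_linearLocus l hf'
    let ι := Mon.ofMonoι _ one mul h_one h_mul
    let b := Mon.ofMonoLift _ one mul h_one h_mul j (i ≫ l') (by rw [Category.assoc, hl', h.fac])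
    obtain ⟨g, -, hg⟩ := h.exists_desc b l' rfl
    have hgι : g ≫ ι = 𝟙 P := h.hom_ext (by
      have : l ≫ (g ≫ ι).hom = (l ≫ g.hom) ≫ linearLocusι M N f := (Category.assoc _ _ _).symm
      rw [this, hg]
      exact hl'.trans (Category.comp_id _).symm)
    have := isLinearOn_comp g.hom (isLinearOn_linearLocusι (M := M) (N := N) (f := f))
    have e : g.hom ≫ linearLocusι M N f = 𝟙 P.X := congrArg Mon.Hom.hom hgι
    rw [e, IsLinearOn] at this
    simpa using this

end FreeExtension

/-! ### Monoids in the category of morphisms `X ⟶ R Y` -/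

namespace Glue

open RightMod

variable {C : Type u₁} [Category.{v} C] [MonoidalCategory C]
  {D : Type u₂} [Category.{v} D] [MonoidalCategory D] {R : C ⥤ D} [R.LaxMonoidal]

/-- The monoid in `Glue R` given by a morphism of monoids `B ⟶ R B'`. -/
def mkMon {B : Mon D} {B' : Mon C} (h : B ⟶ R.mapMon.obj B') : Mon (Glue R) where
  X := ⟨B.X, B'.X, h.hom⟩
  mon :=
    { one := ⟨MonObj.one, MonObj.one, (IsMonHom.one_hom h.hom).symm⟩
      mul := ⟨MonObj.mul, MonObj.mul, by
        refine Eq.trans ?_ (IsMonHom.mul_hom h.hom).symm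
        exact Category.assoc _ _ _⟩
      one_mul := hom_ext (MonObj.one_mul _) (MonObj.one_mul _)
      mul_one := hom_ext (MonObj.mul_one _) (MonObj.mul_one _)
      mul_assoc := hom_ext (MonObj.mul_assoc _) (MonObj.mul_assoc _) }

section

variable {P : Mon D} {P' : Mon C} {k : P ⟶ R.mapMon.obj P'}

/-- The first component of a module. -/
def modLeft (M : RightMod (mkMon k)) : RightMod P where
  X := M.X.left
  act := M.act.left
  act_one := congrArg Hom.left M.act_one
  act_mul := congrArg Hom.left M.act_mul

/-- The second component of a module. -/
def modRight (M : RightMod (mkMon k)) : RightMod P' where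
  X := M.X.right
  act := M.act.right
  act_one := congrArg Hom.right M.act_one
  act_mul := congrArg Hom.right M.act_mul

variable {B : Mon D} {B' : Mon C} {h : B ⟶ R.mapMon.obj B'} {L : Glue R}
  (i : (mkMon h).X ⟶ L) (l : L ⟶ (mkMon k).X)

/-- Regard `R Y` as a `P`-module by restriction along `k`. Then `w` says that `f` is `L`-linear,
hence `P`-linear, which is exactly what makes `a` and `a'` a morphism of `Glue R`. -/
lemma tensor_linear {i₁ : B.X ⟶ L.left} {l₁ : L.left ⟶ P.X} {l₂ : L.right ⟶ P'.X}
    (wl : L.hom ≫ R.map l₂ = l₁ ≫ k.hom) (h₁ : GeneratesActions i₁ l₁) {X : D} {Y : C}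
    (f : X ⟶ R.obj Y) {a : X ⊗ P.X ⟶ X} {a' : Y ⊗ P'.X ⟶ Y} (ha : IsAction P a)
    (ha' : IsAction P' a') (w : ((f ⊗ₘ L.hom) ≫ Functor.LaxMonoidal.μ R _ _) ≫
      R.map (Y ◁ l₂ ≫ a') = (X ◁ l₁ ≫ a) ≫ f) :
    ((f ⊗ₘ k.hom) ≫ Functor.LaxMonoidal.μ R Y P'.X) ≫ R.map a' = a ≫ f := by
  let M : RightMod P := ⟨X, a, ha.act_one, ha.act_mul⟩
  let M' : RightMod P' := ⟨Y, a', ha'.act_one, ha'.act_mul⟩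
  let κ : P.X ⟶ R.obj P'.X := k.hom
  have e := h₁.linear M ((restrict k).obj ((RightMod.map R P').obj M')) f (by
    refine w.symm.trans ?_
    change _ = f ▷ L.left ≫ R.obj Y ◁ l₁ ≫ R.obj Y ◁ κ ≫
      Functor.LaxMonoidal.μ R Y P'.X ≫ R.map a'
    replace wl : L.hom ≫ R.map l₂ = l₁ ≫ κ := wl
    rw [← MonoidalCategory.whiskerLeft_comp_assoc, ← wl, R.map_comp, Category.assoc,
      ← Functor.LaxMonoidal.μ_natural_right_assoc, MonoidalCategory.whiskerLeft_comp_assoc,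
      MonoidalCategory.tensorHom_def_assoc])
  refine Eq.trans ?_ e.symm
  change ((f ⊗ₘ κ) ≫ Functor.LaxMonoidal.μ R Y P'.X) ≫ R.map a' =
    f ▷ P.X ≫ R.obj Y ◁ κ ≫ Functor.LaxMonoidal.μ R Y P'.X ≫ R.map a'
  rw [Category.assoc, MonoidalCategory.tensorHom_def_assoc]

/-- Being a condition on actions rather than a universal property among monoids, it can be checked
on components; no closed structure on `Glue R` is involved. -/
lemma generatesActions (h₁ : GeneratesActions (B := B) (P := P) i.left l.left)
    (h₂ : GeneratesActions (B := B') (P := P') i.right l.right) : GeneratesActions i l where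
  exists_action M m hm := by
    obtain ⟨a, ha, ha'⟩ := h₁.exists_action (modLeft M) m.left (congrArg Hom.left hm)
    obtain ⟨b, hb, hb'⟩ := h₂.exists_action (modRight M) m.right (congrArg Hom.right hm)
    refine ⟨⟨a, b, tensor_linear l.w h₁ M.X.hom ha hb ?_⟩, ⟨?_, ?_⟩, ?_⟩
    · refine (congrArg (fun z ↦ _ ≫ R.map z) hb').trans (m.w.trans ?_)
      exact (congrArg (· ≫ M.X.hom) ha').symm
    · exact hom_ext ha.act_one hb.act_one
    · exact hom_ext ha.act_mul hb.act_mul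
    · exact hom_ext ha' hb'
  linear M N f hf := hom_ext
    (h₁.linear (modLeft M) (modLeft N) f.left (congrArg Hom.left hf))
    (h₂.linear (modRight M) (modRight N) f.right (congrArg Hom.right hf))

end

end Glue

/-! ### Pushouts of free monoids -/

/-- The functor `Mon.forget V`, as a reducible definition. -/
abbrev Mon.underlying (V : Type u) [Category.{v} V] [MonoidalCategory V] : Mon V ⥤ V where
  obj B := B.X
  map f := f.hom

section PushoutMonoid

variable {V : Type u} [Category.{v} V] [MonoidalCategory V] {T : V ⥤ Mon V}
  (adj : T ⊣ Mon.underlying V)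

/-- A pushout of a morphism between free monoids is a free extension. -/
lemma isFreeExtension_of_isPushout {K L₀ : V} {f : K ⟶ L₀} {B P : Mon V} {g : T.obj K ⟶ B}
    {t : T.obj L₀ ⟶ P} {j : B ⟶ P} (h : IsPushout (T.map f) g t j) {L : V} {a : L₀ ⟶ L}
    {i : B.X ⟶ L} (h' : IsPushout f (adj.homEquiv _ _ g) a i) {l : L ⟶ P.X}
    (hl : i ≫ l = j.hom) (hl' : a ≫ l = adj.homEquiv _ _ t) : IsFreeExtension i j l where
  fac := hl
  exists_desc {N} b m hm := by
    have w : T.map f ≫ (adj.homEquiv L₀ N).symm (a ≫ m) = g ≫ b := by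
      apply (adj.homEquiv _ _).injective
      rw [adj.homEquiv_naturality_left, Equiv.apply_symm_apply, adj.homEquiv_naturality_right,
        ← Category.assoc, h'.w, Category.assoc, hm]
    refine ⟨h.desc _ b w, h.inr_desc _ _ _, ?_⟩
    apply h'.hom_ext
    · rw [← Category.assoc, hl']
      refine (adj.homEquiv_naturality_right t (h.desc _ b w)).symm.trans ?_
      rw [h.inl_desc, Equiv.apply_symm_apply]
    · rw [← Category.assoc, hl, hm]
      exact congrArg Mon.Hom.hom (h.inr_desc _ _ w)
  hom_ext {N f g} hfg := by
    apply h.hom_ext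
    · apply (adj.homEquiv _ _).injective
      rw [adj.homEquiv_naturality_right, adj.homEquiv_naturality_right, ← hl', Category.assoc,
        Category.assoc, hfg]
    · apply Mon.Hom.ext'
      refine (congrArg (· ≫ f.hom) hl).symm.trans (Eq.trans ?_ (congrArg (· ≫ g.hom) hl))
      rw [Category.assoc, Category.assoc, hfg]

end PushoutMonoid

/-! ### The comparison of `F` with the left adjoint on monoids -/

section Transfer

variable {C : Type u₁} [Category.{v} C] [MonoidalCategory C]
  {D : Type u₂} [Category.{v} D] [MonoidalCategory D] {F : D ⥤ C} {R : C ⥤ D} [R.LaxMonoidal]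
  (adj : F ⊣ R) {Lmon : Mon D ⥤ Mon C} (adjMon : Lmon ⊣ R.mapMon)

/-- The morphism `B ⟶ R (Lmon B)` of underlying objects. -/
def monUnit (B : Mon D) : B.X ⟶ R.obj (Lmon.obj B).X := (adjMon.unit.app B).hom

/-- The morphism `F B ⟶ Lmon B` of underlying objects. -/
def monComparison (B : Mon D) : F.obj B.X ⟶ (Lmon.obj B).X :=
  (adj.homEquiv _ _).symm (monUnit adjMon B)

lemma monUnit_naturality {B P : Mon D} (j : B ⟶ P) :
    monUnit adjMon B ≫ R.map (Lmon.map j).hom = j.hom ≫ monUnit adjMon P :=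
  (congrArg Mon.Hom.hom (adjMon.unit.naturality j)).symm

lemma monComparison_naturality {B P : Mon D} (j : B ⟶ P) :
    monComparison adj adjMon B ≫ (Lmon.map j).hom = F.map j.hom ≫ monComparison adj adjMon P := by
  rw [monComparison, monComparison, ← adj.homEquiv_naturality_right_symm,
    ← adj.homEquiv_naturality_left_symm, monUnit_naturality]

lemma homEquiv_hom {B : Mon D} {N : Mon C} (b : Lmon.obj B ⟶ N) :
    (adjMon.homEquiv _ _ b).hom = monUnit adjMon B ≫ R.map b.hom := by
  rw [adjMon.homEquiv_unit]
  rfl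

lemma homEquiv_monComparison {P : Mon D} {N : Mon C} {L : D} (l : L ⟶ P.X)
    (f : Lmon.obj P ⟶ N) : adj.homEquiv _ _ ((F.map l ≫ monComparison adj adjMon P) ≫ f.hom) =
      l ≫ (adjMon.homEquiv _ _ f).hom := by
  rw [Category.assoc, adj.homEquiv_naturality_left, adj.homEquiv_naturality_right, monComparison,
    Equiv.apply_symm_apply, homEquiv_hom]
  rfl

/-- The left adjoint `Lmon` preserves free extensions. -/
lemma IsFreeExtension.map {B P : Mon D} {L : D} {i : B.X ⟶ L} {j : B ⟶ P} {l : L ⟶ P.X}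
    (h : IsFreeExtension i j l) {L' : C} {a : F.obj L ⟶ L'} {i' : (Lmon.obj B).X ⟶ L'}
    (h' : IsPushout (F.map i) (monComparison adj adjMon B) a i') {l' : L' ⟶ (Lmon.obj P).X}
    (hl : i' ≫ l' = (Lmon.map j).hom) (hl' : a ≫ l' = F.map l ≫ monComparison adj adjMon P) :
    IsFreeExtension i' (Lmon.map j) l' where
  fac := hl
  exists_desc {N} b m hm := by
    have w : i ≫ adj.homEquiv _ _ (a ≫ m) = (adjMon.homEquiv _ _ b).hom := by
      rw [← adj.homEquiv_naturality_left, reassoc_of% h'.w, hm, homEquiv_hom,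
        adj.homEquiv_naturality_right, monComparison, Equiv.apply_symm_apply]
    obtain ⟨g, hg, hg'⟩ := h.exists_desc (N := R.mapMon.obj N) _ _ w
    have e : Lmon.map j ≫ (adjMon.homEquiv _ _).symm g = b := by
      rw [← adjMon.homEquiv_naturality_left_symm, hg, Equiv.symm_apply_apply]
    refine ⟨(adjMon.homEquiv _ _).symm g, e, ?_⟩
    apply h'.hom_ext
    · apply (adj.homEquiv _ _).injective
      rw [← Category.assoc, hl', homEquiv_monComparison, Equiv.apply_symm_apply]
      exact hg'
    · rw [← Category.assoc, hl, hm]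
      exact congrArg Mon.Hom.hom e
  hom_ext {N f g} hfg := by
    apply (adjMon.homEquiv _ _).injective
    apply h.hom_ext
    rw [← homEquiv_monComparison adj, ← homEquiv_monComparison adj, ← hl', Category.assoc,
      Category.assoc, hfg]

end Transfer

/-! ### Attaching a cell to a monoid -/

namespace Glue

variable {C : Type u₁} [Category.{v} C] [MonoidalCategory C] [SymmetricCategory C]
  [MonoidalClosed C] [ModelCategory C] [IsMonoidalModelCategory C]
  {D : Type u₂} [Category.{v} D] [MonoidalCategory D] [SymmetricCategory D]
  [MonoidalClosed D] [ModelCategory D] [IsMonoidalModelCategory D]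
  {F : D ⥤ C} {R : C ⥤ D} [R.LaxMonoidal] {adj : F ⊣ R}
  {Lmon : Mon D ⥤ Mon C} (adjMon : Lmon ⊣ R.mapMon)

/-- The functor sending `B` to `B ⟶ R (Lmon B)`. -/
abbrev ofMon : Mon D ⥤ Glue R where
  obj B := ⟨B.X, (Lmon.obj B).X, monUnit adjMon B⟩
  map j := ⟨j.hom, (Lmon.map j).hom, monUnit_naturality adjMon j⟩
  map_id B := hom_ext rfl (by simp)
  map_comp f g := hom_ext rfl (by simp)

variable [HasColimitsOfShape ℕ C] [HasColimitsOfShape ℕ D]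

/-- In both components the new monoid is a free extension of the old one, so the morphism is a free
extension of the good monoid `B ⟶ R (Lmon B)` along the good morphism `ι` to `L`. -/
lemma good_ofMon_map_of_isPushout (hR : IsWeakMonoidalQuillenPair adj) {T : D ⥤ Mon D}
    (adjT : T ⊣ Mon.underlying D) {K L₀ : D} (f : K ⟶ L₀) [Cofibration f] {B P : Mon D}
    (g : T.obj K ⟶ B) (t : T.obj L₀ ⟶ P) (j : B ⟶ P) (h : IsPushout (T.map f) g t j)
    (hB : IsGood adj ((ofMon adjMon).obj B)) : good adj ((ofMon adjMon).map j) := by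
  obtain ⟨_, _, hχ⟩ := hB
  let χ := monComparison adj adjMon B
  have : WeakEquivalence χ := hχ
  have w : f ≫ adjT.homEquiv _ _ t = adjT.homEquiv _ _ g ≫ j.hom := by
    rw [← adjT.homEquiv_naturality_left, h.w, adjT.homEquiv_naturality_right]
  let i : B.X ⟶ pushout f (adjT.homEquiv _ _ g) := pushout.inr _ _
  let l : pushout f (adjT.homEquiv _ _ g) ⟶ P.X := pushout.desc (adjT.homEquiv _ _ t) j.hom w
  have hl : i ≫ l = j.hom := pushout.inr_desc _ _ _
  have hext : IsFreeExtension i j l := isFreeExtension_of_isPushout adjT h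
    (IsPushout.of_hasPushout _ _) hl (pushout.inl_desc _ _ _)
  have : Cofibration (F.map i) := hR.isRightQuillen.cofibration_map adj i
  have : IsCofibrant (F.obj B.X) := hR.isRightQuillen.isCofibrant_obj adj B.X
  let l' : pushout (F.map i) χ ⟶ (Lmon.obj P).X :=
    pushout.desc (F.map l ≫ monComparison adj adjMon P) (Lmon.map j).hom (by
      rw [monComparison_naturality, ← hl, F.map_comp, Category.assoc])
  -- The second component is `F` of the first, pushed out along `χ : F B ⟶ Lmon B`. The adjunct of
  -- its structure morphism is a cobase change of the weak equivalence `χ` along a cofibration, so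
  -- it is a weak equivalence.
  let L : Glue R := ⟨_, pushout (F.map i) χ, adj.homEquiv _ _ (pushout.inl _ _)⟩
  let ι : (ofMon adjMon).obj B ⟶ L := ⟨i, pushout.inr _ _, by
    change monUnit adjMon B ≫ R.map _ = i ≫ adj.homEquiv _ _ (pushout.inl (F.map i) χ)
    rw [← adj.homEquiv_naturality_left, pushout.condition, adj.homEquiv_naturality_right]
    exact congrArg (· ≫ _) ((adj.homEquiv _ _).apply_symm_apply _).symm⟩
  let lL : L ⟶ (ofMon adjMon).obj P := ⟨l, l', by
    change adj.homEquiv _ _ (pushout.inl (F.map i) χ) ≫ R.map l' = l ≫ monUnit adjMon P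
    rw [← adj.homEquiv_naturality_right]
    refine (congrArg (adj.homEquiv _ _) (pushout.inl_desc _ _ _)).trans ?_
    rw [adj.homEquiv_naturality_left, monComparison, Equiv.apply_symm_apply]⟩
  have hext' : IsFreeExtension ι.right (Lmon.map j) lL.right :=
    IsFreeExtension.map adj adjMon hext (IsPushout.of_hasPushout _ _) (pushout.inr_desc _ _ _)
      (pushout.inl_desc _ _ _)
  have hι : good adj ι := by
    have : Cofibration ι.left := inferInstanceAs (Cofibration (pushout.inr _ _))
    have : Cofibration ι.right := inferInstanceAs (Cofibration (pushout.inr _ _))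
    refine good_of_cofibration hR.isRightQuillen ι ⟨‹_›, ‹_›, hχ⟩ ?_
    simp only [L, Equiv.symm_apply_apply]
    exact weakEquivalence_pushout_inl (F.map i) χ
  let j' : mkMon (adjMon.unit.app B) ⟶ mkMon (adjMon.unit.app P) :=
    { hom := (ofMon adjMon).map j
      isMonHom_hom :=
        ⟨hom_ext (IsMonHom.one_hom j.hom) (IsMonHom.one_hom (Lmon.map j).hom),
          hom_ext (IsMonHom.mul_hom j.hom) (IsMonHom.mul_hom (Lmon.map j).hom)⟩ }
  exact good_of_generatesActions (j := j') hR ⟨‹_›, ‹_›, hχ⟩ hι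
    (generatesActions (h := adjMon.unit.app B) (k := adjMon.unit.app P) ι lL
      hext.generatesActions hext'.generatesActions) (hom_ext hl hext'.fac)

end Glue

/-! ### Cell induction -/

section CellInduction

variable {T : Type u} [Category.{v} T] {E : Type u'} [Category.{v} E] (Ψ : T ⥤ E)
  {P : MorphismProperty E} [MorphismProperty.IsStableUnderTransfiniteComposition.{v} P]
  [P.RespectsIso]

/-- Induction along transfinite compositions: a property `Q` of objects which is transferred along
the morphisms which `Ψ` sends to `P` holds for all transfinite compositions of morphisms which
`Ψ` sends to `P` if their source satisfies `Q`. -/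
lemma transfiniteCompositions_induction [PreservesFilteredColimitsOfSize.{v, v} Ψ]
    {W : MorphismProperty T} (Q : T → Prop)
    (hQ : ∀ ⦃X Y : T⦄ (f : X ⟶ Y), Q X → P (Ψ.map f) → Q Y)
    (hW : ∀ ⦃X Y : T⦄ (f : X ⟶ Y), Q X → W f → P (Ψ.map f))
    {X Y : T} (f : X ⟶ Y) (hf : MorphismProperty.transfiniteCompositions.{v} W f) (hX : Q X) :
    Q Y := by
  rw [MorphismProperty.transfiniteCompositions_iff] at hf
  obtain ⟨J, _, _, _, _, ⟨h⟩⟩ := hf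
  -- Below a limit element the index set is nonempty, hence filtered, so `Ψ` preserves the colimits
  -- at limit stages.
  have cont (J : Type v) [LinearOrder J] : PreservesWellOrderContinuousOfShape J Ψ :=
    ⟨fun j hj ↦ by
      have : Nonempty (Set.Iio j) := by
        obtain ⟨i, hi⟩ := not_isMin_iff.1 hj.not_isMin
        exact ⟨i, hi⟩
      infer_instance⟩
  have key {J : Type v} [LinearOrder J] [SuccOrder J] [OrderBot J] [WellFoundedLT J] {X Y : T}
      {f : X ⟶ Y} (hX : Q X) (h : CategoryTheory.TransfiniteCompositionOfShape J f)
      (h' : ∀ j, ¬ IsMax j → P (Ψ.map (h.F.map (homOfLE (Order.le_succ j))))) : Q Y := by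
    have := cont J
    exact hQ f hX (MorphismProperty.transfiniteCompositionsOfShape_le P J _
      ((⟨h, h'⟩ : (P.inverseImage Ψ).TransfiniteCompositionOfShape J f).map.mem))
  -- The map out of a stage is known to go to `P` only once `Q` holds at that stage. So `Q` is first
  -- proved at every `j`, by well-founded induction on the composition truncated at `j`.
  have hj (j : J) : Q (h.F.obj j) := by
    induction j using WellFoundedLT.induction with
    | ind j ih =>
      refine key (hQ h.isoBot.inv hX (P.of_isIso _)) (h.iic j).toTransfiniteCompositionOfShape
        fun i hi ↦ hW _ (ih i.1 ?_) ((h.iic j).map_mem i hi)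
      obtain ⟨k, hk⟩ := not_isMax_iff.1 hi
      exact lt_of_lt_of_le hk k.2
  exact key hX h.toTransfiniteCompositionOfShape fun j hj' ↦ hW _ (hj j) (h.map_mem j hj')

end CellInduction

section

variable {C : Type u₁} [Category.{v} C] [ModelCategory C]
  {D : Type u₂} [Category.{v} D] [ModelCategory D]
  {F : D ⥤ C} {R : C ⥤ D} {adj : F ⊣ R} {T : Type u} [Category.{v} T]

namespace Glue

/-- A functor to `Glue R` which preserves filtered colimits sends cofibrant objects to good
objects if it is well behaved on the initial object and on cell attachments. -/
lemma isGood_of_cofibrant (hR : IsRightQuillen R) {U : T ⥤ D} (m : CreatedModelStructure U)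
    (Ψ : T ⥤ Glue R) [PreservesFilteredColimitsOfSize.{v, v} Ψ]
    (h₀ : ∀ Z : T, IsInitial Z → IsGood adj (Ψ.obj Z))
    (h₁ : ∀ ⦃K L : D⦄ (f : K ⟶ L) [Cofibration f] ⦃X Y : T⦄ (g : m.left.obj K ⟶ X)
      (t : m.left.obj L ⟶ Y) (j : X ⟶ Y), IsPushout (m.left.map f) g t j → IsGood adj (Ψ.obj X) →
      good adj (Ψ.map j))
    (X : T) (hX : m.Cofibrant X) : IsGood adj (Ψ.obj X) := by
  obtain ⟨Y, ⟨Z, hZ, f, hf⟩, ⟨r⟩⟩ := m.retract_cell X hX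
  refine IsGood.of_retract hR (r.map Ψ) ?_
  refine transfiniteCompositions_induction Ψ (P := good adj) (fun X ↦ IsGood adj (Ψ.obj X))
    (fun _ _ f hX hf ↦ hX.of_good hR _ hf) ?_ f hf (h₀ Z hZ)
  rintro X Y f hX ⟨_, _, _, _, _, ⟨hg⟩, h⟩
  have : Cofibration _ := (cofibration_iff _).2 hg
  exact h₁ _ _ _ _ h.flip hX

end Glue

end

/-! ### Filtered colimits of monoids -/

namespace Mon

variable {V : Type u} [Category.{v} V] [MonoidalCategory V]

section

variable {B : Mon V} {Y : V} {f : B.X ⟶ Y} {m : Y ⊗ Y ⟶ Y} (h : (f ⊗ₘ f) ≫ m = MonObj.mul ≫ f)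

include h

lemma one_mul_of_hom : 𝟙_ V ◁ f ≫ (MonObj.one ≫ f) ▷ Y ≫ m = 𝟙_ V ◁ f ≫ (λ_ Y).hom := by
  rw [whisker_exchange_assoc, comp_whiskerRight_assoc, ← MonoidalCategory.tensorHom_def_assoc, h,
    MonObj.one_mul_assoc, leftUnitor_naturality]

lemma mul_one_of_hom : f ▷ 𝟙_ V ≫ Y ◁ (MonObj.one ≫ f) ≫ m = f ▷ 𝟙_ V ≫ (ρ_ Y).hom := by
  rw [← whisker_exchange_assoc, MonoidalCategory.whiskerLeft_comp_assoc,
    ← MonoidalCategory.tensorHom_def'_assoc, h, MonObj.mul_one_assoc, rightUnitor_naturality]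

lemma mul_assoc_of_hom : ((f ⊗ₘ f) ⊗ₘ f) ≫ m ▷ Y ≫ m =
    ((f ⊗ₘ f) ⊗ₘ f) ≫ (α_ Y Y Y).hom ≫ Y ◁ m ≫ m := by
  rw [associator_naturality_assoc, ← tensorHom_id, ← id_tensorHom,
    MonoidalCategory.tensorHom_comp_tensorHom_assoc,
    MonoidalCategory.tensorHom_comp_tensorHom_assoc, h, Category.comp_id,
    ← Category.id_comp f, ← MonoidalCategory.tensorHom_comp_tensorHom_assoc,
    ← MonoidalCategory.tensorHom_comp_tensorHom_assoc]
  simp [h]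

lemma mul_of_hom {N : Mon V} {g : B.X ⟶ N.X} {k : Y ⟶ N.X}
    (hg : MonObj.mul ≫ g = (g ⊗ₘ g) ≫ MonObj.mul) (hk : f ≫ k = g) :
    (f ⊗ₘ f) ≫ m ≫ k = (f ⊗ₘ f) ≫ (k ⊗ₘ k) ≫ MonObj.mul := by
  rw [reassoc_of% h, hk, hg, MonoidalCategory.tensorHom_comp_tensorHom_assoc, hk]

end

variable {J : Type v} [SmallCategory J]
  [IsFiltered J] [∀ X : V, PreservesColimitsOfShape J (tensorRight X)]
  [∀ X : V, PreservesColimitsOfShape J (tensorLeft X)] {K : J ⥤ Mon V}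

section

variable {c : Cocone (K ⋙ underlying V)} (hc : IsColimit c)

attribute [local instance] IsFiltered.isSifted

include hc

/-- Filtered categories are sifted, so the tensor product of two colimits over `J` is the colimit of
the diagonal tensor products. -/
lemma tensor_hom_ext {Z : V} {f g : c.pt ⊗ c.pt ⟶ Z}
    (h : ∀ j, (c.ι.app j ⊗ₘ c.ι.app j) ≫ f = (c.ι.app j ⊗ₘ c.ι.app j) ≫ g) : f = g :=
  (hc.tensor hc).hom_ext h

lemma tensor_tensor_hom_ext {Z : V} {f g : (c.pt ⊗ c.pt) ⊗ c.pt ⟶ Z}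
    (h : ∀ j, ((c.ι.app j ⊗ₘ c.ι.app j) ⊗ₘ c.ι.app j) ≫ f =
      ((c.ι.app j ⊗ₘ c.ι.app j) ⊗ₘ c.ι.app j) ≫ g) : f = g :=
  ((hc.tensor hc).tensor hc).hom_ext h

/-- The multiplication of a filtered colimit of monoids. -/
noncomputable def colimitMul : c.pt ⊗ c.pt ⟶ c.pt :=
  (hc.tensor hc).desc
    { pt := c.pt
      ι :=
        { app := fun j ↦ (MonObj.mul : (K.obj j).X ⊗ (K.obj j).X ⟶ _) ≫ c.ι.app j
          naturality := fun j j' f ↦ by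
            have h := c.w f
            have h' := IsMonHom.mul_hom (K.map f).hom
            dsimp at h h' ⊢
            rw [← reassoc_of% h', h, Category.comp_id] } }

lemma ι_colimitMul (j : J) : (c.ι.app j ⊗ₘ c.ι.app j) ≫ colimitMul hc =
    (MonObj.mul : (K.obj j).X ⊗ (K.obj j).X ⟶ _) ≫ c.ι.app j :=
  (hc.tensor hc).fac _ j

omit hc

omit [∀ X : V, PreservesColimitsOfShape J (tensorRight X)]
  [∀ X : V, PreservesColimitsOfShape J (tensorLeft X)] in
-- Two indices map to a common one, so the unit of the colimit may be computed at any index.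
lemma one_ι (c : Cocone (K ⋙ underlying V)) (i j : J) :
    (MonObj.one : _ ⟶ (K.obj i).X) ≫ c.ι.app i = (MonObj.one : _ ⟶ (K.obj j).X) ≫ c.ι.app j := by
  obtain ⟨k, f, g, -⟩ := IsFilteredOrEmpty.cocone_objs i j
  have hf := c.w f
  have hg := c.w g
  dsimp at hf hg
  rw [← hf, ← hg, ← Category.assoc, ← Category.assoc]
  exact congrArg (· ≫ c.ι.app k) ((IsMonHom.one_hom (K.map f).hom).trans
    (IsMonHom.one_hom (K.map g).hom).symm)

/-- The monoid structure on a filtered colimit of monoids. -/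
noncomputable def colimitMon : Mon V where
  X := c.pt
  mon :=
    { one := (MonObj.one : _ ⟶ (K.obj IsFiltered.nonempty.some).X) ≫ c.ι.app _
      mul := colimitMul hc
      one_mul := (isColimitOfPreserves (tensorLeft (𝟙_ V)) hc).hom_ext fun j ↦ by
        rw [one_ι c _ j]
        exact one_mul_of_hom (ι_colimitMul hc j)
      mul_one := (isColimitOfPreserves (tensorRight (𝟙_ V)) hc).hom_ext fun j ↦ by
        rw [one_ι c _ j]
        exact mul_one_of_hom (ι_colimitMul hc j)
      mul_assoc := tensor_tensor_hom_ext hc fun j ↦ mul_assoc_of_hom (ι_colimitMul hc j) }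

/-- The cocone of monoids constructed from a colimit cocone of the underlying objects. -/
noncomputable abbrev liftedCocone : Cocone K where
  pt := colimitMon hc
  ι :=
    { app := fun j ↦
        { hom := c.ι.app j
          isMonHom_hom := ⟨one_ι c _ _, (ι_colimitMul hc j).symm⟩ }
      naturality := fun _ _ f ↦ Mon.Hom.ext' (c.ι.naturality f) }

/-- The cocone `liftedCocone` is a colimit cocone. -/
noncomputable def isColimitLiftedCocone : IsColimit (liftedCocone hc) where
  desc s :=
    { hom := hc.desc ((underlying V).mapCocone s)
      isMonHom_hom := by
        have h j := hc.fac ((underlying V).mapCocone s) j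
        refine ⟨?_, tensor_hom_ext hc fun j ↦ ?_⟩
        · refine (Category.assoc _ _ _).trans ((congrArg (_ ≫ ·) (h _)).trans ?_)
          exact IsMonHom.one_hom (s.ι.app _).hom
        · have h' := IsMonHom.mul_hom (s.ι.app j).hom
          exact mul_of_hom (ι_colimitMul hc j) h' (h j) }
  fac s j := Mon.Hom.ext' (hc.fac ((underlying V).mapCocone s) j)
  uniq s m hm := Mon.Hom.ext'
    (hc.uniq ((underlying V).mapCocone s) _ fun j ↦ congrArg Mon.Hom.hom (hm j))

end

instance [HasColimitsOfShape J V] : PreservesColimitsOfShape J (underlying V) := ⟨fun {K} ↦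
  preservesColimit_of_preserves_colimit_cocone
    (isColimitLiftedCocone (colimit.isColimit (K ⋙ underlying V)))
    (colimit.isColimit (K ⋙ underlying V))⟩

end Mon

/-! ### Right Quillen functors up to isomorphism -/

section

variable {C : Type*} [Category.{v} C] [ModelCategory C] {D : Type*} [Category.{v} D]
  [ModelCategory D]

lemma IsRightQuillen.of_iso {G G' : C ⥤ D} (h : IsRightQuillen G) (e : G ≅ G') :
    IsRightQuillen G' := by
  have he {X Y : C} (f : X ⟶ Y) : Arrow.mk (G'.map f) ≅ Arrow.mk (G.map f) :=
    Arrow.isoMk (e.symm.app X) (e.symm.app Y) (e.inv.naturality f).symm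
  refine ⟨fun p hp ↦ ?_, fun p hp hp' ↦ ?_⟩
  · have := h.fibration p hp
    rw [fibration_iff] at *
    exact ((fibrations D).arrow_mk_iso_iff (he p)).2 this
  · have := h.trivialFibration p hp hp'
    rw [fibration_iff, weakEquivalence_iff] at *
    exact ⟨((fibrations D).arrow_mk_iso_iff (he p)).2 this.1,
      ((weakEquivalences D).arrow_mk_iso_iff (he p)).2 this.2⟩

end

/-! ### Quillen equivalences between created model structures -/

section Lift

variable {C : Type u₁} [Category.{v} C] [ModelCategory C]
  {D : Type u₂} [Category.{v} D] [ModelCategory D] {F : D ⥤ C} {R : C ⥤ D} {adj : F ⊣ R}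
  {T : Type u} [Category.{v} T] {T' : Type u'} [Category.{v} T']
  {U : T ⥤ D} {U' : T' ⥤ C} {E : T ⥤ T'} {G : T' ⥤ T}

lemma isRightQuillen_lift (m : CreatedModelStructure U) (m' : CreatedModelStructure U')
    (hR : IsRightQuillen R) (θ : G ⋙ U ≅ U' ⋙ R) :
    letI := m.model
    letI := m'.model
    IsRightQuillen G := by
  let := m.model
  let := m'.model
  have h : IsRightQuillen (G ⋙ U) := IsRightQuillen.of_iso
    ⟨fun p hp ↦ hR.fibration _ ((m'.fibration_iff p).1 hp), fun p hp hp' ↦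
      hR.trivialFibration _ ((m'.fibration_iff p).1 hp) ((m'.weakEquivalence_iff p).1 hp')⟩ θ.symm
  exact ⟨fun p hp ↦ (m.fibration_iff _).2 (h.fibration p hp), fun p hp hp' ↦
    ⟨(m.fibration_iff _).2 (h.fibration p hp),
      (m.weakEquivalence_iff _).2 (h.trivialFibration p hp hp').2⟩⟩

/-- The object of `Glue R` associated with an object of `T`. -/
abbrev Glue.ofAdjunction (adjG : E ⊣ G) (θ : G ⋙ U ≅ U' ⋙ R) (X : T) : Glue R :=
  ⟨U.obj X, U'.obj (E.obj X), U.map (adjG.unit.app X) ≫ θ.hom.app (E.obj X)⟩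

/-- An adjunction between categories with created model structures which lifts a Quillen
equivalence is a Quillen equivalence if the left adjoint agrees up to weak equivalence with
the underlying left adjoint on cofibrant objects. -/
lemma isQuillenEquivalence_lift (m : CreatedModelStructure U) (m' : CreatedModelStructure U')
    (h : IsQuillenEquivalence adj) (adjG : E ⊣ G) (θ : G ⋙ U ≅ U' ⋙ R)
    (hgood : ∀ X : T, m.Cofibrant X → Glue.IsGood adj (Glue.ofAdjunction adjG θ X)) :
    letI := m.model
    letI := m'.model
    IsQuillenEquivalence adjG := by
  let := m.model
  let := m'.model
  refine isQuillenEquivalence_of_weakEquivalence_homEquiv_iff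
    (isRightQuillen_lift m m' h.isRightQuillen θ) fun X Y f hX hY ↦ ?_
  obtain ⟨_, _, hX'⟩ := hgood X hX
  have : IsCofibrant (U.obj X) := ‹_›
  have hU' : IsRightQuillen U' := ⟨fun p hp ↦ (m'.fibration_iff p).1 hp,
    fun p hp hp' ↦ ⟨(m'.fibration_iff p).1 hp, (m'.weakEquivalence_iff p).1 hp'⟩⟩
  have : IsFibrant (U'.obj Y) := hU'.isFibrant_obj m'.adj Y
  let χ : F.obj (U.obj X) ⟶ U'.obj (E.obj X) :=
    (adj.homEquiv _ _).symm (U.map (adjG.unit.app X) ≫ θ.hom.app (E.obj X))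
  have : WeakEquivalence χ := hX'
  -- Up to `θ`, the adjunct of `f` lies over the adjunct of `χ ≫ U'.map f`. As `χ` is a weak
  -- equivalence, the criterion for `adjG` reduces to the one for `adj`.
  have e : U.map (adjG.homEquiv X Y f) ≫ θ.hom.app Y = adj.homEquiv _ _ (χ ≫ U'.map f) := by
    rw [adj.homEquiv_naturality_right, Equiv.apply_symm_apply, adjG.homEquiv_unit, U.map_comp,
      Category.assoc, Category.assoc]
    exact congrArg (_ ≫ ·) (θ.hom.naturality f)
  rw [m.weakEquivalence_iff, m'.weakEquivalence_iff, ← weakEquivalence_postcomp_iff _ (θ.hom.app Y),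
    e, h.weakEquivalence_homEquiv_iff, weakEquivalence_precomp_iff]

end Lift

/-! ### Monoids -/

/-- The initial monoid has the unit as underlying object. -/
lemma Mon.isIso_one_of_isInitial {V : Type*} [Category* V] [MonoidalCategory V] {Z : Mon V}
    (hZ : IsInitial Z) : IsIso (MonObj.one : 𝟙_ V ⟶ Z.X) := by
  have h : IsInitial (Mon.trivial V) := IsInitial.ofUnique _
  let e := (Mon.underlying V).mapIso (h.uniqueUpToIso hZ)
  have : (MonObj.one : 𝟙_ V ⟶ Z.X) = e.hom :=
    (IsMonHom.one_hom (h.uniqueUpToIso hZ).hom.hom).symm.trans (Category.id_comp _)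
  exact this ▸ e.isIso_hom

namespace Glue

section Monoids

variable {C : Type u₁} [Category.{v} C] [MonoidalCategory C] [SymmetricCategory C]
  [MonoidalClosed C] [ModelCategory C] [IsMonoidalModelCategory C]
  {D : Type u₂} [Category.{v} D] [MonoidalCategory D] [SymmetricCategory D]
  [MonoidalClosed D] [ModelCategory D] [IsMonoidalModelCategory D]
  {F : D ⥤ C} {R : C ⥤ D} [R.LaxMonoidal] {adj : F ⊣ R}
  {Lmon : Mon D ⥤ Mon C} (adjMon : Lmon ⊣ R.mapMon)

omit [SymmetricCategory C] [MonoidalClosed C] [IsMonoidalModelCategory C] [SymmetricCategory D]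
  [MonoidalClosed D] [IsMonoidalModelCategory D] in
-- Condition (ii) concerns a cofibrant replacement of the unit; since the unit of `D` is cofibrant,
-- `F` keeps that replacement a weak equivalence, and two-out-of-three applies.
lemma isGood_unit (hR : IsWeakMonoidalQuillenPair adj) (hC : IsCofibrant (𝟙_ C))
    (hD : IsCofibrant (𝟙_ D)) : IsGood adj (𝟙_ (Glue R)) := by
  refine ⟨hD, hC, ?_⟩
  obtain ⟨I, q, _, _, h⟩ := hR.comonoidalUnit_weakEquivalence
  have := hR.isRightQuillen.weakEquivalence_leftAdjoint_map adj q
  exact (weakEquivalence_precomp_iff (F.map q) (comonoidalUnit adj)).1 h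

omit [SymmetricCategory C] [MonoidalClosed C] [IsMonoidalModelCategory C] [SymmetricCategory D]
  [MonoidalClosed D] [IsMonoidalModelCategory D] in
lemma isGood_ofMon_of_isInitial (hR : IsWeakMonoidalQuillenPair adj) (hC : IsCofibrant (𝟙_ C))
    (hD : IsCofibrant (𝟙_ D)) {Z : Mon D} (hZ : IsInitial Z) :
    IsGood adj ((ofMon adjMon).obj Z) := by
  have := adjMon.leftAdjoint_preservesColimits
  have := Mon.isIso_one_of_isInitial hZ
  have := Mon.isIso_one_of_isInitial (IsInitial.isInitialObj Lmon Z hZ)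
  let e : 𝟙_ (Glue R) ≅ (ofMon adjMon).obj Z := Glue.mkIso (asIso MonObj.one) (asIso MonObj.one)
    (IsMonHom.one_hom (adjMon.unit.app Z).hom).symm
  exact (isGood_unit hR hC hD).of_retract hR.isRightQuillen ⟨e.inv, e.hom, by simp⟩

variable [HasColimits C] [HasColimits D]

instance preservesFilteredColimits_ofMon :
    PreservesFilteredColimitsOfSize.{v, v} (ofMon adjMon) where
  preserves_filtered_colimits J _ _ := by
    have := adjMon.leftAdjoint_preservesColimits
    have : PreservesColimitsOfShape J (ofMon adjMon ⋙ leftFunctor R) :=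
      inferInstanceAs (PreservesColimitsOfShape J (Mon.underlying D))
    have : PreservesColimitsOfShape J (ofMon adjMon ⋙ rightFunctor R) :=
      inferInstanceAs (PreservesColimitsOfShape J (Lmon ⋙ Mon.underlying C))
    exact preservesColimitsOfShape_of_components J _

/-- For a cofibrant monoid `B`, the morphism `F B ⟶ Lmon B` is a weak equivalence between
cofibrant objects. -/
lemma isGood_ofMon (hR : IsWeakMonoidalQuillenPair adj) (hC : IsCofibrant (𝟙_ C))
    (hD : IsCofibrant (𝟙_ D)) (m : CreatedModelStructure (Mon.forget D)) (B : Mon D)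
    (hB : m.Cofibrant B) : IsGood adj ((ofMon adjMon).obj B) :=
  isGood_of_cofibrant hR.isRightQuillen m (ofMon adjMon)
    (fun _ hZ ↦ isGood_ofMon_of_isInitial adjMon hR hC hD hZ)
    (fun _ _ f _ _ _ g t j h hX ↦ good_ofMon_map_of_isPushout adjMon hR m.adj f g t j h hX) B hB

end Monoids

end Glue

/-- A pushout along a morphism of free objects is a pushout along a morphism of free objects
induced by a morphism with source the underlying object. -/
lemma exists_isPushout_counit {V T : Type*} [Category* V] [Category* T] [HasPushouts V]
    {L : V ⥤ T} {U : T ⥤ V} (adj : L ⊣ U) {K K' : V} {f : K ⟶ K'} {X Y : T} {g : L.obj K ⟶ X}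
    {t : L.obj K' ⟶ Y} {j : X ⟶ Y} (h : IsPushout (L.map f) g t j) :
    ∃ t', IsPushout (L.map (pushout.inr f (adj.homEquiv _ _ g))) (adj.counit.app X) t' j := by
  have := adj.leftAdjoint_preservesColimits
  have hp := (IsPushout.of_hasPushout f (adj.homEquiv _ _ g)).map L
  have hg : L.map (adj.homEquiv _ _ g) ≫ adj.counit.app X = g :=
    (adj.homEquiv_counit _ _ _).symm.trans (Equiv.symm_apply_apply _ _)
  have w : L.map f ≫ t = L.map (adj.homEquiv _ _ g) ≫ adj.counit.app X ≫ j := by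
    rw [reassoc_of% hg, h.w]
  refine ⟨hp.desc t (adj.counit.app X ≫ j) w, ?_⟩
  refine IsPushout.of_top (h₁₁ := L.map f) ?_ (hp.inr_desc _ _ _) hp
  rw [hg, hp.inl_desc]
  exact h

/-! ### Modules over a monoid in the category of morphisms `X ⟶ R Y` -/

namespace Glue

open RightMod

section Modules

variable {C : Type u₁} [Category.{v} C] [MonoidalCategory C]
  {D : Type u₂} [Category.{v} D] [MonoidalCategory D] {F : D ⥤ C} {R : C ⥤ D} [R.LaxMonoidal]
  (adj : F ⊣ R) {B : Mon D} {B' : Mon C} (h : B ⟶ R.mapMon.obj B')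

/-- The functor from `B'`-modules to `B`-modules induced by `h : B ⟶ R B'`. -/
abbrev modFunctor : RightMod B' ⥤ RightMod B := RightMod.map R B' ⋙ RightMod.restrict h

/-- The functor sending a module to its first component. -/
abbrev modLeftFunctor : RightMod (mkMon h) ⥤ RightMod B where
  obj M := modLeft M
  map f := ⟨f.hom.left, congrArg Hom.left f.act_hom⟩

variable {h} in
/-- The structure morphism of a module, as a morphism of modules. -/
def modHom (M : RightMod (mkMon h)) : modLeft M ⟶ (modFunctor h).obj (modRight M) where
  hom := M.X.hom
  act_hom := by
    let κ : B.X ⟶ R.obj B'.X := h.hom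
    refine M.act.w.symm.trans ?_
    change ((M.X.hom ⊗ₘ κ) ≫ Functor.LaxMonoidal.μ R M.X.right B'.X) ≫ R.map M.act.right =
      M.X.hom ▷ B.X ≫ R.obj M.X.right ◁ κ ≫ Functor.LaxMonoidal.μ R M.X.right B'.X ≫
        R.map M.act.right
    rw [Category.assoc, MonoidalCategory.tensorHom_def_assoc]

variable {h} {E : RightMod B ⥤ RightMod B'} (adjE : E ⊣ modFunctor h)

/-- The module over `mkMon h` associated with a `B`-module `M`, with second component `E M`. -/
def extendObj (M : RightMod B) : RightMod (mkMon h) where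
  X := ⟨M.X, (E.obj M).X, (adjE.unit.app M).hom⟩
  act := ⟨M.act, (E.obj M).act, by
    let κ : B.X ⟶ R.obj B'.X := h.hom
    let η : M.X ⟶ R.obj (E.obj M).X := (adjE.unit.app M).hom
    have := (adjE.unit.app M).act_hom
    refine Eq.trans ?_ this.symm
    change ((η ⊗ₘ κ) ≫ Functor.LaxMonoidal.μ R (E.obj M).X B'.X) ≫ R.map (E.obj M).act =
      η ▷ B.X ≫ R.obj (E.obj M).X ◁ κ ≫ Functor.LaxMonoidal.μ R (E.obj M).X B'.X ≫
        R.map (E.obj M).act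
    rw [Category.assoc, MonoidalCategory.tensorHom_def_assoc]⟩
  act_one := hom_ext M.act_one (E.obj M).act_one
  act_mul := hom_ext M.act_mul (E.obj M).act_mul

/-- The functor `extendObj`. -/
abbrev extend : RightMod B ⥤ RightMod (mkMon h) where
  obj M := extendObj adjE M
  map f :=
    { hom := ⟨f.hom, (E.map f).hom, congrArg RightMod.Hom.hom (adjE.unit.naturality f).symm⟩
      act_hom := hom_ext f.act_hom (E.map f).act_hom }
  map_id M := RightMod.hom_ext (hom_ext rfl (congrArg RightMod.Hom.hom (E.map_id M)))
  map_comp f g := RightMod.hom_ext (hom_ext rfl (congrArg RightMod.Hom.hom (E.map_comp f g)))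

/-- The functor `extend` is left adjoint to `modLeftFunctor`. -/
def extendAdjunction : extend adjE ⊣ modLeftFunctor h := Adjunction.mkOfHomEquiv
  { homEquiv := fun M N ↦
      { toFun := fun f ↦ ⟨f.hom.left, congrArg Hom.left f.act_hom⟩
        invFun := fun f ↦
          { hom := ⟨f.hom, ((adjE.homEquiv _ (modRight N)).symm (f ≫ modHom N)).hom, by
              have := (adjE.homEquiv M (modRight N)).apply_symm_apply (f ≫ modHom N)
              rw [adjE.homEquiv_unit] at this
              exact congrArg RightMod.Hom.hom this⟩
            act_hom := hom_ext f.act_hom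
              ((adjE.homEquiv _ (modRight N)).symm (f ≫ modHom N)).act_hom }
        left_inv := fun f ↦ by
          refine RightMod.hom_ext (hom_ext rfl ?_)
          let f' : E.obj M ⟶ modRight N := ⟨f.hom.right, congrArg Hom.right f.act_hom⟩
          refine congrArg RightMod.Hom.hom (a₂ := f') ?_
          rw [Equiv.symm_apply_eq, adjE.homEquiv_unit]
          exact RightMod.hom_ext f.hom.w.symm
        right_inv := fun f ↦ rfl }
    homEquiv_naturality_left_symm := fun f g ↦ by
      refine RightMod.hom_ext (hom_ext rfl ?_)
      refine congrArg RightMod.Hom.hom (a₂ := E.map f ≫ _) ?_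
      exact (congrArg (adjE.homEquiv _ _).symm (Category.assoc _ _ _)).trans
        (adjE.homEquiv_naturality_left_symm f (g ≫ modHom _))
    homEquiv_naturality_right := fun f g ↦ rfl }

/-- The functor sending `X` to the unit `X ⟶ R (F X)`. -/
abbrev ofUnit : D ⥤ Glue R where
  obj X := ⟨X, F.obj X, adj.unit.app X⟩
  map f := ⟨f, F.map f, (adj.unit.naturality f).symm⟩

/-- The functor `ofUnit` is left adjoint to `leftFunctor R`. -/
def ofUnitAdjunction : ofUnit adj ⊣ leftFunctor R := Adjunction.mkOfHomEquiv
  { homEquiv := fun X Y ↦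
      { toFun := fun f ↦ f.left
        invFun := fun f ↦ ⟨f, (adj.homEquiv _ _).symm (f ≫ Y.hom), by
          rw [← adj.homEquiv_unit, Equiv.apply_symm_apply]⟩
        left_inv := fun f ↦ by
          refine hom_ext rfl ?_
          change (adj.homEquiv _ _).symm (f.left ≫ Y.hom) = f.right
          rw [Equiv.symm_apply_eq, adj.homEquiv_unit]
          exact f.w.symm
        right_inv := fun f ↦ rfl }
    homEquiv_naturality_left_symm := fun f g ↦ by
      refine hom_ext rfl ?_
      exact (congrArg (adj.homEquiv _ _).symm (Category.assoc _ _ _)).trans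
        (adj.homEquiv_naturality_left_symm _ _)
    homEquiv_naturality_right := fun f g ↦ rfl }

/-- The value of `extend` on free modules. -/
noncomputable def extendIso {T : D ⥤ RightMod B} (adjT : T ⊣ underlying B) :
    T ⋙ extend adjE ≅ ofUnit adj ⋙ free (mkMon h) :=
  (adjT.comp (extendAdjunction adjE)).leftAdjointUniq
    ((ofUnitAdjunction adj).comp (freeAdjunction (mkMon h)))

end Modules

section Unit

variable {C : Type u₁} [Category.{v} C] [ModelCategory C] {D : Type u₂} [Category.{v} D]
  [ModelCategory D] {F : D ⥤ C} {R : C ⥤ D} {adj : F ⊣ R}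

lemma isGood_ofUnit (hR : IsRightQuillen R) (X : D) [IsCofibrant X] :
    IsGood adj ((ofUnit adj).obj X) := by
  refine ⟨‹_›, hR.isCofibrant_obj adj X, ?_⟩
  have : (adj.homEquiv X (F.obj X)).symm (adj.unit.app X) = 𝟙 _ := by
    rw [Equiv.symm_apply_eq, adj.homEquiv_id]
  exact this ▸ inferInstance

end Unit

section ModelCategory

variable {C : Type u₁} [Category.{v} C] [MonoidalCategory C] [SymmetricCategory C]
  [MonoidalClosed C] [ModelCategory C] [IsMonoidalModelCategory C]
  {D : Type u₂} [Category.{v} D] [MonoidalCategory D] [SymmetricCategory D]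
  [MonoidalClosed D] [ModelCategory D] [IsMonoidalModelCategory D]
  {F : D ⥤ C} {R : C ⥤ D} [R.LaxMonoidal] {adj : F ⊣ R}
  {B : Mon D} {B' : Mon C} {h : B ⟶ R.mapMon.obj B'}
  {E : RightMod B ⥤ RightMod B'} (adjE : E ⊣ modFunctor h)

/-- The functor sending a `B`-module `M` to `M ⟶ R (E M)`. -/
abbrev ofMod : RightMod B ⥤ Glue R := extend adjE ⋙ underlying (mkMon h)

instance preservesColimitsOfShape_ofMod (J : Type*) [Category* J] [HasColimitsOfShape J C]
    [HasColimitsOfShape J D] : PreservesColimitsOfShape J (ofMod adjE) := by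
  have := (extendAdjunction adjE).leftAdjoint_preservesColimits
  infer_instance

/-- `ofMod` preserves pushouts and sends a free cell to the tensor product of `ofUnit` of that cell
with the good object `mkMon h`. -/
lemma good_ofMod_map_of_isPushout (hR : IsWeakMonoidalQuillenPair adj)
    (hh : IsGood adj (mkMon h).X) {T : D ⥤ RightMod B} (adjT : T ⊣ underlying B) {K L : D}
    (f : K ⟶ L) [Cofibration f] {X Y : RightMod B} (g : T.obj K ⟶ X) (t : T.obj L ⟶ Y) (j : X ⟶ Y)
    (hp : IsPushout (T.map f) g t j) (hX : IsGood adj ((ofMod adjE).obj X)) :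
    good adj ((ofMod adjE).map j) := by
  -- Neither `K` nor `L` need be cofibrant. Re-expressing the pushout along the counit replaces `f`
  -- by a cofibration out of `X.X`, which is cofibrant.
  obtain ⟨t', hp'⟩ := exists_isPushout_counit adjT hp
  let i : X.X ⟶ _ := pushout.inr f (adjT.homEquiv _ _ g)
  have : IsCofibrant X.X := hX.left
  have : Cofibration i := inferInstanceAs (Cofibration (pushout.inr _ _))
  have hL : IsCofibrant (pushout f (adjT.homEquiv _ _ g)) := isCofibrant_of_cofibration i
  refine MorphismProperty.of_isPushout (hp'.map (ofMod adjE)).flip ?_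
  have e : Arrow.mk ((ofMod adjE).map (T.map i)) ≅
      Arrow.mk ((ofUnit adj).map i ▷ (mkMon h).X) :=
    Arrow.isoMk ((underlying _).mapIso ((extendIso adj adjE adjT).app X.X))
    ((underlying _).mapIso ((extendIso adj adjE adjT).app _))
    (congrArg RightMod.Hom.hom ((extendIso adj adjE adjT).hom.naturality i).symm)
  refine ((good adj).arrow_mk_iso_iff e).2 ?_
  have : Cofibration ((ofUnit adj).map i).left := ‹Cofibration i›
  have : Cofibration ((ofUnit adj).map i).right := hR.isRightQuillen.cofibration_map adj i
  exact good_whiskerRight hR (isGood_ofUnit hR.isRightQuillen _) hh _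
    (good_of_cofibration hR.isRightQuillen ((ofUnit adj).map i)
      (isGood_ofUnit hR.isRightQuillen _) (isGood_ofUnit hR.isRightQuillen _).weakEquivalence)

variable [HasColimits C] [HasColimits D]

instance preservesFilteredColimits_ofMod :
    PreservesFilteredColimitsOfSize.{v, v} (ofMod adjE) where
  preserves_filtered_colimits _ _ _ := inferInstance

lemma isGood_ofMod (hR : IsWeakMonoidalQuillenPair adj) (hh : IsGood adj (mkMon h).X)
    (m : CreatedModelStructure (RightMod.forget B)) (M : RightMod B) (hM : m.Cofibrant M) :
    IsGood adj ((ofMod adjE).obj M) :=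
  isGood_of_cofibrant hR.isRightQuillen m (ofMod adjE)
    (fun Z hZ ↦ isGood_of_good_of_isInitial adj (IsInitial.isInitialObj (ofMod adjE) Z hZ) (𝟙 _)
      (MorphismProperty.id_mem _ _))
    (fun _ _ f _ _ _ g t j hp hX ↦ good_ofMod_map_of_isPushout adjE hR hh m.adj f g t j hp hX)
    M hM

end ModelCategory

end Glue

/-! ### Existence of left adjoints -/

section LeftAdjoints

variable {T : Type u} [Category.{v} T] {V : Type u'} [Category.{v} V]

/-- The counit of an adjunction is a regular epimorphism if the right adjoint `U` is faithful and
allows to lift morphisms along `U`-split epimorphisms. -/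
noncomputable def regularEpiCounit {L : V ⥤ T} {U : T ⥤ V} [U.Faithful] (adj : L ⊣ U)
    (h : ∀ ⦃X Y Z : T⦄ (e : X ⟶ Y) (g : X ⟶ Z) (t : U.obj Y ⟶ U.obj Z), IsSplitEpi (U.map e) →
      U.map e ≫ t = U.map g → ∃ t', U.map t' = t) (X : T) : RegularEpi (adj.counit.app X) where
  W := L.obj (U.obj (L.obj (U.obj X)))
  left := L.map (U.map (adj.counit.app X))
  right := adj.counit.app (L.obj (U.obj X))
  w := adj.counit_naturality _
  isColimit := by
    have split : IsSplitEpi (U.map (adj.counit.app X)) :=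
      ⟨⟨⟨adj.unit.app _, adj.right_triangle_components X⟩⟩⟩
    have (s : Cofork (L.map (U.map (adj.counit.app X))) (adj.counit.app (L.obj (U.obj X)))) :
        ∃ t, adj.counit.app X ≫ t = s.π := by
      -- The unit splits the counit after `U`, which gives the factorization on underlying objects;
      -- `h` lifts it to `T`.
      have e : U.map (adj.counit.app X) ≫ adj.unit.app (U.obj X) ≫ U.map s.π = U.map s.π := by
        have := adj.unit_naturality_assoc (U.map (adj.counit.app X)) (U.map s.π)
        rw [← U.map_comp, s.condition, U.map_comp] at this
        refine this.symm.trans ?_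
        rw [← Category.assoc]
        exact (congrArg (· ≫ U.map s.π) (adj.right_triangle_components _)).trans
          (Category.id_comp _)
      obtain ⟨t, ht⟩ := h _ _ _ split e
      exact ⟨t, U.map_injective (by rw [U.map_comp, ht, e])⟩
    refine Cofork.IsColimit.mk _ (fun s ↦ (this s).choose) (fun s ↦ (this s).choose_spec) ?_
    intro s m hm
    apply U.map_injective
    rw [← cancel_epi (U.map (adj.counit.app X)), ← U.map_comp, ← U.map_comp, (this s).choose_spec]
    exact congrArg U.map hm

end LeftAdjoints

section

variable {V : Type u} [Category.{v} V] [MonoidalCategory V]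

instance : (Mon.underlying V).Faithful := ⟨fun h ↦ Mon.Hom.ext' h⟩

instance (B : Mon V) : (RightMod.underlying B).Faithful := ⟨fun h ↦ RightMod.hom_ext h⟩

/-- The tensor square of a split epimorphism is still an epimorphism, so multiplicativity of `t` may
be checked on `X`. -/
lemma Mon.exists_lift {X Y Z : Mon V} (e : X ⟶ Y) (g : X ⟶ Z) (t : Y.X ⟶ Z.X)
    (he : IsSplitEpi e.hom) (h : e.hom ≫ t = g.hom) :
    ∃ t' : Y ⟶ Z, (Mon.underlying V).map t' = t := by
  refine ⟨{ hom := t, isMonHom_hom := ⟨?_, ?_⟩ }, rfl⟩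
  · have := IsMonHom.one_hom g.hom
    rwa [← h, IsMonHom.one_hom_assoc] at this
  · have := IsMonHom.mul_hom g.hom
    have he' : IsSplitEpi (e.hom ⊗ₘ e.hom) := ⟨⟨⟨section_ e.hom ⊗ₘ section_ e.hom, by
      rw [MonoidalCategory.tensorHom_comp_tensorHom, IsSplitEpi.id, id_tensorHom_id]⟩⟩⟩
    rwa [← h, IsMonHom.mul_hom_assoc, ← MonoidalCategory.tensorHom_comp_tensorHom_assoc,
      cancel_epi] at this

lemma RightMod.exists_lift {B : Mon V} {X Y Z : RightMod B} (e : X ⟶ Y) (g : X ⟶ Z)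
    (t : Y.X ⟶ Z.X) (he : IsSplitEpi e.hom) (h : e.hom ≫ t = g.hom) :
    ∃ t' : Y ⟶ Z, (underlying B).map t' = t := by
  refine ⟨⟨t, ?_⟩, rfl⟩
  have := g.act_hom
  have he' : IsSplitEpi (e.hom ▷ B.X) := ⟨⟨⟨section_ e.hom ▷ B.X, by
    rw [← comp_whiskerRight, IsSplitEpi.id, id_whiskerRight]⟩⟩⟩
  rwa [← h, reassoc_of% e.act_hom, comp_whiskerRight_assoc, cancel_epi] at this

end

section

variable {C : Type u₁} [Category.{v} C] [MonoidalCategory C]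
  {D : Type u₂} [Category.{v} D] [MonoidalCategory D] {F : D ⥤ C} {R : C ⥤ D} [R.LaxMonoidal]
  (adj : F ⊣ R)

include adj

/-- The functor between categories of monoids induced by `R` has a left adjoint. -/
lemma isRightAdjoint_mapMon {S : C ⥤ Mon C} (adjS : S ⊣ Mon.underlying C) {T : D ⥤ Mon D}
    (adjT : T ⊣ Mon.underlying D) [HasReflexiveCoequalizers (Mon C)] :
    (R.mapMon).IsRightAdjoint := by
  -- Passing to `D` factors through `C`, where both functors are right adjoints. The adjoint
  -- triangle theorem then lifts the left adjoint to monoids.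
  have : (R.mapMon ⋙ Mon.underlying D).IsRightAdjoint := (adj.comp adjS).isRightAdjoint
  exact isRightAdjoint_triangle_lift R.mapMon adjT
    (regularEpiCounit adjT fun _ _ _ ↦ Mon.exists_lift)

/-- The functor between categories of modules induced by a morphism `B ⟶ R B'` has a left
adjoint. -/
lemma isRightAdjoint_modFunctor {B : Mon D} {B' : Mon C} (h : B ⟶ R.mapMon.obj B')
    [HasCoequalizers C]
    [∀ X : C, PreservesColimitsOfShape WalkingParallelPair (tensorRight X)] :
    (Glue.modFunctor h).IsRightAdjoint := by
  have : (Glue.modFunctor h ⋙ RightMod.underlying B).IsRightAdjoint :=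
    (adj.comp (RightMod.freeAdjunction B')).isRightAdjoint
  have : HasCoequalizers (RightMod B') := inferInstance
  exact isRightAdjoint_triangle_lift _ (RightMod.freeAdjunction B)
    (regularEpiCounit _ fun _ _ _ ↦ RightMod.exists_lift)

end

/-! ### Quillen equivalences for monoids and for modules over a cofibrant monoid -/

section Main

variable {C : Type u₁} [Category.{v} C] [HasColimits C] [MonoidalCategory C] [SymmetricCategory C]
  [MonoidalClosed C] [ModelCategory C] [IsMonoidalModelCategory C]
  {D : Type u₂} [Category.{v} D] [HasColimits D] [MonoidalCategory D] [SymmetricCategory D]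
  [MonoidalClosed D] [ModelCategory D] [IsMonoidalModelCategory D]
  {F : D ⥤ C} {R : C ⥤ D} [R.LaxMonoidal] {adj : F ⊣ R}
  (hR : IsWeakMonoidalQuillenEquivalence adj)
  (hC : IsCofibrant (𝟙_ C)) (hD : IsCofibrant (𝟙_ D))

include hR hC hD

/-- Quillen equivalence between the categories of monoids. -/
lemma isQuillenEquivalence_mapMon (mC : CreatedModelStructure (Mon.forget C))
    (mD : CreatedModelStructure (Mon.forget D)) {Lmon : Mon D ⥤ Mon C}
    (adjMon : Lmon ⊣ R.mapMon) :
    letI := mC.model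
    letI := mD.model
    IsQuillenEquivalence adjMon :=
  isQuillenEquivalence_lift mD mC hR.isQuillenEquivalence adjMon (Iso.refl _) fun B hB ↦ by
    have := Glue.isGood_ofMon adjMon hR.isWeakMonoidalQuillenPair hC hD mD B hB
    refine ⟨this.left, this.right, ?_⟩
    change WeakEquivalence ((adj.homEquiv _ _).symm (monUnit adjMon B ≫ 𝟙 _))
    rw [Category.comp_id]
    exact this.weakEquivalence

/-- Quillen equivalence between the categories of modules over a cofibrant monoid and over its
image. -/
lemma isRightQuillenEquivalence_modFunctor (mD : CreatedModelStructure (Mon.forget D))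
    {Lmon : Mon D ⥤ Mon C} (adjMon : Lmon ⊣ R.mapMon) (B : Mon D) (hB : mD.Cofibrant B)
    (mB : CreatedModelStructure (RightMod.forget B))
    (mLB : CreatedModelStructure (RightMod.forget (Lmon.obj B))) :
    IsRightQuillenEquivalence mLB.model mB.model (Glue.modFunctor (adjMon.unit.app B)) := by
  have hB' := Glue.isGood_ofMon adjMon hR.isWeakMonoidalQuillenPair hC hD mD B hB
  have := isRightAdjoint_modFunctor adj (adjMon.unit.app B)
  let adjE := Adjunction.ofIsRightAdjoint (Glue.modFunctor (adjMon.unit.app B))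
  refine ⟨_, adjE, ?_⟩
  refine isQuillenEquivalence_lift mB mLB hR.isQuillenEquivalence adjE (Iso.refl _) fun M hM ↦ ?_
  have := Glue.isGood_ofMod adjE hR.isWeakMonoidalQuillenPair hB' mB M hM
  refine ⟨this.left, this.right, ?_⟩
  change WeakEquivalence ((adj.homEquiv _ _).symm (((Glue.ofMod adjE).obj M).hom ≫ 𝟙 _))
  rw [Category.comp_id]
  exact this.weakEquivalence

lemma isRightQuillenEquivalence_mapMon (mC : CreatedModelStructure (Mon.forget C))
    (mD : CreatedModelStructure (Mon.forget D)) :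
    IsRightQuillenEquivalence mC.model mD.model R.mapMon := by
  have : HasReflexiveCoequalizers (Mon C) := by
    -- The model structure on `Mon C` supplies the reflexive coequalizers.
    let := mC.model
    infer_instance
  have := isRightAdjoint_mapMon adj mC.adj mD.adj
  exact ⟨_, _, isQuillenEquivalence_mapMon hR hC hD mC mD (Adjunction.ofIsRightAdjoint R.mapMon)⟩

end Main

/-! ### Composition and cancellation of Quillen equivalences -/

section Compose

variable {C : Type*} [Category.{v} C] [ModelCategory C] {D : Type*} [Category.{v} D]
  [ModelCategory D]

lemma IsQuillenEquivalence.of_iso {F F' : D ⥤ C} {G G' : C ⥤ D} {adj : F ⊣ G}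
    (h : IsQuillenEquivalence adj) (e : G ≅ G') (adj' : F' ⊣ G') : IsQuillenEquivalence adj' := by
  refine isQuillenEquivalence_of_weakEquivalence_homEquiv_iff (h.isRightQuillen.of_iso e)
    fun X Y f _ _ ↦ ?_
  let α := (adj.ofNatIsoRight e).leftAdjointUniq adj'
  have : adj'.homEquiv X Y f = adj.homEquiv X Y (α.hom.app X ≫ f) ≫ e.hom.app Y := by
    have h₁ := Adjunction.homEquiv_leftAdjointUniq_hom_app (adj.ofNatIsoRight e) adj' X
    rw [adj'.homEquiv_unit, ← h₁, ← Adjunction.homEquiv_naturality_right]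
    exact adj.homEquiv_ofNatIsoRight_apply e _
  rw [this, weakEquivalence_postcomp_iff, h.weakEquivalence_homEquiv_iff,
    weakEquivalence_precomp_iff]

variable {E : Type*} [Category.{v} E] [ModelCategory E] {F : D ⥤ C} {G : C ⥤ D} {adj : F ⊣ G}
  {F' : E ⥤ D} {G' : D ⥤ E} {adj' : F' ⊣ G'}

lemma IsQuillenEquivalence.comp (h : IsQuillenEquivalence adj) (h' : IsQuillenEquivalence adj') :
    IsQuillenEquivalence (adj'.comp adj) := by
  refine isQuillenEquivalence_of_weakEquivalence_homEquiv_iff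
    ⟨fun p hp ↦ h'.isRightQuillen.fibration _ (h.isRightQuillen.fibration p hp),
      fun p hp hp' ↦ ?_⟩ fun X Y f _ _ ↦ ?_
  · have := h.isRightQuillen.trivialFibration p hp hp'
    exact h'.isRightQuillen.trivialFibration _ this.1 this.2
  · have := h.isRightQuillen.isFibrant_obj adj Y
    have := h'.isRightQuillen.isCofibrant_obj adj' X
    rw [Adjunction.comp_homEquiv]
    exact (h'.weakEquivalence_homEquiv_iff _).trans (h.weakEquivalence_homEquiv_iff _)

/-- If `G ⋙ G'` and `G'` are Quillen equivalences, and `G'` detects weak equivalences, then `G`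
is a Quillen equivalence. -/
lemma IsQuillenEquivalence.of_comp (hG : IsRightQuillen G)
    (h : IsQuillenEquivalence (adj'.comp adj))
    (h' : IsQuillenEquivalence adj')
    (hG' : ∀ {X Y : D} (f : X ⟶ Y), WeakEquivalence (G'.map f) ↔ WeakEquivalence f) :
    IsQuillenEquivalence adj := by
  refine isQuillenEquivalence_of_weakEquivalence_homEquiv_iff hG fun X Y f _ _ ↦ ?_
  -- The criterion for the composite only tests objects `F'.obj X'`. Since `G'` detects weak
  -- equivalences, the adjunct `w'` of this replacement is a weak equivalence, so `X` may be
  -- replaced by such an object.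
  obtain ⟨X', w, _, _, _⟩ := exists_cofibrant_replacement (G'.obj X)
  obtain ⟨Xf, r, _, _, _⟩ := exists_fibrant_replacement X
  have := h'.isRightQuillen.isCofibrant_obj adj' X'
  let w' : F'.obj X' ⟶ X := (adj'.homEquiv _ _).symm w
  have : WeakEquivalence w' := by
    rw [← weakEquivalence_postcomp_iff w' r, ← h'.weakEquivalence_homEquiv_iff,
      adj'.homEquiv_naturality_right, Equiv.apply_symm_apply]
    have := (hG' r).2 ‹_›
    infer_instance
  have := hG.weakEquivalence_leftAdjoint_map adj w'
  rw [← weakEquivalence_precomp_iff (F.map w') f]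
  refine Iff.trans ?_ (h.weakEquivalence_homEquiv_iff _)
  have e : (adj'.comp adj).homEquiv _ _ (F.map w' ≫ f) =
      w ≫ G'.map (adj.homEquiv _ _ f) := by
    rw [Adjunction.comp_homEquiv]
    change adj'.homEquiv _ _ (adj.homEquiv _ _ (F.map w' ≫ f)) = _
    rw [adj.homEquiv_naturality_left, adj'.homEquiv_naturality_right, Equiv.apply_symm_apply]
  rw [e, weakEquivalence_precomp_iff, hG']

end Compose

section

variable {C : Type u₁} [Category.{v} C] [MonoidalCategory C]
  {D : Type u₂} [Category.{v} D] [MonoidalCategory D] {F : D ⥤ C} {R : C ⥤ D} [R.LaxMonoidal]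

/-- The functor between categories of modules induced by `R` has a left adjoint. -/
lemma isRightAdjoint_map (adj : F ⊣ R) (A : Mon C) [HasCoequalizers C]
    [∀ X : C, PreservesColimitsOfShape WalkingParallelPair (tensorRight X)] :
    (RightMod.map R A).IsRightAdjoint := by
  have : (RightMod.map R A ⋙ RightMod.underlying _).IsRightAdjoint :=
    (adj.comp (RightMod.freeAdjunction A)).isRightAdjoint
  have : HasCoequalizers (RightMod A) := inferInstance
  exact isRightAdjoint_triangle_lift _ (RightMod.freeAdjunction _)
    (regularEpiCounit _ fun _ _ _ ↦ RightMod.exists_lift)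

/-- Compatibility of the functors between module categories with restriction of scalars. -/
def restrictIso {A A' : Mon C} {B : Mon D} (f : A' ⟶ A) (h : B ⟶ R.mapMon.obj A')
    (p : B ⟶ R.mapMon.obj A) (w : h ≫ R.mapMon.map f = p) :
    RightMod.restrict f ⋙ Glue.modFunctor h ≅ RightMod.map R A ⋙ RightMod.restrict p :=
  NatIso.ofComponents (fun M ↦ RightMod.mkIso (Iso.refl _) (by
    subst w
    let κ : B.X ⟶ R.obj A'.X := h.hom
    change (R.obj M.X ◁ κ ≫ Functor.LaxMonoidal.μ R M.X A'.X ≫ R.map (M.X ◁ f.hom ≫ M.act)) ≫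
      𝟙 _ = 𝟙 _ ▷ B.X ≫ R.obj M.X ◁ (κ ≫ R.map f.hom) ≫ Functor.LaxMonoidal.μ R M.X A.X ≫
        R.map M.act
    simp))
    fun g ↦ RightMod.hom_ext ((Category.comp_id _).trans (Category.id_comp _).symm)

end

/-! ### Quillen equivalences for modules over `A` and over `R A` -/

section Main

variable {C : Type u₁} [Category.{v} C] [HasColimits C] [MonoidalCategory C] [SymmetricCategory C]
  [MonoidalClosed C] [ModelCategory C] [IsMonoidalModelCategory C]
  {D : Type u₂} [Category.{v} D] [HasColimits D] [MonoidalCategory D] [SymmetricCategory D]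
  [MonoidalClosed D] [ModelCategory D] [IsMonoidalModelCategory D]
  {F : D ⥤ C} {R : C ⥤ D} [R.LaxMonoidal] {adj : F ⊣ R}
  (hR : IsWeakMonoidalQuillenEquivalence adj)
  (hC : IsCofibrant (𝟙_ C)) (hD : IsCofibrant (𝟙_ D))

include hR hC hD

/-- A monoid `A` admits a weak equivalence from the image of a cofibrant monoid `B` with adjunct
a weak equivalence, if it is fibrant or if `R` preserves weak equivalences of monoids. -/
lemma exists_cofibrant_monoid (mC : CreatedModelStructure (Mon.forget C))
    (mD : CreatedModelStructure (Mon.forget D)) {Lmon : Mon D ⥤ Mon C}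
    (adjMon : Lmon ⊣ R.mapMon) (A : Mon C)
    (hA : mC.Fibrant A ∨ ∀ (A₁ A₂ : Mon C) (f : A₁ ⟶ A₂), WeakEquivalence f.hom →
      WeakEquivalence (R.mapMon.map f).hom) :
    ∃ (B : Mon D) (f : Lmon.obj B ⟶ A), mD.Cofibrant B ∧ WeakEquivalence f.hom ∧
      WeakEquivalence (adjMon.homEquiv _ _ f).hom := by
  let := mC.model
  let := mD.model
  have h := isQuillenEquivalence_mapMon hR hC hD mC mD adjMon
  have hwC {X Y : Mon C} (f : X ⟶ Y) : WeakEquivalence f ↔ WeakEquivalence f.hom :=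
    mC.weakEquivalence_iff f
  have hwD {X Y : Mon D} (f : X ⟶ Y) : WeakEquivalence f ↔ WeakEquivalence f.hom :=
    mD.weakEquivalence_iff f
  obtain ⟨B, p, hB, -, hp⟩ := exists_cofibrant_replacement (R.mapMon.obj A)
  refine ⟨B, (adjMon.homEquiv _ _).symm p, hB, ?_, by rwa [Equiv.apply_symm_apply, ← hwD]⟩
  rw [← hwC]
  obtain hA | hA := hA
  · have : IsFibrant A := hA
    rwa [← h.weakEquivalence_homEquiv_iff, Equiv.apply_symm_apply]
  -- Without fibrancy of `A`, the criterion is applied to a fibrant replacement `r`, which `R` keeps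
  -- a weak equivalence.
  · obtain ⟨A', r, _, -, hr⟩ := exists_fibrant_replacement A
    have : WeakEquivalence (R.mapMon.map r) := (hwD _).2 (hA _ _ _ ((hwC _).1 hr))
    rw [← weakEquivalence_postcomp_iff _ r, ← h.weakEquivalence_homEquiv_iff,
      adjMon.homEquiv_naturality_right, Equiv.apply_symm_apply]
    infer_instance

/-- Quillen equivalence between the categories of modules over `A` and over `R A`. -/
lemma isRightQuillenEquivalence_map (mC : CreatedModelStructure (Mon.forget C))
    (mD : CreatedModelStructure (Mon.forget D))
    (mModC : ∀ A : Mon C, CreatedModelStructure (RightMod.forget A))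
    (mModD : ∀ B : Mon D, CreatedModelStructure (RightMod.forget B))
    (qC : QuillenInvariance mModC) (qD : QuillenInvariance mModD) (A : Mon C)
    (hA : mC.Fibrant A ∨ ∀ (A₁ A₂ : Mon C) (f : A₁ ⟶ A₂), WeakEquivalence f.hom →
      WeakEquivalence (R.mapMon.map f).hom) :
    IsRightQuillenEquivalence (mModC A).model (mModD (R.mapMon.obj A)).model
      (RightMod.map R A) := by
  obtain ⟨Lmon, adjMon, -⟩ := isRightQuillenEquivalence_mapMon hR hC hD mC mD
  obtain ⟨B, f, hB, hf, hp⟩ := exists_cofibrant_monoid hR hC hD mC mD adjMon A hA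
  obtain ⟨_, adj₁, h₁⟩ := qC _ _ f hf
  obtain ⟨_, adj₂, h₂⟩ := isRightQuillenEquivalence_modFunctor hR hC hD mD adjMon B hB (mModD B)
    (mModC _)
  obtain ⟨_, adj₃, h₃⟩ := qD _ _ _ hp
  have := isRightAdjoint_map adj A
  let adj₄ := Adjunction.ofIsRightAdjoint (RightMod.map R A)
  refine ⟨_, adj₄, ?_⟩
  let := (mModC A).model
  let := (mModC (Lmon.obj B)).model
  let := (mModD B).model
  let := (mModD (R.mapMon.obj A)).model
  -- There are two routes from `A`-modules to `B`-modules: through modules over `Lmon B` and through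
  -- modules over `R A`. They agree; the first is a Quillen equivalence by invariance in `C` and the
  -- cofibrant case. The second ends with a Quillen equivalence by invariance in `D`, which is
  -- cancelled.
  refine IsQuillenEquivalence.of_comp
    (isRightQuillen_lift _ _ hR.isQuillenEquivalence.isRightQuillen (Iso.refl _)) ((h₁.comp h₂).of_iso (restrictIso f _ _ (adjMon.homEquiv_unit ..).symm) _) h₃ ?_
  intro M N g
  exact ((mModD B).weakEquivalence_iff _).trans ((mModD _).weakEquivalence_iff g).symm

end Main

theorem mainTheorem2
    {C : Type u₁} [Category.{v} C] [HasColimits C] [MonoidalCategory C] [SymmetricCategory C]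
    [MonoidalClosed C] [ModelCategory C] [IsMonoidalModelCategory C]
    {D : Type u₂} [Category.{v} D] [HasColimits D] [MonoidalCategory D] [SymmetricCategory D]
    [MonoidalClosed D] [ModelCategory D] [IsMonoidalModelCategory D]
    (F : D ⥤ C) (R : C ⥤ D) [R.LaxMonoidal] (adj : F ⊣ R)
    (hR : IsWeakMonoidalQuillenEquivalence adj)
    (hC : IsCofibrant (𝟙_ C)) (hD : IsCofibrant (𝟙_ D)) :
    -- modules over a cofibrant monoid `B` in `D` and over `Lmon B`
    (∀ (mMonD : CreatedModelStructure (Mon.forget D))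
      (Lmon : Mon D ⥤ Mon C) (adjMon : Lmon ⊣ R.mapMon)
      (B : Mon D), mMonD.Cofibrant B →
      ∀ (mB : CreatedModelStructure (RightMod.forget B))
        (mLB : CreatedModelStructure (RightMod.forget (Lmon.obj B))),
        IsRightQuillenEquivalence mLB.model mB.model
          (RightMod.map R (Lmon.obj B) ⋙ RightMod.restrict (adjMon.unit.app B))) ∧
    -- modules over a monoid `A` in `C` and over `R A`
    (∀ (mMonC : CreatedModelStructure (Mon.forget C))
      (_ : CreatedModelStructure (Mon.forget D))
      (mModC : ∀ A : Mon C, CreatedModelStructure (RightMod.forget A))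
      (mModD : ∀ B : Mon D, CreatedModelStructure (RightMod.forget B)),
      QuillenInvariance mModC → QuillenInvariance mModD →
      ∀ A : Mon C,
        (mMonC.Fibrant A ∨
          ∀ (A₁ A₂ : Mon C) (f : A₁ ⟶ A₂), WeakEquivalence f.hom →
            WeakEquivalence (R.mapMon.map f).hom) →
        IsRightQuillenEquivalence (mModC A).model (mModD (R.mapMon.obj A)).model
          (RightMod.map R A)) ∧
    -- monoids
    (∀ (mMonC : CreatedModelStructure (Mon.forget C))
      (mMonD : CreatedModelStructure (Mon.forget D)),
      IsRightQuillenEquivalence mMonC.model mMonD.model R.mapMon) := by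
  exact ⟨fun mMonD _ adjMon B hB mB mLB ↦
      isRightQuillenEquivalence_modFunctor hR hC hD mMonD adjMon B hB mB mLB,
    fun mMonC mMonD mModC mModD qC qD A hA ↦
      isRightQuillenEquivalence_map hR hC hD mMonC mMonD mModC mModD qC qD A hA,
    fun mMonC mMonD ↦ isRightQuillenEquivalence_mapMon hR hC hD mMonC mMonD⟩
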